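/- Let $(M,\omega,\theta)$ be a locally conformal symplectic manifold: $M$ is a smooth manifold, $\omega$ is a smooth non-degenerate $2$-form on $M$, and $\theta$ (the Lee form) is a smooth closed $1$-form with $d\omega=\theta\wedge\omega$. Let $i:Z\hookrightarrow M$ be a compact embedded submanifold such that $i^*\omega$ is non-degenerate and $i^*\theta$ is exact. Let $\mathcal N=\{v\in T_pM : p\in Z,\ \omega(v,u)=0 \text{ for all } u\in T_pZ\}\cong TM|_Z/TZ$ be the normal bundle of $Z$, with any smooth complex structure $I$ compatible with $\omega$ (that is, $\omega(Iv,Iw)=\omega(v,w)$, and $\omega(v,Iv)>0$ for $v\neq 0$). Let $\varphi:D\to M$ be any tubular neighbourhood of $Z$: $D\subset\mathcal N$ is an open neighbourhood of the zero section, and $\varphi$ is a diffeomorphism onto an open subset of $M$ which is $i$ on the zero section and whose normal derivative there induces the identity of $TM|_Z/TZ$. Let $\pi:\tilde M\to M$ be the blow-up of $M$ along $Z$ constructed with these choices. That is, let $\mathbb P(\mathcal N)$ be the complex projectivization of $\mathcal N$, let $L=\{(\ell,v)\in\mathbb P(\mathcal N)\times\mathcal N : v\in\ell\}$ be its tautological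 line bundle, and let $\tilde D=\{(\ell,v)\in L: v\in D\}$. Then $\tilde M$ is the smooth manifold obtained by gluing $M\setminus Z$ and $\tilde D$ along $\varphi(D)\setminus Z\cong \tilde D\setminus\mathbb P(\mathcal N)$ through $(\ell,v)\mapsto\varphi(v)$, and $\pi$ is the inclusion on $M\setminus Z$ and $(\ell,v)\mapsto\varphi(v)$ on $\tilde D$. Then there is a smooth non-degenerate $2$-form $\tilde\omega$ on $\tilde M$ such that $(\tilde M,\tilde\omega,\pi^*\theta)$ is a locally conformal symplectic manifold; that is, $\pi^*\theta$ is closed and $d\tilde\omega=\pi^*\theta\wedge\tilde\omega$. -/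

import Mathlib

open scoped Manifold ContDiff
open Bundle (TotalSpace)

noncomputable section

namespace LCS

/-! ### Differential forms on manifolds without boundary -/

section Forms

variable {E : Type*} [NormedAddCommGroup E] [NormedSpace ℝ E]
  {M : Type*} [TopologicalSpace M] [ChartedSpace E M]
  {E' : Type*} [NormedAddCommGroup E'] [NormedSpace ℝ E']
  {M' : Type*} [TopologicalSpace M'] [ChartedSpace E' M']
  {k : ℕ}

/-- A (not necessarily smooth) differential `k`-form on the manifold `M`, modelled on `E`:
an alternating `k`-linear form on every tangent space. -/
abbrev DiffForm (E : Type*) [NormedAddCommGroup E] [NormedSpace ℝ E]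
    (M : Type*) [TopologicalSpace M] [ChartedSpace E M] (k : ℕ) : Type _ :=
  ∀ x : M, TangentSpace 𝓘(ℝ, E) x [⋀^Fin k]→L[ℝ] ℝ

/-- The pullback `f^* α`. -/
def DiffForm.pullback (f : M → M') (α : DiffForm E' M' k) : DiffForm E M k :=
  fun x => (α (f x)).compContinuousLinearMap (mfderiv 𝓘(ℝ, E) 𝓘(ℝ, E') f x)

/-- The expression of `α` in the preferred chart at `x₀`: the form on the target of the chart
obtained by pulling `α` back along the inverse of the chart. -/
def DiffForm.inChart (α : DiffForm E M k) (x₀ : M) (y : E) : E [⋀^Fin k]→L[ℝ] ℝ :=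
  DiffForm.pullback (E := E) (M := E) (extChartAt 𝓘(ℝ, E) x₀).symm α y

/-- `α` is smooth: its coefficients in charts are `C^∞`. -/
def DiffForm.IsSmooth (α : DiffForm E M k) : Prop :=
  ∀ x₀ : M, ContDiffOn ℝ ∞ (α.inChart x₀) (extChartAt 𝓘(ℝ, E) x₀).target

/-- The exterior derivative `dα`: at `x`, take the exterior derivative of the expression of `α` in
the chart at `x`, and pull it back along this chart. -/
def DiffForm.d (α : DiffForm E M k) : DiffForm E M (k + 1) :=
  fun x => ContinuousAlternatingMap.compContinuousLinearMap
    (extDeriv (α.inChart x) (extChartAt 𝓘(ℝ, E) x x))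
    (mfderiv 𝓘(ℝ, E) 𝓘(ℝ, E) (extChartAt 𝓘(ℝ, E) x) x)

/-- The value of the wedge product `θ ∧ α` of a `1`-form and a `k`-form on tangent vectors
`v₀, …, v_k`, namely `∑ᵢ (-1)ⁱ θ(vᵢ) α(v₀, …, v̂ᵢ, …, v_k)`. -/
def DiffForm.wedgeOne (θ : DiffForm E M 1) (α : DiffForm E M k) (x : M)
    (v : Fin (k + 1) → TangentSpace 𝓘(ℝ, E) x) : ℝ :=
  ∑ i : Fin (k + 1), (-1 : ℝ) ^ (i : ℕ) * (θ x ![v i] * α x (i.removeNth v))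

/-- The `2`-form `α` is non-degenerate at every point. -/
def DiffForm.IsNondegenerate (α : DiffForm E M 2) : Prop :=
  ∀ (x : M) (v : TangentSpace 𝓘(ℝ, E) x),
    (∀ w : TangentSpace 𝓘(ℝ, E) x, α x ![v, w] = 0) → v = 0

/-- The `1`-form `θ` is exact: `θ = df` for a smooth function `f`. -/
def DiffForm.IsExactOne (θ : DiffForm E M 1) : Prop :=
  ∃ f : M → ℝ, ContMDiff 𝓘(ℝ, E) 𝓘(ℝ, ℝ) ∞ f ∧
    ∀ (x : M) (v : TangentSpace 𝓘(ℝ, E) x), θ x ![v] = mfderiv 𝓘(ℝ, E) 𝓘(ℝ, ℝ) f x v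

/-- `Ω` is a locally conformal symplectic form with Lee form `θ`: both are smooth, `Ω` is
non-degenerate, `θ` is closed, and `dΩ = θ ∧ Ω`. -/
structure IsLCS (Ω : DiffForm E M 2) (θ : DiffForm E M 1) : Prop where
  smooth_form : Ω.IsSmooth
  smooth_lee : θ.IsSmooth
  nondegenerate : Ω.IsNondegenerate
  closed_lee : ∀ x, θ.d x = 0
  d_eq : ∀ x v, Ω.d x v = DiffForm.wedgeOne θ Ω x v

end Forms

/-! ### The normal bundle, tubular neighbourhoods and the blow-up -/

section BlowUp

variable {E : Type*} [NormedAddCommGroup E] [NormedSpace ℝ E]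
  {M : Type*} [TopologicalSpace M] [ChartedSpace E M] [IsManifold 𝓘(ℝ, E) ∞ M]
  {E' : Type*} [NormedAddCommGroup E'] [NormedSpace ℝ E']
  {Z : Type*} [TopologicalSpace Z] [ChartedSpace E' Z]
  {F : Type*} [NormedAddCommGroup F] [NormedSpace ℝ F]
  {N : Z → Type*} [∀ z, AddCommGroup (N z)] [∀ z, Module ℂ (N z)]
  [∀ z, TopologicalSpace (N z)] [TopologicalSpace (TotalSpace F N)]
  [FiberBundle F N] [VectorBundle ℝ F N] [ContMDiffVectorBundle ∞ F N 𝓘(ℝ, E')]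
  {B : Type*} [TopologicalSpace B] [ChartedSpace E B]

variable (E' F) in
/-- `N` is the normal bundle of the submanifold `i : Z → M`, realised as the `Ω`-orthogonal
complement of `TZ` in `TM|_Z`, with a complex structure compatible with `Ω`.

Here `N` is a smooth real vector bundle over `Z` whose fibres are complex vector spaces, and `ν` is
a smooth fibrewise linear injection `N → TM|_Z` whose image is
`{v ∈ T_{i(z)}M | Ω(v, u) = 0 for all u ∈ T_zZ}`. -/
structure IsNormalBundle (Ω : DiffForm E M 2) (i : Z → M)
    (ν : ∀ z, N z →ₗ[ℝ] TangentSpace 𝓘(ℝ, E) (i z)) : Prop where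
  injective : ∀ z, Function.Injective (ν z)
  mem_range_iff : ∀ (z : Z) (v : TangentSpace 𝓘(ℝ, E) (i z)), v ∈ Set.range (ν z) ↔
    ∀ u : TangentSpace 𝓘(ℝ, E') z, Ω (i z) ![v, mfderiv 𝓘(ℝ, E') 𝓘(ℝ, E) i z u] = 0
  smooth : ContMDiff (𝓘(ℝ, E').prod 𝓘(ℝ, F)) 𝓘(ℝ, E).tangent ∞
    (fun p : TotalSpace F N => (⟨i p.proj, ν p.proj p.2⟩ : TangentBundle 𝓘(ℝ, E) M))
  /-- multiplication by the imaginary unit is smooth -/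
  smooth_I : ContMDiff (𝓘(ℝ, E').prod 𝓘(ℝ, F)) (𝓘(ℝ, E').prod 𝓘(ℝ, F)) ∞
    (fun p : TotalSpace F N => (⟨p.proj, Complex.I • p.2⟩ : TotalSpace F N))
  /-- multiplication by the imaginary unit preserves `Ω` -/
  compatible : ∀ (z : Z) (v w : N z),
    Ω (i z) ![ν z (Complex.I • v), ν z (Complex.I • w)] = Ω (i z) ![ν z v, ν z w]
  /-- `v, w ↦ Ω(v, I w)` is positive definite -/
  positive : ∀ (z : Z) (v : N z), v ≠ 0 → 0 < Ω (i z) ![ν z v, ν z (Complex.I • v)]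

variable (E') in
/-- `φ : D → M` is a tubular neighbourhood of `i : Z → M`: `D` is an open neighbourhood of the zero
section of the normal bundle `N` (for instance an open disc bundle), and `φ` is a diffeomorphism
from `D` onto the open set `φ(D)` of `M` that is `i` on the zero section and whose derivative there
in the fibre directions induces the identification `N ≅ TM|_Z / TZ` given by `ν`. -/
structure IsTubularNeighbourhood (i : Z → M)
    (ν : ∀ z, N z →ₗ[ℝ] TangentSpace 𝓘(ℝ, E) (i z))
    (D : Set (TotalSpace F N)) (φ : TotalSpace F N → M) : Prop where
  isOpen : IsOpen D
  zero_mem : ∀ z : Z, (⟨z, 0⟩ : TotalSpace F N) ∈ D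
  injOn : Set.InjOn φ D
  localDiffeo : IsLocalDiffeomorphOn (𝓘(ℝ, E').prod 𝓘(ℝ, F)) 𝓘(ℝ, E) ∞ φ D
  map_zero : ∀ z : Z, φ ⟨z, 0⟩ = i z
  normal_deriv : ∀ (z : Z) (v : N z), ∃ u : TangentSpace 𝓘(ℝ, E') z,
    (mfderiv 𝓘(ℝ, ℝ) 𝓘(ℝ, E) (fun t : ℝ => φ ⟨z, t • v⟩) 0 (1 : ℝ) : E) =
      (ν z v : E) + (mfderiv 𝓘(ℝ, E') 𝓘(ℝ, E) i z u : E)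

/-- Triples `(z, ℓ, v)` with `z ∈ Z`, `ℓ` a complex subspace of `N_z` and `v ∈ N_z`. -/
@[ext] structure SubspaceVector (N : Z → Type*) [∀ z, AddCommGroup (N z)]
    [∀ z, Module ℂ (N z)] where
  base : Z
  line : Submodule ℂ (N base)
  vec : N base

/-- The part `D̃ = {(z, ℓ, v) | ℓ ∈ ℙ(N_z), v ∈ ℓ, v ∈ D}` lying over `D ⊆ N` of the tautological
line bundle `L ⊆ ℙ(N) × N` of the complex projective bundle `ℙ(N) → Z`. -/
def tautologicalOver (D : Set (TotalSpace F N)) : Set (SubspaceVector N) :=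
  {p | Module.finrank ℂ p.line = 1 ∧ p.vec ∈ p.line ∧ (⟨p.base, p.vec⟩ : TotalSpace F N) ∈ D}

/-- The map `(w, t) ↦ (ℂ w, t w)`. On pairs with `w ≠ 0` it is the quotient map by `ℂ^*` of
`(N ∖ 0) × ℂ` onto the tautological line bundle `L`, and the manifold structure of `L` is the one
for which it is a smooth submersion. -/
def tautologicalMap (p : TotalSpace F N × ℂ) : SubspaceVector N :=
  ⟨p.1.proj, Submodule.span ℂ {p.1.2}, p.2 • p.1.2⟩

variable (E E') in
/-- `π : B → M` is the blow-up of `M` along `i : Z → M`, constructed with the complex normal bundle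
`N` and the tubular neighbourhood `φ : D → M`. That is, `B` is the manifold obtained by gluing
`M ∖ Z` and the part `D̃` over `D` of the tautological line bundle of `ℙ(N)` along
`φ(D) ∖ Z ≅ D ∖ Z ≅ D̃ ∖ ℙ(N)`, and `π` is the inclusion on `M ∖ Z` and `(z, ℓ, v) ↦ φ(z, v)`
on `D̃`.

The embedding of `D̃` as the open subset `π⁻¹(φ(D))` of `B` is `j` (only its values on `D̃`
matter); that it is a diffeomorphism for the manifold structure of `D̃` is expressed through the
quotient map `(w, t) ↦ (ℂ w, t w)`. The inverse of the embedding of `M ∖ Z` as the open subset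
`B ∖ π⁻¹(Z)` is `π`. -/
structure IsBlowUp (i : Z → M) (D : Set (TotalSpace F N)) (φ : TotalSpace F N → M)
    (j : SubspaceVector N → B) (π : B → M) : Prop where
  smooth : ContMDiff 𝓘(ℝ, E) 𝓘(ℝ, E) ∞ π
  /-- away from `Z`, `π` is a diffeomorphism -/
  bijOn_compl : Set.BijOn π (π ⁻¹' (Set.range i)ᶜ) (Set.range i)ᶜ
  localDiffeo_compl : IsLocalDiffeomorphOn 𝓘(ℝ, E) 𝓘(ℝ, E) ∞ π (π ⁻¹' (Set.range i)ᶜ)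
  /-- over `φ(D)`, `π` is identified by `j` with the projection `D̃ → D` -/
  bijOn_taut : Set.BijOn j (tautologicalOver D) (π ⁻¹' (φ '' D))
  map_taut : ∀ p ∈ tautologicalOver D, π (j p) = φ ⟨p.base, p.vec⟩
  /-- `(w, t) ↦ j (ℂ w, t w)` is a smooth submersion on `{(w, t) | w ≠ 0, t w ∈ D}` -/
  submersion : ∀ p : TotalSpace F N × ℂ, p.1.2 ≠ 0 →
    (⟨p.1.proj, p.2 • p.1.2⟩ : TotalSpace F N) ∈ D →
      ContMDiffAt ((𝓘(ℝ, E').prod 𝓘(ℝ, F)).prod 𝓘(ℝ, ℂ)) 𝓘(ℝ, E) ∞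
          (fun q : TotalSpace F N × ℂ => j (tautologicalMap q)) p ∧
        Function.Surjective (mfderiv ((𝓘(ℝ, E').prod 𝓘(ℝ, F)).prod 𝓘(ℝ, ℂ)) 𝓘(ℝ, E)
          (fun q : TotalSpace F N × ℂ => j (tautologicalMap q)) p)

end BlowUp

end LCS

end

/-! Write S for the exceptional divisor, the preimage of Z under π. The form π^*Ω satisfies dη =
π^*θ ∧ η and is non-degenerate off S, but on S it kills the directions tangent to the fibres of
ℙ(N). The task is to correct it near S without spoiling the twisted equation. If π^*θ = dG near S
and τ is a closed 2-form supported there, then e^G τ solves the same equation. So Ω' = π^*Ω + s e^G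
τ is acceptable for every constant s, and only G, τ and a small s > 0 have to be found.

The function G exists because i^*θ = df. Extend f to the normal bundle by integrating φ^*θ along
radial segments of the fibres (`eventually_tubePrimitive`), then compose with the lift of π to N.

The form τ is of Fubini–Study type. As Z is compact, N embeds fibrewise and complex linearly in a
Hermitian space H (`exists_fibrewise_embedding`). Let ψ be the lift of π to N followed by this
embedding; near S it vanishes exactly on S. On H ∖ 0 take the angular form A = Im⟨c, dc⟩ / ‖c‖².
Multiplying a map by a nonvanishing complex function T changes the pullback of A by d arg T only, so
d(ψ^*A) = d(C^*A) wherever ψ = T • C with T and C nonvanishing. Near a point of S there is such a C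
that is nonvanishing on S too, namely the direction of the line, so d(ψ^*A) extends across S.
Cutting ψ^*A off before differentiating gives a locally exact τ with compact support
(`exists_angular_two_form`).

Non-degeneracy near S is a local estimate. There is a linear map J that tames Ω at a point of Z and
acts as I on the normal component (`exists_tame_tube`). A tangent vector v of the blow-up is tested
against a vector R with dπ(R) = J dπ(v) whose component ζ along the projective fibre is multiplied
by I. Then π^*Ω(v, R) is at least δ‖dπ v‖², and τ(v, R) is at least κ‖ζ‖² up to terms containing ‖dπ
v‖, which are absorbed when s is small (`exists_eventually_nondegenerate_blowDown`). Off S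
non-degeneracy is open, and compactness of the support of τ gives one s for all points
(`exists_isLCS_of_local_directions`). -/

noncomputable section

namespace LCS

set_option linter.unusedSectionVars false

open Filter Topology Set

/-! ### Smooth operations on forms on vector spaces. -/

section VectorSpaceForms

variable {V W X : Type*} [NormedAddCommGroup V] [NormedSpace ℝ V]
  [NormedAddCommGroup W] [NormedSpace ℝ W] [NormedAddCommGroup X] [NormedSpace ℝ X] {k : ℕ}

/-- Alternatization as a continuous linear map. -/
def alternatizationCLM (V : Type*) [NormedAddCommGroup V] [NormedSpace ℝ V] (k : ℕ) :
    ContinuousMultilinearMap ℝ (fun _ : Fin k => V) ℝ →L[ℝ] V [⋀^Fin k]→L[ℝ] ℝ :=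
  LinearMap.mkContinuous
    { toFun := fun f => f.alternatization
      map_add' := fun f g => by simp
      map_smul' := fun c f => by
        ext v
        simp [ContinuousMultilinearMap.alternatization_apply_apply, Finset.mul_sum,
          Units.smul_def, mul_left_comm] }
    (Fintype.card (Equiv.Perm (Fin k))) fun f => by
      refine ContinuousAlternatingMap.opNorm_le_bound _ (by positivity) fun v => ?_
      simp only [LinearMap.coe_mk, AddHom.coe_mk,
        ContinuousMultilinearMap.alternatization_apply_apply]
      refine (norm_sum_le _ _).trans ?_
      rw [mul_assoc, ← nsmul_eq_mul, ← Finset.card_univ]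
      refine Finset.sum_le_card_nsmul _ _ _ fun σ _ => ?_
      have h1 : ‖Equiv.Perm.sign σ • f (v ∘ σ)‖ = ‖f (v ∘ σ)‖ := by
        rcases Int.units_eq_one_or (Equiv.Perm.sign σ) with h | h <;> simp [h]
      rw [h1]
      refine (f.le_opNorm _).trans_eq ?_
      congr 1
      exact Equiv.prod_comp σ fun i => ‖v i‖

theorem alternatizationCLM_coe (f : V [⋀^Fin k]→L[ℝ] ℝ) :
    alternatizationCLM V k f.toContinuousMultilinearMap = (k.factorial : ℝ) • f := by
  ext v
  have h : ∀ σ : Equiv.Perm (Fin k), Equiv.Perm.sign σ • f (v ∘ σ) = f v := fun σ => by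
    have := f.toAlternatingMap.map_perm v σ
    simp only [ContinuousAlternatingMap.coe_toAlternatingMap] at this
    rw [this, smul_smul, Int.units_mul_self, one_smul]
  simp [alternatizationCLM, ContinuousMultilinearMap.alternatization_apply_apply, h,
    Fintype.card_perm]

/-- Forget alternation, compose as multilinear maps, where the dependence on the linear maps is
smooth, then alternatize. Alternatization multiplies an alternating form by k!, whence the division
at the end. -/
theorem contDiffAt_compContinuousLinearMap {n : ℕ∞ω} {f : X → W [⋀^Fin k]→L[ℝ] ℝ}
    {g : X → V →L[ℝ] W} {x : X} (hf : ContDiffAt ℝ n f x) (hg : ContDiffAt ℝ n g x) :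
    ContDiffAt ℝ n (fun y => (f y).compContinuousLinearMap (g y)) x := by
  have h1 : ContDiffAt ℝ n (fun y => (ContinuousMultilinearMap.compContinuousLinearMapContinuousMultilinear
      ℝ (fun _ : Fin k => V) (fun _ => W) ℝ (fun _ => g y))
      (ContinuousAlternatingMap.toContinuousMultilinearMapCLM ℝ (f y))) x := by
    refine ContDiffAt.clm_apply ?_ ?_
    · exact (ContinuousMultilinearMap.contDiff _).contDiffAt.comp x
        (contDiffAt_pi.2 fun _ => hg)
    · exact (ContinuousLinearMap.contDiff _).contDiffAt.comp x hf
  have h2 := ((alternatizationCLM V k).contDiff.contDiffAt.comp x h1).const_smul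
    ((k.factorial : ℝ)⁻¹)
  refine h2.congr_of_eventuallyEq (Eventually.of_forall fun y => ?_)
  have h3 := alternatizationCLM_coe ((f y).compContinuousLinearMap (g y))
  have h4 : (k.factorial : ℝ) ≠ 0 := by positivity
  calc (f y).compContinuousLinearMap (g y)
      = (k.factorial : ℝ)⁻¹ • ((k.factorial : ℝ) • (f y).compContinuousLinearMap (g y)) := by
        rw [inv_smul_smul₀ h4]
    _ = _ := by rw [← h3]; rfl

theorem contDiffAt_extDeriv {η : V → V [⋀^Fin k]→L[ℝ] ℝ} {x : V} (h : ContDiffAt ℝ ∞ η x) :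
    ContDiffAt ℝ ∞ (extDeriv η) x := by
  have h1 : ContDiffAt ℝ ∞ (fderiv ℝ η) x := h.fderiv_right (m := ∞) (by simp)
  exact (ContinuousAlternatingMap.alternatizeUncurryFinCLM ℝ V ℝ).contDiff.contDiffAt.comp x h1

end VectorSpaceForms

/-! ### Pulling forms on manifolds back to vector spaces. -/

section Forms

variable {V W : Type*} [NormedAddCommGroup V] [NormedSpace ℝ V]
  [NormedAddCommGroup W] [NormedSpace ℝ W]
  {E : Type*} [NormedAddCommGroup E] [NormedSpace ℝ E]
  {M : Type*} [TopologicalSpace M] [ChartedSpace E M]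
  {E' : Type*} [NormedAddCommGroup E'] [NormedSpace ℝ E']
  {M' : Type*} [TopologicalSpace M'] [ChartedSpace E' M']
  {k : ℕ}

/-- The pullback of a form on a manifold to a vector space. -/
def DiffForm.pull (g : V → M) (α : DiffForm E M k) : V → V [⋀^Fin k]→L[ℝ] ℝ :=
  DiffForm.pullback (E := V) (M := V) g α

theorem DiffForm.pull_apply (g : V → M) (α : DiffForm E M k) (y : V) (v : Fin k → V) :
    α.pull g y v = α (g y) fun l => mfderiv 𝓘(ℝ, V) 𝓘(ℝ, E) g y (v l) := rfl

theorem DiffForm.pull_pullback {f : M' → M} {g : V → M'} {y : V} (α : DiffForm E M k)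
    (hf : MDifferentiableAt 𝓘(ℝ, E') 𝓘(ℝ, E) f (g y))
    (hg : MDifferentiableAt 𝓘(ℝ, V) 𝓘(ℝ, E') g y) :
    (DiffForm.pullback (E := E') f α).pull g y = α.pull (f ∘ g) y := by
  ext v
  rw [DiffForm.pull_apply, DiffForm.pull_apply, mfderiv_comp y hf hg]
  rfl

theorem DiffForm.pull_comp {f : W → M} {g : V → W} {y : V} (α : DiffForm E M k)
    (hf : MDifferentiableAt 𝓘(ℝ, W) 𝓘(ℝ, E) f (g y)) (hg : DifferentiableAt ℝ g y) :
    α.pull (f ∘ g) y = (α.pull f (g y)).compContinuousLinearMap (fderiv ℝ g y) := by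
  ext v
  rw [DiffForm.pull_apply, mfderiv_comp y hf hg.mdifferentiableAt, mfderiv_eq_fderiv]
  rfl

theorem DiffForm.pull_congr {f g : V → M} {y : V} (α : DiffForm E M k) (h : f =ᶠ[𝓝 y] g) :
    α.pull f y = α.pull g y := by
  have h1 : f y = g y := h.eq_of_nhds
  have h2 := h.mfderiv_eq (I := 𝓘(ℝ, V)) (I' := 𝓘(ℝ, E))
  ext v
  rw [DiffForm.pull_apply, DiffForm.pull_apply, h2]
  have key : ∀ (p q : M) (e : p = q) (u : Fin k → E), α p u = α q u := by
    rintro p _ rfl u; rfl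
  exact key _ _ h1 _

/-- The form `α` is smooth at `x`. -/
def DiffForm.SmoothAt (α : DiffForm E M k) (x : M) : Prop :=
  ContDiffAt ℝ ∞ (α.inChart x) (extChartAt 𝓘(ℝ, E) x x)

theorem contDiffAt_extChartAt_comp {g : V → M} {y : V}
    (hg : ContMDiffAt 𝓘(ℝ, V) 𝓘(ℝ, E) ∞ g y) :
    ContDiffAt ℝ ∞ (extChartAt 𝓘(ℝ, E) (g y) ∘ g) y :=
  (contMDiffAt_extChartAt.comp y hg).contDiffAt

theorem DiffForm.SmoothAt.congr {α β : DiffForm E M k} {x : M} (hα : α.SmoothAt x)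
    (h : ∀ᶠ x' in 𝓝 x, α x' = β x') : β.SmoothAt x := by
  refine ContDiffAt.congr_of_eventuallyEq hα ?_
  have h1 := (continuousAt_extChartAt_symm (I := 𝓘(ℝ, E)) x).eventually
    (by simpa using h)
  filter_upwards [h1] with y hy
  simp only [DiffForm.inChart, DiffForm.pullback]
  rw [hy]

theorem DiffForm.d_congr {α β : DiffForm E M k} {x : M} (h : ∀ᶠ x' in 𝓝 x, α x' = β x') :
    α.d x = β.d x := by
  have h1 := (continuousAt_extChartAt_symm (I := 𝓘(ℝ, E)) x).eventually
    (by simpa using h)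
  have h2 : α.inChart x =ᶠ[𝓝 (extChartAt 𝓘(ℝ, E) x x)] β.inChart x := by
    filter_upwards [h1] with y hy
    simp only [DiffForm.inChart, DiffForm.pullback]
    rw [hy]
  simp only [DiffForm.d]
  rw [h2.extDeriv_eq]

/-- Two forms that agree on the image of a surjective derivative are equal. -/
theorem DiffForm.eq_of_pull_eq {α β : DiffForm E M k} {g : V → M} {y : V}
    (hg : Function.Surjective (mfderiv 𝓘(ℝ, V) 𝓘(ℝ, E) g y)) (h : α.pull g y = β.pull g y) :
    α (g y) = β (g y) := by
  apply ContinuousAlternatingMap.ext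
  intro v
  choose u hu using fun l => hg (v l)
  have h1 : ∀ γ : DiffForm E M k, γ.pull g y u = γ (g y) v := fun γ =>
    (γ.pull_apply g y u).trans (congrArg (γ (g y)) (funext hu))
  rw [← h1, ← h1, h]

section

variable [IsManifold 𝓘(ℝ, E) ∞ M]

theorem contMDiffAt_extChartAt_symm (x : M) {y : E} (hy : y ∈ (extChartAt 𝓘(ℝ, E) x).target) :
    ContMDiffAt 𝓘(ℝ, E) 𝓘(ℝ, E) ∞ (extChartAt 𝓘(ℝ, E) x).symm y :=
  (contMDiffOn_extChartAt_symm (n := ∞) x y hy).contMDiffAt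
    ((isOpen_extChartAt_target x).mem_nhds hy)

/-- Near y the map g is the inverse chart applied to the coordinate expression of g. Questions about
`pull` thereby become questions about pullbacks between vector spaces. -/
theorem DiffForm.pull_eventuallyEq (α : DiffForm E M k) {g : V → M} {y : V}
    (hg : ContMDiffAt 𝓘(ℝ, V) 𝓘(ℝ, E) ∞ g y) :
    α.pull g =ᶠ[𝓝 y] fun y' => (α.inChart (g y) (extChartAt 𝓘(ℝ, E) (g y) (g y'))).compContinuousLinearMap
      (fderiv ℝ (extChartAt 𝓘(ℝ, E) (g y) ∘ g) y') := by
  -- Being C^∞ at a point gives no single neighbourhood valid for all orders. Being C¹ does persist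
  -- nearby, and one derivative is enough here.
  have h1 : ∀ᶠ y' in 𝓝 y, ContMDiffAt 𝓘(ℝ, V) 𝓘(ℝ, E) 1 g y' :=
    ((contMDiffAt_iff_contMDiffAt_nhds (by simp)).1 (hg.of_le (by simp : (1 : ℕ∞ω) ≤ ∞)))
  have h2 : ∀ᶠ y' in 𝓝 y, g y' ∈ (chartAt E (g y)).source :=
    hg.continuousAt.eventually ((chartAt E (g y)).open_source.mem_nhds (mem_chart_source E (g y)))
  filter_upwards [h1, h2.eventually_nhds] with y' hy1 hy2
  have hy3 := hy2.self_of_nhds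
  have h3 : g =ᶠ[𝓝 y'] (extChartAt 𝓘(ℝ, E) (g y)).symm ∘ (extChartAt 𝓘(ℝ, E) (g y) ∘ g) := by
    filter_upwards [hy2] with z hz
    exact ((extChartAt 𝓘(ℝ, E) (g y)).left_inv (by simpa using hz)).symm
  have h4 : MDifferentiableAt 𝓘(ℝ, V) 𝓘(ℝ, E) (extChartAt 𝓘(ℝ, E) (g y) ∘ g) y' :=
    (mdifferentiableAt_extChartAt hy3).comp y' (hy1.mdifferentiableAt (by simp))
  rw [α.pull_congr h3, α.pull_comp _ h4.differentiableAt]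
  · rfl
  · refine (contMDiffAt_extChartAt_symm (g y) ?_).mdifferentiableAt (by simp)
    exact (extChartAt 𝓘(ℝ, E) (g y)).map_source (by simpa using hy3)

theorem DiffForm.SmoothAt.pull {α : DiffForm E M k} {g : V → M} {y : V} (hα : α.SmoothAt (g y))
    (hg : ContMDiffAt 𝓘(ℝ, V) 𝓘(ℝ, E) ∞ g y) : ContDiffAt ℝ ∞ (α.pull g) y := by
  refine ContDiffAt.congr_of_eventuallyEq ?_ (α.pull_eventuallyEq hg)
  have h := contDiffAt_extChartAt_comp hg
  exact contDiffAt_compContinuousLinearMap (ContDiffAt.comp y hα h)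
    (h.fderiv_right (m := ∞) (by simp))

/-- Naturality of d, reduced to `extDeriv_pullback` by the coordinate expression. For g an inverse
chart it says that d, defined with a different chart at each point, can be computed in one fixed
chart. -/
theorem DiffForm.SmoothAt.extDeriv_pull {α : DiffForm E M k} {g : V → M} {y : V}
    (hα : α.SmoothAt (g y)) (hg : ContMDiffAt 𝓘(ℝ, V) 𝓘(ℝ, E) ∞ g y) :
    extDeriv (α.pull g) y = α.d.pull g y := by
  rw [(α.pull_eventuallyEq hg).extDeriv_eq]
  have h := contDiffAt_extChartAt_comp hg
  have h1 := extDeriv_pullback (r := ∞) (f := extChartAt 𝓘(ℝ, E) (g y) ∘ g) (x := y)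
    (ContDiffAt.differentiableAt hα (by simp)) h (by simpa using (WithTop.coe_le_coe.2 le_top : ((2 : ℕ∞) : ℕ∞ω) ≤ ∞))
  refine h1.trans ?_
  have h2 : fderiv ℝ (extChartAt 𝓘(ℝ, E) (g y) ∘ g) y =
      (mfderiv 𝓘(ℝ, E) 𝓘(ℝ, E) (extChartAt 𝓘(ℝ, E) (g y)) (g y)).comp
        (mfderiv 𝓘(ℝ, V) 𝓘(ℝ, E) g y) := by
    rw [← mfderiv_eq_fderiv]
    exact mfderiv_comp y (mdifferentiableAt_extChartAt (mem_chart_source E (g y)))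
      (hg.mdifferentiableAt (by simp))
  rw [h2]
  rfl

/-- The expression in one chart near another point is a pullback along an inverse chart, so
smoothness in the chart centred at each point suffices. -/
theorem DiffForm.isSmooth_iff {α : DiffForm E M k} : α.IsSmooth ↔ ∀ x, α.SmoothAt x := by
  constructor
  · intro h x
    exact (h x).contDiffAt ((isOpen_extChartAt_target x).mem_nhds (mem_extChartAt_target x))
  · intro h x y hy
    exact ((h _).pull (contMDiffAt_extChartAt_symm x hy)).contDiffWithinAt

theorem mfderiv_extChartAt_symm_surjective (x : M) :
    Function.Surjective (mfderiv 𝓘(ℝ, E) 𝓘(ℝ, E) (extChartAt 𝓘(ℝ, E) x).symm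
      (extChartAt 𝓘(ℝ, E) x x)) := by
  intro u
  refine ⟨mfderiv 𝓘(ℝ, E) 𝓘(ℝ, E) (extChartAt 𝓘(ℝ, E) x) x u, ?_⟩
  have h2 := mfderiv_comp (I := 𝓘(ℝ, E)) (I' := 𝓘(ℝ, E)) (I'' := 𝓘(ℝ, E)) x
    ((contMDiffAt_extChartAt_symm x (mem_extChartAt_target x)).mdifferentiableAt (by simp))
    (mdifferentiableAt_extChartAt (I := 𝓘(ℝ, E)) (mem_chart_source E x))
  have h3 : ((extChartAt 𝓘(ℝ, E) x).symm ∘ extChartAt 𝓘(ℝ, E) x) =ᶠ[𝓝 x] id := by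
    filter_upwards [extChartAt_source_mem_nhds (I := 𝓘(ℝ, E)) x] with z hz
    exact (extChartAt 𝓘(ℝ, E) x).left_inv hz
  rw [h3.mfderiv_eq, mfderiv_id] at h2
  exact (DFunLike.congr_fun h2 u).symm

/-- A form is determined at `x` by its expression in the chart at `x`. -/
theorem DiffForm.eq_of_inChart_eq {α β : DiffForm E M k} {x : M}
    (h : α.inChart x (extChartAt 𝓘(ℝ, E) x x) = β.inChart x (extChartAt 𝓘(ℝ, E) x x)) :
    α x = β x := by
  have h1 := DiffForm.eq_of_pull_eq (mfderiv_extChartAt_symm_surjective x) h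
  rwa [extChartAt_to_inv] at h1

end

end Forms

/-! ### The angular form on a Hermitian space. -/

section AngularForm

variable {H : Type*} [NormedAddCommGroup H] [InnerProductSpace ℂ H]

variable (H) in
/-- The imaginary part of the inner product, as a real bilinear form. -/
def imInner : H →L[ℝ] H →L[ℝ] ℝ :=
  LinearMap.mkContinuous₂
    (LinearMap.mk₂ ℝ (fun x y : H => (inner ℂ x y).im)
      (fun x y z => by simp) (fun r x y => by simp [← Complex.coe_smul, mul_comm])
      (fun x y z => by simp) (fun r x y => by simp [← Complex.coe_smul, mul_comm]))
    1 fun x y => by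
      simpa using (Complex.abs_im_le_norm _).trans (norm_inner_le_norm (𝕜 := ℂ) x y)

variable (H) in
/-- The real part of the inner product, as a real bilinear form. -/
def reInner : H →L[ℝ] H →L[ℝ] ℝ :=
  LinearMap.mkContinuous₂
    (LinearMap.mk₂ ℝ (fun x y : H => (inner ℂ x y).re)
      (fun x y z => by simp) (fun r x y => by simp [← Complex.coe_smul, mul_comm])
      (fun x y z => by simp) (fun r x y => by simp [← Complex.coe_smul, mul_comm]))
    1 fun x y => by
      simpa using (Complex.abs_re_le_norm _).trans (norm_inner_le_norm (𝕜 := ℂ) x y)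

@[simp] theorem imInner_apply (x y : H) : imInner H x y = (inner ℂ x y).im := rfl

@[simp] theorem reInner_apply (x y : H) : reInner H x y = (inner ℂ x y).re := rfl

theorem reInner_self (x : H) : reInner H x x = ‖x‖ ^ 2 := by
  rw [reInner_apply, inner_self_eq_norm_sq_to_K]
  norm_cast

/-- The angular form `Im ⟨c, dc⟩ / ‖c‖²`, whose exterior derivative is the pullback of a
Fubini–Study form to `H ∖ 0`. -/
def angularMap (c : H) : H [⋀^Fin 1]→L[ℝ] ℝ :=
  (reInner H c c)⁻¹ • ContinuousAlternatingMap.ofSubsingleton ℝ H ℝ (0 : Fin 1) (imInner H c)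

variable (H) in
/-- `angularMap` as a form on the manifold `H`. -/
def angularForm : DiffForm H H 1 := angularMap

theorem angularMap_apply (c : H) (v : Fin 1 → H) :
    angularMap c v = (‖c‖ ^ 2)⁻¹ * (inner ℂ c (v 0)).im := by
  have : angularMap c v = (reInner H c c)⁻¹ * imInner H c (v 0) := rfl
  rw [this, reInner_self, imInner_apply]

theorem reInner_self_ne_zero {c : H} (hc : c ≠ 0) : reInner H c c ≠ 0 := by
  rw [reInner_self]
  simpa using hc

theorem contDiffAt_angularMap {c : H} (hc : c ≠ 0) : ContDiffAt ℝ ∞ (angularMap (H := H)) c := by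
  have h1 : ContDiff ℝ ∞ fun c : H => reInner H c c :=
    (reInner H).contDiff.clm_apply contDiff_id
  have h2 : ContDiff ℝ ∞ fun c : H =>
      ContinuousAlternatingMap.ofSubsingletonLIE (𝕜 := ℝ) (E := H) (F := ℝ) (0 : Fin 1) (imInner H c) :=
    (ContinuousAlternatingMap.ofSubsingletonLIE (𝕜 := ℝ) (E := H) (F := ℝ) (0 : Fin 1)).contDiff.comp (imInner H).contDiff
  exact (h1.contDiffAt.inv (reInner_self_ne_zero hc)).smul h2.contDiffAt

theorem angularForm_inChart (c : H) : (angularForm H).inChart c = angularMap := by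
  have h : (extChartAt 𝓘(ℝ, H) c).symm = (PartialEquiv.refl H) := by
    rw [extChartAt_model_space_eq_id]; rfl
  funext y
  refine ContinuousAlternatingMap.ext fun v => ?_
  have h1 : (angularForm H).inChart c y v = angularMap ((extChartAt 𝓘(ℝ, H) c).symm y)
      fun l => mfderiv 𝓘(ℝ, H) 𝓘(ℝ, H) (extChartAt 𝓘(ℝ, H) c).symm y (v l) := rfl
  rw [h1, h]
  have h2 : mfderiv 𝓘(ℝ, H) 𝓘(ℝ, H) (PartialEquiv.refl H) y = ContinuousLinearMap.id ℝ H :=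
    mfderiv_id
  rw [h2]
  rfl

theorem smoothAt_angularForm {c : H} (hc : c ≠ 0) : (angularForm H).SmoothAt c := by
  rw [DiffForm.SmoothAt, angularForm_inChart]
  rw [extChartAt_model_space_eq_id]
  exact contDiffAt_angularMap hc

/-- The derivative of ‖c‖⁻² comes multiplied by Im⟨c, w⟩, which is 0 for w orthogonal to c, so only
the bilinear factor contributes. Antisymmetry of the imaginary part gives the factor 2. With y = I x
the value is positive, which is the Fubini–Study positivity used later. -/
theorem extDeriv_angularMap_of_orthogonal {c x y : H} (hc : c ≠ 0) (hx : inner ℂ c x = 0)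
    (hy : inner ℂ c y = 0) :
    extDeriv angularMap c ![x, y] = 2 * (‖c‖ ^ 2)⁻¹ * (inner ℂ x y).im := by
  rw [extDeriv_apply ((contDiffAt_angularMap hc).differentiableAt (by simp))]
  have key : ∀ u w : H, inner ℂ c w = 0 → ∀ f : Fin 1 → H, f 0 = w →
      fderiv ℝ (fun c => angularMap c f) c u = (‖c‖ ^ 2)⁻¹ * (inner ℂ u w).im := by
    intro u w hw f hf
    have h1 : HasFDerivAt (fun c : H => (reInner H c c)⁻¹)
        (fderiv ℝ (fun c : H => (reInner H c c)⁻¹) c) c := by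
      refine DifferentiableAt.hasFDerivAt (DifferentiableAt.inv ?_ (reInner_self_ne_zero hc))
      exact (reInner H).differentiableAt.clm_apply differentiableAt_id
    have h2 : HasFDerivAt (fun c : H => imInner H c w) ((imInner H).flip w) c :=
      ((imInner H).flip w).hasFDerivAt
    have h3 := h1.fun_mul h2
    have h4 : (fun c => angularMap c f) = fun c : H => (reInner H c c)⁻¹ * imInner H c w := by
      funext c
      rw [← hf]
      rfl
    rw [h4, h3.fderiv]
    simp [hw, ← reInner_self]
  rw [Fin.sum_univ_two, key _ y hy _ rfl, key _ x hx _ rfl]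
  have h : (inner ℂ y x).im = -(inner ℂ x y).im := by
    rw [← inner_conj_symm, Complex.conj_im]
  simp [h]
  ring

variable {V : Type*} [NormedAddCommGroup V] [NormedSpace ℝ V]

theorem angularForm_pull_apply (C : V → H) (y : V) (v : Fin 1 → V) :
    (angularForm H).pull C y v = (‖C y‖ ^ 2)⁻¹ * (inner ℂ (C y) (fderiv ℝ C y (v 0))).im := by
  rw [DiffForm.pull_apply, mfderiv_eq_fderiv]
  exact angularMap_apply _ _

/-- The angular form changes by a closed form under multiplication by a nonzero function. -/
theorem extDeriv_angularForm_pull_smul {C : V → H} {T : V → ℂ} {y : V}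
    (hC : ContDiffAt ℝ ∞ C y) (hT : ContDiffAt ℝ ∞ T y) (hCy : C y ≠ 0) (hTy : T y ≠ 0) :
    extDeriv ((angularForm H).pull fun z => T z • C z) y = extDeriv ((angularForm H).pull C) y := by
  -- A branch of arg T near y: after division by T y the value at y is 1, inside the slit plane. The
  -- two pulled back forms will differ by du, and d(du) = 0.
  set u : V → ℝ := fun z => (Complex.log (T z / T y)).im with hu
  have hT1 : ContDiffAt ℝ ∞ (fun z => T z / T y) y := by
    simp only [div_eq_mul_inv]
    exact hT.mul contDiffAt_const
  have hlog : ∀ {w : ℂ}, w ∈ Complex.slitPlane → ContDiffAt ℝ ∞ Complex.log w := fun hw =>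
    (Complex.contDiffAt_log hw).restrict_scalars ℝ
  have hsl : T y / T y ∈ Complex.slitPlane := by rw [div_self hTy]; exact Complex.one_mem_slitPlane
  have hus : ContDiffAt ℝ ∞ u y :=
    Complex.imCLM.contDiff.contDiffAt.comp y (ContDiffAt.comp y (hlog hsl) hT1)
  have e1 : ∀ᶠ z in 𝓝 y, DifferentiableAt ℝ T z :=
    ((hT.of_le (by simp : (1 : ℕ∞ω) ≤ ∞)).eventually (by simp)).mono fun z hz =>
      hz.differentiableAt (by simp)
  have e2 : ∀ᶠ z in 𝓝 y, DifferentiableAt ℝ C z :=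
    ((hC.of_le (by simp : (1 : ℕ∞ω) ≤ ∞)).eventually (by simp)).mono fun z hz =>
      hz.differentiableAt (by simp)
  have e3 : ∀ᶠ z in 𝓝 y, T z / T y ∈ Complex.slitPlane :=
    hT1.continuousAt.eventually (Complex.isOpen_slitPlane.mem_nhds hsl)
  have e4 : ∀ᶠ z in 𝓝 y, C z ≠ 0 := hC.continuousAt.eventually_ne hCy
  have e5 : ∀ᶠ z in 𝓝 y, T z ≠ 0 := hT.continuousAt.eventually_ne hTy
  have key : (angularForm H).pull (fun z => T z • C z) =ᶠ[𝓝 y] fun z => (angularForm H).pull C z +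
      extDeriv (fun x => ContinuousAlternatingMap.constOfIsEmpty ℝ V (Fin 0) (u x)) z := by
    filter_upwards [e1, e2, e3, e4, e5] with z h1 h2 h3 h4 h5
    ext v
    rw [extDeriv_constOfIsEmpty, ContinuousAlternatingMap.add_apply,
      angularForm_pull_apply, angularForm_pull_apply]
    have d1 : HasFDerivAt (fun z => T z • C z)
        (T z • fderiv ℝ C z + (fderiv ℝ T z).smulRight (C z)) z := h1.hasFDerivAt.smul h2.hasFDerivAt
    have d2 : HasFDerivAt (fun z => T z / T y) ((T y)⁻¹ • fderiv ℝ T z) z := by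
      simp only [div_eq_mul_inv]
      exact h1.hasFDerivAt.mul_const _
    have d3 := Complex.imCLM.hasFDerivAt.comp z
      (((Complex.hasStrictDerivAt_log h3).hasDerivAt.hasFDerivAt.restrictScalars ℝ).comp z d2)
    have hu2 : u = Complex.imCLM ∘ Complex.log ∘ fun z => T z / T y := rfl
    rw [d1.fderiv, hu2, d3.fderiv]
    have n1 : (inner ℂ (C z) (C z)) = ((‖C z‖ ^ 2 : ℝ) : ℂ) := by
      rw [inner_self_eq_norm_sq_to_K]; norm_cast
    have n2 : ‖T z‖ ^ 2 = Complex.normSq (T z) := (Complex.normSq_eq_norm_sq _).symm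
    have n3 : (T z)⁻¹ = (starRingEnd ℂ) (T z) * (((‖T z‖ ^ 2)⁻¹ : ℝ) : ℂ) := by
      rw [n2, Complex.inv_def]
    have n4 : (starRingEnd ℂ) (T z) * T z = ((‖T z‖ ^ 2 : ℝ) : ℂ) := by
      rw [n2, mul_comm, Complex.mul_conj]
    have n5 : ‖T z‖ ^ 2 ≠ 0 := by simpa using h5
    have n6 : ‖C z‖ ^ 2 ≠ 0 := by simpa using h4
    set a := fderiv ℝ T z (v 0) with ha
    set b := fderiv ℝ C z (v 0) with hb
    have m1 : ((T z • fderiv ℝ C z + (fderiv ℝ T z).smulRight (C z)) (v 0)) =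
        T z • b + a • C z := rfl
    have m2 : (ContinuousLinearMap.comp Complex.imCLM
        ((ContinuousLinearMap.restrictScalars ℝ
          (ContinuousLinearMap.toSpanSingleton ℂ (T z / T y)⁻¹)).comp
            ((T y)⁻¹ • fderiv ℝ T z))) (v 0) = ((T z)⁻¹ * a).im := by
      have : ((T y)⁻¹ • a) • (T z / T y)⁻¹ = (T z)⁻¹ * a := by
        simp only [smul_eq_mul]; field_simp
      exact congrArg Complex.im this
    have m3 : ∀ L : V →L[ℝ] ℝ, ContinuousAlternatingMap.ofSubsingleton ℝ V ℝ (0 : Fin 1) L v =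
      L (v 0) := fun L => rfl
    rw [m1, m3, m2, n3]
    simp only [inner_add_right, inner_smul_left, inner_smul_right, n1, norm_smul, mul_pow]
    set t := inner ℂ (C z) b
    -- With a and b the derivatives of T and C along v, this is ⟨T C, T b + a C⟩ = |T|²⟨C, b⟩ + ‖C‖²
    -- T̄ a. Division by |T|²‖C‖² leaves the form of C plus Im(a / T), which is du.
    have m4 : (starRingEnd ℂ) (T z) * (T z * t) + a * ((starRingEnd ℂ) (T z) * ((‖C z‖ ^ 2 : ℝ) : ℂ))
        = ((‖T z‖ ^ 2 : ℝ) : ℂ) * t + ((‖C z‖ ^ 2 : ℝ) : ℂ) * ((starRingEnd ℂ) (T z) * a) := by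
      rw [← n4]; ring
    have m5 : (starRingEnd ℂ) (T z) * (((‖T z‖ ^ 2)⁻¹ : ℝ) : ℂ) * a =
        (((‖T z‖ ^ 2)⁻¹ : ℝ) : ℂ) * ((starRingEnd ℂ) (T z) * a) := by ring
    rw [mul_left_comm, m4]
    rw [m5, Complex.add_im, Complex.im_ofReal_mul, Complex.im_ofReal_mul, Complex.im_ofReal_mul]
    field_simp
  have hu1 : ContDiffAt ℝ ∞ (fun x => ContinuousAlternatingMap.constOfIsEmpty ℝ V (Fin 0) (u x)) y :=
    (ContinuousAlternatingMap.constOfIsEmptyLIE ℝ V ℝ (Fin 0)).contDiff.contDiffAt.comp y hus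
  rw [key.extDeriv_eq, extDeriv_fun_add, extDeriv_extDeriv_apply hu1
    (by simpa using (WithTop.coe_le_coe.2 le_top : ((2 : ℕ∞) : ℕ∞ω) ≤ ∞)), add_zero]
  · exact ((smoothAt_angularForm hCy).pull hC.contMDiffAt).differentiableAt (by simp)
  · exact (contDiffAt_extDeriv hu1).differentiableAt (by simp)

end AngularForm

/-! ### Non-degenerate and tamed bilinear forms. -/

section LinearAlgebra

variable {W : Type*} [NormedAddCommGroup W] [NormedSpace ℝ W]

/-- The bilinear form of an alternating `2`-form. -/
def bilin (η : W [⋀^Fin 2]→L[ℝ] ℝ) : W →L[ℝ] W →L[ℝ] ℝ :=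
  have e0 : ∀ a b c : W, Function.update ![a, b] 0 c = ![c, b] := fun a b c => by
    ext l; fin_cases l <;> simp
  have e1 : ∀ a b c : W, Function.update ![a, b] 1 c = ![a, c] := fun a b c => by
    ext l; fin_cases l <;> simp
  LinearMap.mkContinuous₂
    (LinearMap.mk₂ ℝ (fun x y : W => η ![x, y])
      (fun x x' y => by simpa [e0] using η.map_update_add ![0, y] 0 x x')
      (fun r x y => by simpa [e0] using η.map_update_smul ![0, y] 0 r x)
      (fun x y y' => by simpa [e1] using η.map_update_add ![x, 0] 1 y y')
      (fun r x y => by simpa [e1] using η.map_update_smul ![x, 0] 1 r y))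
    ‖η‖ fun x y => by simpa [Fin.prod_univ_two, mul_assoc] using η.le_opNorm ![x, y]

@[simp] theorem bilin_apply (η : W [⋀^Fin 2]→L[ℝ] ℝ) (x y : W) : bilin η x y = η ![x, y] := rfl

variable (W) in
/-- `bilin` as a continuous linear map. -/
def bilinCLM : (W [⋀^Fin 2]→L[ℝ] ℝ) →L[ℝ] W →L[ℝ] W →L[ℝ] ℝ :=
  LinearMap.mkContinuous
    { toFun := bilin
      map_add' := fun _ _ => rfl
      map_smul' := fun _ _ => rfl } 1 fun η => by
    rw [one_mul]
    refine ContinuousLinearMap.opNorm_le_bound₂ _ (norm_nonneg _) fun x y => ?_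
    exact (η.le_opNorm ![x, y]).trans_eq (by simp [Fin.prod_univ_two, mul_assoc])

theorem continuous_bilin : Continuous (bilin (W := W)) := (bilinCLM W).continuous

theorem bilin_swap (η : W [⋀^Fin 2]→L[ℝ] ℝ) (x y : W) : bilin η x y = -bilin η y x := by
  have h := η.toAlternatingMap.map_swap ![x, y] (i := 0) (j := 1) (by simp)
  have e : ![x, y] ∘ Equiv.swap (0 : Fin 2) 1 = ![y, x] := by
    ext l; fin_cases l <;> simp
  rw [e] at h
  simp only [ContinuousAlternatingMap.coe_toAlternatingMap] at h
  rw [bilin_apply, bilin_apply, h, neg_neg]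

theorem abs_bilin_le (η : W [⋀^Fin 2]→L[ℝ] ℝ) (x y : W) : |bilin η x y| ≤ ‖η‖ * (‖x‖ * ‖y‖) := by
  simpa [Fin.prod_univ_two] using η.le_opNorm ![x, y]

/-- The alternating `2`-form `η` is non-degenerate. -/
def Nondegenerate₂ (η : W [⋀^Fin 2]→L[ℝ] ℝ) : Prop :=
  ∀ v, (∀ w, η ![v, w] = 0) → v = 0

/-- A positive definite form on a finite-dimensional space is uniformly positive, and so are the
forms close to it. -/
theorem exists_forall_near_pos [FiniteDimensional ℝ W] {b : W →L[ℝ] W →L[ℝ] ℝ}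
    (hb : ∀ v, v ≠ 0 → 0 < b v v) :
    ∃ δ > 0, ∀ᶠ b' in 𝓝 b, ∀ v, δ * ‖v‖ ^ 2 ≤ b' v v := by
  obtain ⟨δ, hδ, h⟩ : ∃ δ > 0, ∀ v, δ * ‖v‖ ^ 2 ≤ b v v := by
    rcases (Metric.sphere (0 : W) 1).eq_empty_or_nonempty with he | hne
    · refine ⟨1, one_pos, fun v => ?_⟩
      have hv : v = 0 := by
        by_contra hv
        have : ‖v‖⁻¹ • v ∈ Metric.sphere (0 : W) 1 := by
          simp [norm_smul, inv_mul_cancel₀ (norm_ne_zero_iff.2 hv)]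
        simp [he] at this
      simp [hv]
    · have hc : Continuous fun v => b v v := b.continuous.clm_apply continuous_id
      obtain ⟨u, hu, hmin⟩ := (isCompact_sphere (0 : W) 1).exists_isMinOn hne hc.continuousOn
      refine ⟨b u u, hb u (ne_zero_of_mem_unit_sphere ⟨u, hu⟩), fun v => ?_⟩
      by_cases hv : v = 0
      · simp [hv]
      have hv' : ‖v‖ ≠ 0 := norm_ne_zero_iff.2 hv
      have h1 : b u u ≤ b (‖v‖⁻¹ • v) (‖v‖⁻¹ • v) :=
        hmin (a := ‖v‖⁻¹ • v) (by simp [norm_smul, inv_mul_cancel₀ hv'])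
      have h2 : b (‖v‖⁻¹ • v) (‖v‖⁻¹ • v) = (‖v‖ ^ 2)⁻¹ * b v v := by
        simp; field_simp
      rw [h2] at h1
      have h3 : 0 < ‖v‖ ^ 2 := by positivity
      rwa [inv_mul_eq_div, le_div_iff₀ h3] at h1
  refine ⟨δ / 2, by positivity, ?_⟩
  filter_upwards [eventually_norm_sub_lt b (half_pos hδ)] with b' hb' v
  have h1 : |(b' - b) v v| ≤ ‖b' - b‖ * ‖v‖ * ‖v‖ := (b' - b).le_opNorm₂ v v
  have h2 : (b' - b) v v = b' v v - b v v := rfl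
  rw [h2] at h1
  have h3 := h v
  have h4 : ‖b' - b‖ * ‖v‖ * ‖v‖ ≤ δ / 2 * ‖v‖ * ‖v‖ := by gcongr
  nlinarith [(abs_le.1 h1).1]

/-- The form identifies W with its dual, so each coordinate function is η(s_l, ·) for some s_l.
Sending v to minus the combination of the s_l with the coordinates of v as coefficients makes η(v, S
v) the sum of their squares. -/
theorem Nondegenerate₂.exists_pos [FiniteDimensional ℝ W] {η : W [⋀^Fin 2]→L[ℝ] ℝ}
    (h : Nondegenerate₂ η) : ∃ S : W →L[ℝ] W, ∀ v, v ≠ 0 → 0 < η ![v, S v] := by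
  classical
  set f : W →ₗ[ℝ] Module.Dual ℝ W :=
    (ContinuousLinearMap.coeLM ℝ).comp (bilin η : W →ₗ[ℝ] W →L[ℝ] ℝ) with hf
  have hinj : Function.Injective f := by
    rw [← LinearMap.ker_eq_bot, LinearMap.ker_eq_bot']
    exact fun v hv => h v fun w => LinearMap.congr_fun hv w
  have hsurj : Function.Surjective f :=
    (LinearMap.injective_iff_surjective_of_finrank_eq_finrank
      (Subspace.dual_finrank_eq (K := ℝ) (V := W)).symm).1 hinj
  let β := Module.finBasis ℝ W
  choose s hs using fun l => hsurj (β.coord l)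
  refine ⟨-(∑ l, (LinearMap.toContinuousLinearMap (β.coord l)).smulRight (s l)), fun v hv => ?_⟩
  have h1 : ∀ l, bilin η v (s l) = -β.coord l v := fun l => by
    rw [bilin_swap, ← hs l]; rfl
  have h2 : η ![v, (-(∑ l, (LinearMap.toContinuousLinearMap (β.coord l)).smulRight (s l))) v] =
      ∑ l, (β.coord l v) ^ 2 := by
    rw [← bilin_apply]
    simp only [neg_apply, sum_apply, map_neg, map_sum,
      ContinuousLinearMap.smulRight_apply, map_smul, h1]
    simp [sq]
  rw [h2]
  refine lt_of_le_of_ne (Finset.sum_nonneg fun l _ => sq_nonneg _) fun h3 => hv ?_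
  have h4 := (Finset.sum_eq_zero_iff_of_nonneg fun l _ => sq_nonneg (β.coord l v)).1 h3.symm
  exact (Module.Basis.forall_coord_eq_zero_iff β).1 fun l => by simpa using h4 l (Finset.mem_univ l)

/-- With S fixed, the form v ↦ η'(v, S v) is positive definite at η, hence uniformly so for nearby
η', while it vanishes on the kernel of η'. -/
theorem Nondegenerate₂.eventually [FiniteDimensional ℝ W] {η : W [⋀^Fin 2]→L[ℝ] ℝ}
    (h : Nondegenerate₂ η) : ∀ᶠ η' in 𝓝 η, Nondegenerate₂ η' := by
  obtain ⟨S, hS⟩ := h.exists_pos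
  let f : (W [⋀^Fin 2]→L[ℝ] ℝ) → W →L[ℝ] W →L[ℝ] ℝ := fun η' =>
    (ContinuousLinearMap.compL ℝ W W ℝ).flip S ∘L bilin η'
  have hf : Continuous f := by
    have : Continuous fun η' : W [⋀^Fin 2]→L[ℝ] ℝ => bilin η' := continuous_bilin
    exact continuous_const.clm_comp this
  obtain ⟨δ, hδ, h1⟩ := exists_forall_near_pos (b := f η) hS
  filter_upwards [hf.continuousAt.eventually h1] with η' h2 v hv
  have h3 : f η' v v = 0 := hv (S v)
  have h4 := h2 v
  rw [h3] at h4
  have h5 : ‖v‖ ^ 2 = 0 := le_antisymm (by nlinarith) (by positivity)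
  simpa using h5

/-- A positive almost complex structure on the model of the tangent space of `M` along `Z` that
lifts the complex structure of the normal space. -/
theorem exists_tame_of_splitting {X Y T : Type*} [NormedAddCommGroup X] [NormedSpace ℝ X]
    [FiniteDimensional ℝ X] [NormedAddCommGroup Y] [NormedSpace ℂ Y] [FiniteDimensional ℂ Y]
    [NormedAddCommGroup T] [NormedSpace ℝ T] (η : T [⋀^Fin 2]→L[ℝ] ℝ) (Q : X →L[ℝ] T)
    (n : Y →ₗ[ℝ] T) (Λ : X × Y →L[ℝ] T) (hQn : ∀ x y, η ![Q x, n y] = 0)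
    (hQ : Nondegenerate₂ (η.compContinuousLinearMap Q))
    (hn : ∀ y, y ≠ 0 → 0 < η ![n y, n (Complex.I • y)])
    (hΛ1 : ∀ x, Λ (x, 0) = Q x) (hΛ2 : ∀ y, ∃ x, Λ (0, y) = n y + Q x) :
    ∃ J : X × Y →L[ℝ] X × Y, (∀ v, (J v).2 = Complex.I • v.2) ∧
      ∀ v, v ≠ 0 → 0 < η ![Λ v, Λ (J v)] := by
  have : FiniteDimensional ℝ Y := FiniteDimensional.complexToReal Y
  have hcomp : ∀ x x', (η.compContinuousLinearMap Q) ![x, x'] = η ![Q x, Q x'] := fun x x' => by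
    rw [ContinuousAlternatingMap.compContinuousLinearMap_apply]
    congr 1; ext l; fin_cases l <;> rfl
  have hQinj : Function.Injective Q := by
    refine (injective_iff_map_eq_zero Q).2 fun x hx => hQ x fun w => ?_
    rw [hcomp, hx, ← bilin_apply]; simp
  obtain ⟨S, hS⟩ := hQ.exists_pos
  -- The defect between Λ on the second factor and n takes values in the range of Q. Its preimage u
  -- under Q gives Λ (x, y) = Q (x + u y) + n y.
  let u₀ : Y →ₗ[ℝ] T := (Λ : X × Y →ₗ[ℝ] T) ∘ₗ LinearMap.inr ℝ X Y - n
  have hu₀ : ∀ y, u₀ y ∈ LinearMap.range (Q : X →ₗ[ℝ] T) := fun y => by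
    obtain ⟨x, hx⟩ := hΛ2 y
    exact ⟨x, by simp [u₀, hx]⟩
  let u : Y →ₗ[ℝ] X := (LinearEquiv.ofInjective (Q : X →ₗ[ℝ] T) hQinj).symm.toLinearMap ∘ₗ
    u₀.codRestrict _ hu₀
  have hu : ∀ y, Q (u y) = Λ (0, y) - n y := fun y => by
    have h1 := LinearEquiv.apply_symm_apply (LinearEquiv.ofInjective (Q : X →ₗ[ℝ] T) hQinj)
      (u₀.codRestrict _ hu₀ y)
    exact congrArg Subtype.val h1
  have hΛ : ∀ x y, Λ (x, y) = Q (x + u y) + n y := fun x y => by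
    have : ((x, y) : X × Y) = (x, 0) + (0, y) := by simp
    rw [this, map_add, hΛ1, map_add, hu]; abel
  let uc := LinearMap.toContinuousLinearMap u
  let mI : Y →L[ℝ] Y := (Complex.I • ContinuousLinearMap.id ℂ Y).restrictScalars ℝ
  -- Chosen so that Λ (J (x, y)) = Q (S (x + u y)) + n (I y). The cross terms then vanish by `hQn`,
  -- leaving one non-negative term from Q and one from n.
  let J : X × Y →L[ℝ] X × Y :=
    (S ∘L (ContinuousLinearMap.fst ℝ X Y + uc ∘L ContinuousLinearMap.snd ℝ X Y) -
      uc ∘L mI ∘L ContinuousLinearMap.snd ℝ X Y).prod (mI ∘L ContinuousLinearMap.snd ℝ X Y)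
  have hJ : ∀ x y, J (x, y) = (S (x + u y) - u (Complex.I • y), Complex.I • y) := fun x y => rfl
  refine ⟨J, fun v => rfl, ?_⟩
  rintro ⟨x, y⟩ hv
  have h1 : η ![Λ (x, y), Λ (J (x, y))] = η ![Q (x + u y), Q (S (x + u y))] +
      η ![n y, n (Complex.I • y)] := by
    rw [hJ, hΛ, hΛ, sub_add_cancel]
    simp only [← bilin_apply, map_add, add_apply]
    have h2 : bilin η (n y) (Q (S x)) = 0 := by rw [bilin_swap, bilin_apply, hQn, neg_zero]
    have h3 : bilin η (n y) (Q (S (u y))) = 0 := by rw [bilin_swap, bilin_apply, hQn, neg_zero]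
    have h4 : bilin η (Q x) (n (Complex.I • y)) = 0 := hQn _ _
    have h5 : bilin η (Q (u y)) (n (Complex.I • y)) = 0 := hQn _ _
    rw [h2, h3, h4, h5]; ring
  rw [h1]
  have h6 : 0 ≤ η ![Q (x + u y), Q (S (x + u y))] := by
    by_cases h : x + u y = 0
    · rw [h, ← bilin_apply]; simp
    · rw [← hcomp]; exact (hS _ h).le
  by_cases hy : y = 0
  · subst hy
    have hx : x + u 0 ≠ 0 := by
      intro h; exact hv (by simpa using h)
    have h7 := hS _ hx
    rw [hcomp] at h7
    have h8 : η ![n 0, n (Complex.I • 0)] = 0 := by rw [← bilin_apply]; simp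
    rw [h8, add_zero]; exact h7
  · exact add_pos_of_nonneg_of_pos h6 (hn y hy)

/-! ### The blow-down map in linear coordinates. -/

variable {X Y K : Type*} [NormedAddCommGroup X] [NormedSpace ℝ X]
  [NormedAddCommGroup Y] [NormedSpace ℂ Y] [NormedAddCommGroup K] [NormedSpace ℂ K]

/-- The blow-down map in local coordinates. -/
def blowDown (ι : K →L[ℂ] Y) (y₀ : Y) (p : X × K × ℂ) : X × Y :=
  (p.1, p.2.2 • (y₀ + ι p.2.1))

/-- The derivative of `blowDown`. -/
def blowDownDeriv (ι : K →L[ℂ] Y) (y₀ : Y) (p : X × K × ℂ) : X × K × ℂ →L[ℝ] X × Y :=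
  (ContinuousLinearMap.fst ℝ X (K × ℂ)).prod
    (((p.2.2 • ι).restrictScalars ℝ) ∘L (ContinuousLinearMap.fst ℝ K ℂ) ∘L
        (ContinuousLinearMap.snd ℝ X (K × ℂ)) +
      ((ContinuousLinearMap.toSpanSingleton ℂ (y₀ + ι p.2.1)).restrictScalars ℝ) ∘L
        (ContinuousLinearMap.snd ℝ K ℂ) ∘L (ContinuousLinearMap.snd ℝ X (K × ℂ)))

theorem blowDownDeriv_apply (ι : K →L[ℂ] Y) (y₀ : Y) (p v : X × K × ℂ) :
    blowDownDeriv ι y₀ p v = (v.1, p.2.2 • ι v.2.1 + v.2.2 • (y₀ + ι p.2.1)) := rfl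

theorem hasFDerivAt_blowDown (ι : K →L[ℂ] Y) (y₀ : Y) (p : X × K × ℂ) :
    HasFDerivAt (blowDown ι y₀) (blowDownDeriv ι y₀ p) p := by
  have h1 : HasFDerivAt (fun p : X × K × ℂ => p.2.2) (ContinuousLinearMap.snd ℝ K ℂ ∘L
      ContinuousLinearMap.snd ℝ X (K × ℂ)) p :=
    (ContinuousLinearMap.snd ℝ K ℂ ∘L ContinuousLinearMap.snd ℝ X (K × ℂ)).hasFDerivAt
  have h2 : HasFDerivAt (fun p : X × K × ℂ => y₀ + ι p.2.1) (ι.restrictScalars ℝ ∘L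
      ContinuousLinearMap.fst ℝ K ℂ ∘L ContinuousLinearMap.snd ℝ X (K × ℂ)) p :=
    (ι.restrictScalars ℝ ∘L ContinuousLinearMap.fst ℝ K ℂ ∘L
      ContinuousLinearMap.snd ℝ X (K × ℂ)).hasFDerivAt.const_add y₀
  exact (hasFDerivAt_fst).prodMk (h1.smul h2)

theorem contDiff_blowDown (ι : K →L[ℂ] Y) (y₀ : Y) :
    ContDiff ℝ ∞ (blowDown (X := X) ι y₀) := by
  refine contDiff_fst.prodMk ?_
  refine ContDiff.smul (contDiff_snd.comp contDiff_snd) (contDiff_const.add ?_)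
  exact (ι.restrictScalars ℝ).contDiff.comp (contDiff_fst.comp contDiff_snd)

/-- Here a is the size of the vector after blowing down and n the size of its component along the
projective fibre. Young's inequality bounds C a n by κ/2 n² plus a multiple of a² that δ a² absorbs
for small s. The summand 1 in `hsmall` leaves s a² over, so that both squares must vanish. -/
theorem pos_of_blowUp_estimate {δ κ C a n s A G : ℝ} (hκ : 0 < κ) (hs : 0 < s)
    (hA : δ * a ^ 2 ≤ A) (hG : κ * n ^ 2 - C * a * n - C * a ^ 2 ≤ G)
    (hsmall : s * (C + C ^ 2 / (2 * κ) + 1) < δ) (h0 : A + s * G ≤ 0) : a = 0 ∧ n = 0 := by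
  have h1 : C * a * n ≤ κ / 2 * n ^ 2 + C ^ 2 / (2 * κ) * a ^ 2 := by
    have : 0 ≤ (κ * n - C * a) ^ 2 / (2 * κ) := by positivity
    have e : (κ * n - C * a) ^ 2 / (2 * κ) =
        κ / 2 * n ^ 2 + C ^ 2 / (2 * κ) * a ^ 2 - C * a * n := by
      field_simp; ring
    linarith
  have h2 : κ / 2 * n ^ 2 - (C + C ^ 2 / (2 * κ)) * a ^ 2 ≤ G := by linarith
  have h3 : s * (κ / 2 * n ^ 2 - (C + C ^ 2 / (2 * κ)) * a ^ 2) ≤ s * G := by gcongr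
  have h4 : s * (C + C ^ 2 / (2 * κ) + 1) * a ^ 2 ≤ δ * a ^ 2 := by gcongr
  have h5 : s * a ^ 2 + s * κ / 2 * n ^ 2 ≤ 0 := by linarith
  have h6 : 0 ≤ s * a ^ 2 := by positivity
  have h7 : 0 ≤ s * κ / 2 * n ^ 2 := by positivity
  constructor
  · have : s * a ^ 2 = 0 := by linarith
    simpa [hs.ne'] using this
  · have : s * κ / 2 * n ^ 2 = 0 := by linarith
    simpa [hs.ne', hκ.ne'] using this

/-- Near the exceptional divisor, a small multiple of a form that is positive along it makes the
pulled back form non-degenerate. -/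
theorem exists_eventually_nondegenerate_blowDown [FiniteDimensional ℝ X] [FiniteDimensional ℂ Y]
    [FiniteDimensional ℂ K] (ι : K →L[ℂ] Y) {y₀ : Y} (hy₀ : y₀ ≠ 0) {x₀ : X}
    {A : X × Y → (X × Y) [⋀^Fin 2]→L[ℝ] ℝ} (hA : ContinuousAt A (x₀, 0))
    {J : X × Y →L[ℝ] X × Y} (hJ : ∀ v, (J v).2 = Complex.I • v.2)
    (hAJ : ∀ v, v ≠ 0 → 0 < A (x₀, 0) ![v, J v])
    {G : X × K × ℂ → (X × K × ℂ) [⋀^Fin 2]→L[ℝ] ℝ} (hG : ContinuousAt G (x₀, 0, 0))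
    (hG0 : ∀ᶠ p in 𝓝 ((x₀, 0, 0) : X × K × ℂ), ∀ s w, G p ![(0, 0, s), w] = 0)
    (hGpos : ∀ ζ : K, ζ ≠ 0 → 0 < G (x₀, 0, 0) ![(0, ζ, 0), (0, Complex.I • ζ, 0)]) :
    ∃ s₀ : ℝ, 0 < s₀ ∧ ∀ᶠ p in 𝓝 ((x₀, 0, 0) : X × K × ℂ), ∀ s : ℝ, 0 < s → s < s₀ →
      Nondegenerate₂ ((A (blowDown ι y₀ p)).compContinuousLinearMap (blowDownDeriv ι y₀ p) +
        s • G p) := by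
  have : FiniteDimensional ℝ Y := FiniteDimensional.complexToReal Y
  have : FiniteDimensional ℝ K := FiniteDimensional.complexToReal K
  let jK : K →L[ℝ] X × K × ℂ :=
    ContinuousLinearMap.inr ℝ X (K × ℂ) ∘L ContinuousLinearMap.inl ℝ K ℂ
  let mI : K →L[ℝ] K := (Complex.I • ContinuousLinearMap.id ℂ K).restrictScalars ℝ
  let bA : (X × Y) [⋀^Fin 2]→L[ℝ] ℝ → X × Y →L[ℝ] X × Y →L[ℝ] ℝ := fun η =>
    (ContinuousLinearMap.compL ℝ _ _ ℝ).flip J ∘L bilin η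
  have hbA : Continuous bA := continuous_const.clm_comp continuous_bilin
  let bG : (X × K × ℂ) [⋀^Fin 2]→L[ℝ] ℝ → K →L[ℝ] K →L[ℝ] ℝ := fun η =>
    (ContinuousLinearMap.compL ℝ _ _ ℝ).flip (jK ∘L mI) ∘L bilin η ∘L jK
  have hbG : Continuous bG :=
    continuous_const.clm_comp (continuous_bilin.clm_comp continuous_const)
  obtain ⟨δ, hδ, h1⟩ := exists_forall_near_pos (b := bA (A (x₀, 0))) hAJ
  obtain ⟨κ, hκ, h2⟩ := exists_forall_near_pos (b := bG (G (x₀, 0, 0))) hGpos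
  have hbd0 : blowDown ι y₀ ((x₀, 0, 0) : X × K × ℂ) = (x₀, 0) := by simp [blowDown]
  have hAc : ContinuousAt (fun p => A (blowDown ι y₀ p)) ((x₀, 0, 0) : X × K × ℂ) := by
    refine ContinuousAt.comp (g := A) ?_ (contDiff_blowDown ι y₀).continuous.continuousAt
    rwa [hbd0]
  have h1' := (hbA.continuousAt.comp hAc).eventually (by simpa only [Function.comp, hbd0] using h1)
  have h2' := (hbG.continuousAt.comp hG).eventually h2
  have h3 : ∀ᶠ p in 𝓝 ((x₀, 0, 0) : X × K × ℂ), ‖G p‖ < ‖G (x₀, 0, 0)‖ + 1 :=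
    hG.norm.eventually_lt continuousAt_const (lt_add_one _)
  have h4 : ∀ᶠ p in 𝓝 ((x₀, 0, 0) : X × K × ℂ), y₀ + ι p.2.1 ≠ 0 := by
    have : Continuous fun p : X × K × ℂ => y₀ + ι p.2.1 := by fun_prop
    exact this.continuousAt.eventually_ne (by simpa using hy₀)
  set C₀ := ‖G (x₀, 0, 0)‖ + 1 with hC₀
  have hC₀p : 0 ≤ C₀ := by positivity
  set C := C₀ * (1 + ‖J‖) with hC
  have hCp : 0 ≤ C := by positivity
  -- This is the bound asked for by `pos_of_blowUp_estimate`, with C bounding the cross terms of G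
  -- through the norms of G and J.
  refine ⟨δ / (C + C ^ 2 / (2 * κ) + 1), by positivity, ?_⟩
  filter_upwards [h1', h2', h3, h4, hG0] with p p1 p2 p3 p4 p5 s hs hs' v hv
  set V := blowDownDeriv ι y₀ p v with hV
  obtain ⟨x, ζ, t⟩ := v
  -- The test vector: its last two components are I times those of v, and the first is chosen so
  -- that the blow-down derivative sends it to J V.
  let R : X × K × ℂ := ((J V).1, Complex.I • ζ, Complex.I • t)
  have hLR : blowDownDeriv ι y₀ p R = J V := by
    refine Prod.ext rfl ?_
    rw [hJ, hV, blowDownDeriv_apply, blowDownDeriv_apply]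
    simp only [R, map_smul, smul_add, smul_smul, smul_eq_mul, mul_comm Complex.I]
  have hVx : ‖x‖ ≤ ‖V‖ := norm_fst_le V
  have hJV : ‖(J V).1‖ ≤ ‖J‖ * ‖V‖ := (norm_fst_le _).trans (J.le_opNorm V)
  have hAv : δ * ‖V‖ ^ 2 ≤ A (blowDown ι y₀ p) ![V, J V] := p1 V
  -- The scalar direction lies in the kernel of G p, so t does not enter the estimate. It is
  -- recovered at the end from V = 0, once ζ = 0.
  have hkill2 : ∀ s w, bilin (G p) w (0, 0, s) = 0 := fun s w => by
    rw [bilin_swap, bilin_apply, p5, neg_zero]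
  have hGv : κ * ‖ζ‖ ^ 2 - C * ‖V‖ * ‖ζ‖ - C * ‖V‖ ^ 2 ≤ G p ![(x, ζ, t), R] := by
    have e1 : ((x, ζ, t) : X × K × ℂ) = (x, 0, 0) + (0, ζ, 0) + (0, 0, t) := by simp
    have e2 : R = ((J V).1, 0, 0) + (0, Complex.I • ζ, 0) + (0, 0, Complex.I • t) := by simp [R]
    have e3 : G p ![(x, ζ, t), R] = bilin (G p) (x, 0, 0) ((J V).1, 0, 0) +
        bilin (G p) (x, 0, 0) (0, Complex.I • ζ, 0) + bilin (G p) (0, ζ, 0) ((J V).1, 0, 0) +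
        bilin (G p) (0, ζ, 0) (0, Complex.I • ζ, 0) := by
      rw [← bilin_apply, e1, e2]
      simp only [map_add, add_apply, hkill2]
      have : ∀ w, bilin (G p) (0, 0, t) w = 0 := fun w => p5 t w
      simp only [this]; ring
    have b1 := abs_bilin_le (G p) (x, 0, 0) ((J V).1, 0, 0)
    have b2 := abs_bilin_le (G p) (x, 0, 0) (0, Complex.I • ζ, 0)
    have b3 := abs_bilin_le (G p) (0, ζ, 0) ((J V).1, 0, 0)
    have b4 : κ * ‖ζ‖ ^ 2 ≤ bilin (G p) (0, ζ, 0) (0, Complex.I • ζ, 0) := p2 ζ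
    have n1 : ∀ x : X, ‖((x, 0, 0) : X × K × ℂ)‖ = ‖x‖ := fun x => by simp [Prod.norm_def]
    have n2 : ∀ z : K, ‖((0, z, 0) : X × K × ℂ)‖ = ‖z‖ := fun z => by simp [Prod.norm_def]
    rw [n1, n1] at b1
    rw [n1, n2, norm_smul, Complex.norm_I, one_mul] at b2
    rw [n1, n2] at b3
    have c1 : ‖G p‖ * (‖x‖ * ‖(J V).1‖) ≤ C₀ * (‖V‖ * (‖J‖ * ‖V‖)) := by gcongr
    have c2 : ‖G p‖ * (‖x‖ * ‖ζ‖) ≤ C₀ * (‖V‖ * ‖ζ‖) := by gcongr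
    have c3 : ‖G p‖ * (‖ζ‖ * ‖(J V).1‖) ≤ C₀ * (‖ζ‖ * (‖J‖ * ‖V‖)) := by gcongr
    rw [e3]
    have d0 : 0 ≤ C₀ * ‖V‖ ^ 2 := by positivity
    have d1 : C * ‖V‖ * ‖ζ‖ = C₀ * (‖V‖ * ‖ζ‖) + C₀ * (‖ζ‖ * (‖J‖ * ‖V‖)) := by rw [hC]; ring
    have d2 : C * ‖V‖ ^ 2 = C₀ * ‖V‖ ^ 2 + C₀ * (‖V‖ * (‖J‖ * ‖V‖)) := by rw [hC]; ring
    linarith [(abs_le.1 b1).1, (abs_le.1 b2).1, (abs_le.1 b3).1]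
  have htot : A (blowDown ι y₀ p) ![V, J V] + s * G p ![(x, ζ, t), R] = 0 := by
    have h := hv R
    rw [ContinuousAlternatingMap.add_apply, ContinuousAlternatingMap.smul_apply,
      ContinuousAlternatingMap.compContinuousLinearMap_apply] at h
    have e : (blowDownDeriv ι y₀ p ∘ ![(x, ζ, t), R]) = ![V, J V] := by
      ext l <;> fin_cases l <;> simp [hLR, hV]
    rw [← e]; exact h
  obtain ⟨hV0, hζ0⟩ := pos_of_blowUp_estimate (a := ‖V‖) (n := ‖ζ‖) hκ hs hAv hGv
    (by rwa [lt_div_iff₀ (by positivity)] at hs') htot.le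
  have hζ : ζ = 0 := norm_eq_zero.1 hζ0
  have hV1 : V = 0 := norm_eq_zero.1 hV0
  subst hζ
  rw [hV, blowDownDeriv_apply] at hV1
  have hx : x = 0 := congrArg Prod.fst hV1
  have ht : t = 0 := by
    have h := congrArg Prod.snd hV1
    simp only [map_zero, smul_zero, zero_add, Prod.snd_zero] at h
    exact (smul_eq_zero.1 h).resolve_right p4
  simp [hx, ht]

end LinearAlgebra

/-! ### Complex embeddings and trivializations of the normal bundle. -/

section Bundles

variable {E' : Type*} [NormedAddCommGroup E'] [NormedSpace ℝ E']
  {Z : Type*} [TopologicalSpace Z] [ChartedSpace E' Z] [IsManifold 𝓘(ℝ, E') ∞ Z]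
  {F : Type*} [NormedAddCommGroup F] [NormedSpace ℝ F]
  {N : Z → Type*} [∀ z, AddCommGroup (N z)] [∀ z, Module ℂ (N z)]
  [∀ z, TopologicalSpace (N z)] [TopologicalSpace (TotalSpace F N)]
  [FiberBundle F N] [VectorBundle ℝ F N] [ContMDiffVectorBundle ∞ F N 𝓘(ℝ, E')]

/-- The fibre coordinate is smooth over `baseSet`. Near any point outside, the bump function is
identically 0, so the behaviour of `linearMapAt` there is harmless. -/
theorem contMDiff_bump_smul_linearMapAt [FiniteDimensional ℝ E'] [T2Space Z] {z₀ : Z}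
    (f : SmoothBumpFunction 𝓘(ℝ, E') z₀)
    (hf : tsupport f ⊆ (trivializationAt F N z₀).baseSet) :
    ContMDiff (𝓘(ℝ, E').prod 𝓘(ℝ, F)) 𝓘(ℝ, F) ∞ fun p : TotalSpace F N =>
      f p.proj • (trivializationAt F N z₀).linearMapAt ℝ p.proj p.2 := by
  intro p
  by_cases hp : p.proj ∈ (trivializationAt F N z₀).baseSet
  · have h1 : ContMDiffAt (𝓘(ℝ, E').prod 𝓘(ℝ, F)) 𝓘(ℝ, ℝ) ∞ (fun p : TotalSpace F N => f p.proj) p :=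
      (f.contMDiff.contMDiffAt).comp p (Bundle.contMDiffAt_proj N)
    have hp' : p ∈ (trivializationAt F N z₀).source := by
      rwa [(trivializationAt F N z₀).mem_source]
    have h2 : ContMDiffAt (𝓘(ℝ, E').prod 𝓘(ℝ, F)) 𝓘(ℝ, F) ∞
        (fun p : TotalSpace F N => (trivializationAt F N z₀ p).2) p :=
      ((Bundle.Trivialization.contMDiffAt_iff (IB := 𝓘(ℝ, E')) (e := trivializationAt F N z₀)
        (f := id) hp').1 contMDiffAt_id).2
    refine (h1.smul h2).congr_of_eventuallyEq ?_
    filter_upwards [(trivializationAt F N z₀).open_source.mem_nhds hp'] with q hq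
    rw [(trivializationAt F N z₀).mem_source] at hq
    rw [(trivializationAt F N z₀).linearMapAt_apply, if_pos hq]
    rfl
  · have h1 : ∀ᶠ q : TotalSpace F N in 𝓝 p, f q.proj = 0 := by
      have h2 : (tsupport f)ᶜ ∈ 𝓝 p.proj :=
        (isClosed_tsupport _).isOpen_compl.mem_nhds fun h => hp (hf h)
      filter_upwards [(FiberBundle.continuous_proj F N).continuousAt.eventually h2] with q hq
      exact image_eq_zero_of_notMem_tsupport hq
    refine (contMDiffAt_const (c := (0 : F))).congr_of_eventuallyEq ?_
    filter_upwards [h1] with q hq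
    rw [hq, zero_smul]

/-- The complexification of a real linear map from a complex vector space. -/
def complexify {Y : Type*} [AddCommGroup Y] [Module ℂ Y] (k : Y →ₗ[ℝ] ℝ) : Y →ₗ[ℂ] ℂ where
  toFun v := (k v : ℂ) - Complex.I * (k (Complex.I • v) : ℂ)
  map_add' v w := by simp; ring
  map_smul' a v := by
    have h1 : a • v = a.re • v + a.im • (Complex.I • v) := by
      conv_lhs => rw [← Complex.re_add_im a, add_smul, mul_smul]
      simp only [Complex.coe_smul]
    have h2 : Complex.I • a • v = a.re • (Complex.I • v) - a.im • v := by
      rw [h1, smul_add, smul_comm Complex.I a.re, smul_comm Complex.I a.im, smul_smul Complex.I]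
      simp [sub_eq_add_neg]
    rw [h2, h1]
    simp only [map_add, map_sub, map_smul, RingHom.id_apply, smul_eq_mul, Complex.ofReal_add,
      Complex.ofReal_sub, Complex.ofReal_mul]
    conv_rhs => rw [← Complex.re_add_im a]
    ring_nf
    simp only [Complex.I_sq]
    ring

theorem complexify_apply {Y : Type*} [AddCommGroup Y] [Module ℂ Y] (k : Y →ₗ[ℝ] ℝ) (v : Y) :
    complexify k v = (k v : ℂ) - Complex.I * (k (Complex.I • v) : ℂ) := rfl

theorem complexify_eq_zero {Y : Type*} [AddCommGroup Y] [Module ℂ Y] {k : Y →ₗ[ℝ] ℝ} {v : Y}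
    (h : complexify k v = 0) : k v = 0 := by
  have := congrArg Complex.re h
  simpa [complexify_apply] using this

/-- Sums of complexified coordinate functions are smooth on the total space. -/
theorem contMDiff_sum_complexify {H : Type*} [NormedAddCommGroup H] [InnerProductSpace ℂ H]
    {ι : Type*} [Fintype ι] (b : ι → H) (k : ι → ∀ z, N z →ₗ[ℝ] ℝ)
    (hI : ContMDiff (𝓘(ℝ, E').prod 𝓘(ℝ, F)) (𝓘(ℝ, E').prod 𝓘(ℝ, F)) ∞
      (fun p : TotalSpace F N => (⟨p.proj, Complex.I • p.2⟩ : TotalSpace F N)))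
    (hk : ∀ l, ContMDiff (𝓘(ℝ, E').prod 𝓘(ℝ, F)) 𝓘(ℝ, ℝ) ∞
      fun p : TotalSpace F N => k l p.proj p.2) :
    ContMDiff (𝓘(ℝ, E').prod 𝓘(ℝ, F)) 𝓘(ℝ, H) ∞
      fun p : TotalSpace F N => ∑ l, complexify (k l p.proj) p.2 • b l := by
  have hsum : ∀ s : Finset ι, ContMDiff (𝓘(ℝ, E').prod 𝓘(ℝ, F)) 𝓘(ℝ, H) ∞
      fun p : TotalSpace F N => ∑ l ∈ s, complexify (k l p.proj) p.2 • b l := by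
    classical
    intro s
    induction s using Finset.induction_on with
    | empty => simpa using contMDiff_const
    | insert l s hl ih =>
      simp only [Finset.sum_insert hl]
      refine ContMDiff.add ?_ ih
      have h2 : ContMDiff (𝓘(ℝ, E').prod 𝓘(ℝ, F)) 𝓘(ℝ, ℝ) ∞
          fun p : TotalSpace F N => k l p.proj (Complex.I • p.2) := (hk l).comp hI
      let L : ℝ × ℝ → H := fun r => ((r.1 : ℂ) - Complex.I * (r.2 : ℂ)) • b l
      have hL : ContDiff ℝ ∞ L := by
        refine ContDiff.smul ?_ contDiff_const
        have h3 := Complex.ofRealCLM.contDiff (n := ∞)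
        exact (h3.comp contDiff_fst).sub (contDiff_const.mul (h3.comp contDiff_snd))
      exact hL.contMDiff.comp ((hk l).prodMk_space h2)
  exact hsum Finset.univ

/-- A complex vector bundle over a compact manifold embeds fibrewise in a trivial one. -/
theorem exists_fibrewise_embedding [FiniteDimensional ℝ E'] [T2Space Z] [CompactSpace Z]
    (hF : Nonempty Z → FiniteDimensional ℝ F)
    (hI : ContMDiff (𝓘(ℝ, E').prod 𝓘(ℝ, F)) (𝓘(ℝ, E').prod 𝓘(ℝ, F)) ∞
      (fun p : TotalSpace F N => (⟨p.proj, Complex.I • p.2⟩ : TotalSpace F N))) :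
    ∃ (H : Type) (_ : NormedAddCommGroup H) (_ : InnerProductSpace ℂ H)
      (_ : FiniteDimensional ℂ H) (c : ∀ z, N z →ₗ[ℂ] H), (∀ z, Function.Injective (c z)) ∧
      ContMDiff (𝓘(ℝ, E').prod 𝓘(ℝ, F)) 𝓘(ℝ, H) ∞ fun p : TotalSpace F N => c p.proj p.2 := by
  classical
  rcases isEmpty_or_nonempty Z with hZ | hZ
  · refine ⟨ℂ, inferInstance, inferInstance, inferInstance, fun z => isEmptyElim z,
      fun z => isEmptyElim z, fun p => isEmptyElim p.proj⟩
  have := hF hZ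
  have hbump : ∀ z₀ : Z, ∃ f : SmoothBumpFunction 𝓘(ℝ, E') z₀,
      tsupport f ⊆ (trivializationAt F N z₀).baseSet := fun z₀ => by
    obtain ⟨f, -, hf⟩ := (SmoothBumpFunction.nhds_basis_tsupport (I := 𝓘(ℝ, E')) z₀).mem_iff.1
      ((trivializationAt F N z₀).open_baseSet.mem_nhds
        (FiberBundle.mem_baseSet_trivializationAt' z₀))
    exact ⟨f, hf⟩
  choose f hf using hbump
  obtain ⟨s, -, hs⟩ := isCompact_univ.elim_nhds_subcover (fun z₀ => Function.support (f z₀))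
    fun z₀ _ => (f z₀).support_mem_nhds
  let β := Module.finBasis ℝ F
  -- Cut-off real coordinates. The trivializations are only real linear, so each coordinate is
  -- complexified; its real part is the original coordinate, which gives injectivity wherever some
  -- bump function is nonzero.
  let k : (s × Fin (Module.finrank ℝ F)) → ∀ z, N z →ₗ[ℝ] ℝ := fun l z =>
    β.coord l.2 ∘ₗ (f l.1 z • (trivializationAt F N (l.1 : Z)).linearMapAt ℝ z)
  have hk : ∀ l, ContMDiff (𝓘(ℝ, E').prod 𝓘(ℝ, F)) 𝓘(ℝ, ℝ) ∞
      fun p : TotalSpace F N => k l p.proj p.2 := fun l =>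
    (LinearMap.toContinuousLinearMap (β.coord l.2)).contDiff.contMDiff.comp
      (contMDiff_bump_smul_linearMapAt (f l.1) (hf l.1))
  let e := Fintype.equivFin (s × Fin (Module.finrank ℝ F))
  let m := Fintype.card (s × Fin (Module.finrank ℝ F))
  let c : ∀ z, N z →ₗ[ℂ] EuclideanSpace ℂ (Fin m) := fun z =>
    ∑ l, (complexify (k l z)).smulRight (EuclideanSpace.basisFun (Fin m) ℂ (e l))
  have hc : ∀ z v, c z v =
      ∑ l, complexify (k l z) v • EuclideanSpace.basisFun (Fin m) ℂ (e l) := fun z v => by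
    simp [c]
  refine ⟨EuclideanSpace ℂ (Fin m), inferInstance, inferInstance, inferInstance, c,
    fun z => ?_, ?_⟩
  · refine (injective_iff_map_eq_zero _).2 fun v hv => ?_
    have h1 : ∀ l, complexify (k l z) v = 0 := by
      have hli := (EuclideanSpace.basisFun (Fin m) ℂ).orthonormal.linearIndependent.comp _ e.injective
      rw [hc] at hv
      exact Fintype.linearIndependent_iff.1 hli _ hv
    obtain ⟨z₀, hz₀, hz⟩ := mem_iUnion₂.1 (hs (mem_univ z))
    have h2 : f z₀ z • (trivializationAt F N z₀).linearMapAt ℝ z v = 0 := by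
      refine (Module.Basis.forall_coord_eq_zero_iff β).1 fun l => ?_
      exact complexify_eq_zero (h1 (⟨z₀, hz₀⟩, l))
    have h3 := (smul_eq_zero.1 h2).resolve_left hz
    have hzb : z ∈ (trivializationAt F N z₀).baseSet := hf z₀ (subset_tsupport _ hz)
    have h4 := (trivializationAt F N z₀).symmₗ_linearMapAt (R := ℝ) hzb v
    rw [← h4, h3, map_zero]
  · simp only [hc]
    exact contMDiff_sum_complexify _ k hI hk

/-- A complex trivialization `γ` of `N` near `z₀`, inverse to the fibre coordinate `P ∘ c`. -/
structure IsComplexTrivialization {H Y : Type*} [NormedAddCommGroup H] [InnerProductSpace ℂ H]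
    [NormedAddCommGroup Y] [InnerProductSpace ℂ Y] (c : ∀ z, N z →ₗ[ℂ] H) (z₀ : Z)
    (P : H →L[ℂ] Y) (ι : Y →ₗᵢ[ℂ] H) (γ : E' × Y → TotalSpace F N) (U : Set E') : Prop where
  isOpen : IsOpen U
  mem : extChartAt 𝓘(ℝ, E') z₀ z₀ ∈ U
  subset : U ⊆ (extChartAt 𝓘(ℝ, E') z₀).target
  proj : ∀ x ∈ U, ∀ y, (γ (x, y)).proj = (extChartAt 𝓘(ℝ, E') z₀).symm x
  coord : ∀ x ∈ U, ∀ y, P (c _ (γ (x, y)).2) = y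
  injective : ∀ x ∈ U, Function.Injective
    fun v : N ((extChartAt 𝓘(ℝ, E') z₀).symm x) => P (c _ v)
  smooth : ∀ x ∈ U, ∀ y, ContMDiffAt 𝓘(ℝ, E' × Y) (𝓘(ℝ, E').prod 𝓘(ℝ, F)) ∞ γ (x, y)
  center : ∀ y, c _ (γ (extChartAt 𝓘(ℝ, E') z₀ z₀, y)).2 = ι y

/-- Complex trivializations exist. -/
theorem exists_isComplexTrivialization {H Y : Type*} [NormedAddCommGroup H] [InnerProductSpace ℂ H]
    [FiniteDimensional ℂ H] [NormedAddCommGroup Y] [InnerProductSpace ℂ Y] [FiniteDimensional ℂ Y]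
    [FiniteDimensional ℝ F] (c : ∀ z, N z →ₗ[ℂ] H) (hc : ∀ z, Function.Injective (c z))
    (hcs : ContMDiff (𝓘(ℝ, E').prod 𝓘(ℝ, F)) 𝓘(ℝ, H) ∞ fun p : TotalSpace F N => c p.proj p.2)
    (z₀ : Z) (ι : Y →ₗᵢ[ℂ] H) (hι : LinearMap.range ι.toLinearMap = LinearMap.range (c z₀)) :
    ∃ (P : H →L[ℂ] Y) (γ : E' × Y → TotalSpace F N) (U : Set E'),
      IsComplexTrivialization c z₀ P ι γ U := by
  classical
  have : CompleteSpace Y := FiniteDimensional.complete ℂ Y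
  have : CompleteSpace H := FiniteDimensional.complete ℂ H
  have : CompleteSpace F := FiniteDimensional.complete ℝ F
  have : FiniteDimensional ℝ Y := FiniteDimensional.complexToReal Y
  let P : H →L[ℂ] Y := ContinuousLinearMap.adjoint ι.toContinuousLinearMap
  have hP : ∀ y, P (ι y) = y := fun y => by
    refine ext_inner_right ℂ fun w => ?_
    rw [ContinuousLinearMap.adjoint_inner_left]
    exact ι.inner_map_map y w
  let ch := extChartAt 𝓘(ℝ, E') z₀
  let e := trivializationAt F N z₀
  let U₀ : Set E' := ch.target ∩ ch.symm ⁻¹' e.baseSet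
  have hU₀ : IsOpen U₀ :=
    (continuousOn_extChartAt_symm z₀).isOpen_inter_preimage (isOpen_extChartAt_target z₀)
      e.open_baseSet
  have hx₀ : ch z₀ ∈ U₀ := by
    refine ⟨mem_extChartAt_target z₀, ?_⟩
    rw [mem_preimage, extChartAt_to_inv]
    exact FiberBundle.mem_baseSet_trivializationAt' z₀
  -- The coordinate P ∘ c read in the real trivialization `e`. It is bijective at the centre, where
  -- ι identifies Y with the range of c, hence invertible nearby; composing its inverse with `e`
  -- gives γ.
  let a : E' → F →L[ℝ] Y := fun x => LinearMap.toContinuousLinearMap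
    ((((P : H →ₗ[ℂ] Y) ∘ₗ c (ch.symm x)).restrictScalars ℝ) ∘ₗ e.symmₗ ℝ (ch.symm x))
  have ha : ∀ x w, a x w = P (c (ch.symm x) (e.symmₗ ℝ (ch.symm x) w)) := fun x w => rfl
  have hsymm : ∀ x ∈ U₀, ∀ w, (⟨ch.symm x, e.symmₗ ℝ (ch.symm x) w⟩ : TotalSpace F N) =
      e.toOpenPartialHomeomorph.symm (ch.symm x, w) := fun x hx w => by
    rw [e.coe_symmₗ (R := ℝ) hx.2, e.mk_symm hx.2]
  have hlift : ∀ (x : E') (hx : x ∈ U₀) (w : F),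
      ContMDiffAt (𝓘(ℝ, E').prod 𝓘(ℝ, F)) (𝓘(ℝ, E').prod 𝓘(ℝ, F)) ∞
        e.toOpenPartialHomeomorph.symm (ch.symm x, w) := fun x hx w =>
    (e.contMDiffOn_symm (IB := 𝓘(ℝ, E')) (n := ∞)).contMDiffAt
      (e.open_target.mem_nhds (by rw [e.mem_target]; exact hx.2))
  have has : ContDiffOn ℝ ∞ a U₀ := by
    refine contDiffOn_clm_apply.2 fun w => ?_
    intro x hx
    refine ContDiffAt.contDiffWithinAt (ContMDiffAt.contDiffAt ?_)
    have h1 : ContMDiffAt 𝓘(ℝ, E') 𝓘(ℝ, H) ∞ (fun x' => (fun p : TotalSpace F N => c p.proj p.2)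
        (e.toOpenPartialHomeomorph.symm (ch.symm x', w))) x := by
      refine (hcs _).comp x (ContMDiffAt.comp (I' := 𝓘(ℝ, E').prod 𝓘(ℝ, F)) x (hlift x hx w) ?_)
      exact (contMDiffAt_extChartAt_symm z₀ hx.1).prodMk contMDiffAt_const
    have h2 := (P.restrictScalars ℝ).contDiff.contMDiff.contMDiffAt.comp x h1
    refine h2.congr_of_eventuallyEq ?_
    filter_upwards [hU₀.mem_nhds hx] with x' hx'
    change a x' w = P ((fun p : TotalSpace F N => c p.proj p.2)
      (e.toOpenPartialHomeomorph.symm (ch.symm x', w)))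
    rw [← hsymm x' hx']
    rfl
  have hinj₀ : Function.Injective fun v : N (ch.symm (ch z₀)) => P (c _ v) := by
    have hz : ch.symm (ch z₀) = z₀ := extChartAt_to_inv z₀
    rw [hz]
    intro v v' hv
    obtain ⟨y, hy⟩ : c z₀ v ∈ LinearMap.range ι.toLinearMap := hι ▸ ⟨v, rfl⟩
    obtain ⟨y', hy'⟩ : c z₀ v' ∈ LinearMap.range ι.toLinearMap := hι ▸ ⟨v', rfl⟩
    apply hc
    simp only [← hy, ← hy'] at hv ⊢
    have hv' : P (ι y) = P (ι y') := hv
    rw [hP, hP] at hv'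
    rw [hv']
  have hsurj₀ : ∀ y, ∃ v : N (ch.symm (ch z₀)), c _ v = ι y := by
    have hz : ch.symm (ch z₀) = z₀ := extChartAt_to_inv z₀
    rw [hz]
    intro y
    have : ι y ∈ LinearMap.range (c z₀) := hι ▸ ⟨y, rfl⟩
    exact this
  have hbij : Function.Bijective (a (ch z₀)) := by
    constructor
    · intro w w' hw
      have h1 := hinj₀ hw
      rw [← e.linearMapAt_symmₗ (R := ℝ) hx₀.2 w, h1, e.linearMapAt_symmₗ (R := ℝ) hx₀.2]
    · intro y
      obtain ⟨v, hv⟩ := hsurj₀ y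
      refine ⟨e.linearMapAt ℝ _ v, ?_⟩
      rw [ha, e.symmₗ_linearMapAt (R := ℝ) hx₀.2, hv, hP]
  let U : Set E' := U₀ ∩ a ⁻¹' range ((↑) : (F ≃L[ℝ] Y) → F →L[ℝ] Y)
  have hU : IsOpen U := has.continuousOn.isOpen_inter_preimage hU₀ ContinuousLinearEquiv.isOpen
  have hmem : ch z₀ ∈ U := by
    refine ⟨hx₀, (LinearEquiv.ofBijective (a (ch z₀) : F →ₗ[ℝ] Y) hbij).toContinuousLinearEquiv, ?_⟩
    ext w; rfl
  let γ : E' × Y → TotalSpace F N := fun q =>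
    ⟨ch.symm q.1, e.symmₗ ℝ (ch.symm q.1) ((a q.1).inverse q.2)⟩
  have hγ : ∀ x ∈ U, ∀ y, P (c _ (γ (x, y)).2) = y := by
    rintro x ⟨-, L, hL⟩ y
    change a x ((a x).inverse y) = y
    rw [← hL, ContinuousLinearMap.inverse_equiv]
    simp
  refine ⟨P, γ, U, hU, hmem, fun x hx => hx.1.1, fun x hx y => rfl, hγ, ?_, ?_, ?_⟩
  · rintro x ⟨hx, L, hL⟩ v v' hv
    have h1 : ∀ u, P (c (ch.symm x) u) = L (e.linearMapAt ℝ _ u) := fun u => by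
      conv_lhs => rw [← e.symmₗ_linearMapAt (R := ℝ) hx.2 u]
      rw [← ha, ← hL]; rfl
    have h2 : L (e.linearMapAt ℝ _ v) = L (e.linearMapAt ℝ _ v') := by rw [← h1, ← h1]; exact hv
    rw [← e.symmₗ_linearMapAt (R := ℝ) hx.2 v, L.injective h2, e.symmₗ_linearMapAt (R := ℝ) hx.2]
  · rintro x ⟨hx, L, hL⟩ y
    have h1 : ContDiffAt ℝ ∞ (fun q : E' × Y => (a q.1).inverse q.2) (x, y) := by
      have h2 : ContDiffAt ℝ ∞ (fun q : E' × Y => (a q.1).inverse) (x, y) := by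
        have h0 : ContDiffAt ℝ ∞ (a ∘ Prod.fst) ((x, y) : E' × Y) :=
          ContDiffAt.comp (g := a) (x, y) (has.contDiffAt (hU₀.mem_nhds hx)) contDiffAt_fst
        refine ContDiffAt.comp (g := ContinuousLinearMap.inverse) (x, y) ?_ h0
        change ContDiffAt ℝ ∞ ContinuousLinearMap.inverse (a x)
        rw [← hL]
        exact contDiffAt_map_inverse L
      exact h2.clm_apply contDiffAt_snd
    have h3 : ContMDiffAt 𝓘(ℝ, E' × Y) (𝓘(ℝ, E').prod 𝓘(ℝ, F)) ∞
        (fun q : E' × Y => (ch.symm q.1, (a q.1).inverse q.2)) (x, y) := by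
      refine ContMDiffAt.prodMk ?_ h1.contMDiffAt
      exact ContMDiffAt.comp (I' := 𝓘(ℝ, E')) (x, y) (contMDiffAt_extChartAt_symm z₀ hx.1)
        contDiffAt_fst.contMDiffAt
    refine (ContMDiffAt.comp (x, y) (hlift x hx _) h3).congr_of_eventuallyEq ?_
    have h4 : ∀ᶠ q : E' × Y in 𝓝 (x, y), q.1 ∈ U₀ :=
      continuous_fst.continuousAt.eventually (hU₀.mem_nhds hx)
    filter_upwards [h4] with q hq
    exact hsymm q.1 hq _
  · intro y
    obtain ⟨v, hv⟩ := hsurj₀ y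
    rw [← hv]
    congr 1
    apply hinj₀
    change P (c _ (γ (ch z₀, y)).2) = P (c _ v)
    rw [hγ _ hmem, hv, hP]

end Bundles

/-! ### Pullback of forms between manifolds and non-degeneracy. -/

section PullbackSmooth

variable {E : Type*} [NormedAddCommGroup E] [NormedSpace ℝ E]
  {M : Type*} [TopologicalSpace M] [ChartedSpace E M] [IsManifold 𝓘(ℝ, E) ∞ M]
  {E' : Type*} [NormedAddCommGroup E'] [NormedSpace ℝ E']
  {M' : Type*} [TopologicalSpace M'] [ChartedSpace E' M'] [IsManifold 𝓘(ℝ, E') ∞ M']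
  {V : Type*} [NormedAddCommGroup V] [NormedSpace ℝ V]
  {k : ℕ} {f : M' → M} {α : DiffForm E M k}

theorem eventually_mdifferentiableAt {x : M'} (hf : ContMDiffAt 𝓘(ℝ, E') 𝓘(ℝ, E) ∞ f x) :
    ∀ᶠ x' in 𝓝 x, MDifferentiableAt 𝓘(ℝ, E') 𝓘(ℝ, E) f x' :=
  ((contMDiffAt_iff_contMDiffAt_nhds (by simp)).1
    (hf.of_le (by simp : (1 : ℕ∞ω) ≤ ∞))).mono fun _ h => h.mdifferentiableAt (by simp)

theorem DiffForm.pull_pullback_eventuallyEq {g : V → M'} {y : V} (α : DiffForm E M k)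
    (hf : ContMDiffAt 𝓘(ℝ, E') 𝓘(ℝ, E) ∞ f (g y)) (hg : ContMDiffAt 𝓘(ℝ, V) 𝓘(ℝ, E') ∞ g y) :
    (DiffForm.pullback (E := E') f α).pull g =ᶠ[𝓝 y] α.pull (f ∘ g) := by
  filter_upwards [hg.continuousAt.eventually (eventually_mdifferentiableAt hf),
    eventually_mdifferentiableAt hg] with y' h1 h2
  exact DiffForm.pull_pullback α h1 h2

theorem DiffForm.SmoothAt.pullback {x : M'} (hα : α.SmoothAt (f x))
    (hf : ContMDiffAt 𝓘(ℝ, E') 𝓘(ℝ, E) ∞ f x) : (DiffForm.pullback (E := E') f α).SmoothAt x := by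
  have hx : (extChartAt 𝓘(ℝ, E') x).symm (extChartAt 𝓘(ℝ, E') x x) = x := extChartAt_to_inv x
  have h1 := contMDiffAt_extChartAt_symm x (mem_extChartAt_target (I := 𝓘(ℝ, E')) x)
  have hf' : ContMDiffAt 𝓘(ℝ, E') 𝓘(ℝ, E) ∞ f
      ((extChartAt 𝓘(ℝ, E') x).symm (extChartAt 𝓘(ℝ, E') x x)) := by rwa [hx]
  refine ContDiffAt.congr_of_eventuallyEq ?_ (DiffForm.pull_pullback_eventuallyEq α hf' h1)
  refine DiffForm.SmoothAt.pull ?_ (hf'.comp _ h1)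
  rwa [Function.comp, hx]

theorem DiffForm.SmoothAt.d_pullback {x : M'} (hα : α.SmoothAt (f x))
    (hf : ContMDiffAt 𝓘(ℝ, E') 𝓘(ℝ, E) ∞ f x) :
    (DiffForm.pullback (E := E') f α).d x = DiffForm.pullback (E := E') f α.d x := by
  have hx : (extChartAt 𝓘(ℝ, E') x).symm (extChartAt 𝓘(ℝ, E') x x) = x := extChartAt_to_inv x
  have h1 := contMDiffAt_extChartAt_symm x (mem_extChartAt_target (I := 𝓘(ℝ, E')) x)
  have hf' : ContMDiffAt 𝓘(ℝ, E') 𝓘(ℝ, E) ∞ f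
      ((extChartAt 𝓘(ℝ, E') x).symm (extChartAt 𝓘(ℝ, E') x x)) := by rwa [hx]
  have hα' : α.SmoothAt (f ((extChartAt 𝓘(ℝ, E') x).symm (extChartAt 𝓘(ℝ, E') x x))) := by rwa [hx]
  refine DiffForm.eq_of_inChart_eq ?_
  have hp : (DiffForm.pullback (E := E') f α).SmoothAt
      ((extChartAt 𝓘(ℝ, E') x).symm (extChartAt 𝓘(ℝ, E') x x)) := hα'.pullback hf'
  refine (hp.extDeriv_pull h1).symm.trans ?_
  rw [(DiffForm.pull_pullback_eventuallyEq α hf' h1).extDeriv_eq]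
  refine (DiffForm.SmoothAt.extDeriv_pull (g := f ∘ (extChartAt 𝓘(ℝ, E') x).symm) hα'
    (hf'.comp _ h1)).trans ?_
  exact (DiffForm.pull_pullback α.d (hf'.mdifferentiableAt (by simp))
    (h1.mdifferentiableAt (by simp))).symm

/-- Non-degeneracy of the `2`-form `α` at a point. -/
def DiffForm.NondegenerateAt (α : DiffForm E M 2) (x : M) : Prop :=
  Nondegenerate₂ (W := E) (α x)

theorem DiffForm.isNondegenerate_iff {α : DiffForm E M 2} :
    α.IsNondegenerate ↔ ∀ x, α.NondegenerateAt x := Iff.rfl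

/-- Surjectivity of the derivative suffices: a kernel vector of α lifts to a kernel vector of the
pulled back form, and that lift is 0. -/
theorem DiffForm.NondegenerateAt.of_pull {α : DiffForm E M 2} {g : V → M} {y : V}
    (hg : Function.Surjective (mfderiv 𝓘(ℝ, V) 𝓘(ℝ, E) g y)) (h : Nondegenerate₂ (α.pull g y)) :
    α.NondegenerateAt (g y) := by
  intro v hv
  obtain ⟨u, rfl⟩ := hg v
  have hu : u = 0 := by
    refine h u fun w => ?_
    rw [DiffForm.pull_apply]
    refine Eq.trans ?_ (hv (mfderiv 𝓘(ℝ, V) 𝓘(ℝ, E) g y w))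
    congr 1
    ext l; fin_cases l <;> rfl
  rw [hu]
  exact map_zero (mfderiv 𝓘(ℝ, V) 𝓘(ℝ, E) g y)

theorem DiffForm.NondegenerateAt.pull {α : DiffForm E M 2} {g : V → M} {y : V}
    (hg : Function.Bijective (mfderiv 𝓘(ℝ, V) 𝓘(ℝ, E) g y)) (h : α.NondegenerateAt (g y)) :
    Nondegenerate₂ (α.pull g y) := by
  intro v hv
  have h1 : mfderiv 𝓘(ℝ, V) 𝓘(ℝ, E) g y v = 0 := by
    refine h _ fun w => ?_
    obtain ⟨u, rfl⟩ := hg.2 w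
    refine Eq.trans ?_ (hv u)
    rw [DiffForm.pull_apply]
    congr 1
    ext l; fin_cases l <;> rfl
  exact hg.1 (h1.trans (map_zero (mfderiv 𝓘(ℝ, V) 𝓘(ℝ, E) g y)).symm)

theorem mfderiv_bijective_of_localDiffeo {f : M' → M} {x : M'}
    (hf : IsLocalDiffeomorphAt 𝓘(ℝ, E') 𝓘(ℝ, E) ∞ f x) :
    Function.Bijective (mfderiv 𝓘(ℝ, E') 𝓘(ℝ, E) f x) := by
  have h := hf.mfderivToContinuousLinearEquiv_coe (by simp)
  rw [← h]
  exact (hf.mfderivToContinuousLinearEquiv (by simp)).bijective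

theorem DiffForm.NondegenerateAt.pullback {α : DiffForm E M 2} {f : M' → M} {x : M'}
    (hf : Function.Bijective (mfderiv 𝓘(ℝ, E') 𝓘(ℝ, E) f x)) (h : α.NondegenerateAt (f x)) :
    (DiffForm.pullback (E := E') f α).NondegenerateAt x := by
  intro v hv
  have h1 : mfderiv 𝓘(ℝ, E') 𝓘(ℝ, E) f x v = 0 := by
    refine h _ fun w => ?_
    obtain ⟨u, rfl⟩ := hf.2 w
    refine Eq.trans ?_ (hv u)
    change _ = α (f x) fun l => mfderiv 𝓘(ℝ, E') 𝓘(ℝ, E) f x (![v, u] l)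
    congr 1
    ext l; fin_cases l <;> rfl
  exact hf.1 (h1.trans (map_zero (mfderiv 𝓘(ℝ, E') 𝓘(ℝ, E) f x)).symm)

end PullbackSmooth

/-! ### The tubular neighbourhood and the topology of the exceptional divisor. -/

section Setup

variable {E : Type*} [NormedAddCommGroup E] [NormedSpace ℝ E]
  {M : Type*} [TopologicalSpace M] [ChartedSpace E M] [IsManifold 𝓘(ℝ, E) ∞ M]
  {E' : Type*} [NormedAddCommGroup E'] [NormedSpace ℝ E']
  {Z : Type*} [TopologicalSpace Z] [ChartedSpace E' Z] [IsManifold 𝓘(ℝ, E') ∞ Z]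
  {F : Type*} [NormedAddCommGroup F] [NormedSpace ℝ F]
  {N : Z → Type*} [∀ z, AddCommGroup (N z)] [∀ z, Module ℂ (N z)]
  [∀ z, TopologicalSpace (N z)] [TopologicalSpace (TotalSpace F N)]
  [FiberBundle F N] [VectorBundle ℝ F N] [ContMDiffVectorBundle ∞ F N 𝓘(ℝ, E')]
  {B : Type*} [TopologicalSpace B] [ChartedSpace E B] [IsManifold 𝓘(ℝ, E) ∞ B]
  {i : Z → M} {ν : ∀ z, N z →ₗ[ℝ] TangentSpace 𝓘(ℝ, E) (i z)}
  {D : Set (TotalSpace F N)} {φ : TotalSpace F N → M}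
  {j : SubspaceVector N → B} {π : B → M}

namespace IsTubularNeighbourhood

theorem isOpen_image (hφ : IsTubularNeighbourhood E' i ν D φ) : IsOpen (φ '' D) := by
  rw [isOpen_iff_mem_nhds]
  rintro _ ⟨v, hv, rfl⟩
  obtain ⟨Φ, hvΦ, hΦ⟩ := hφ.localDiffeo ⟨v, hv⟩
  have h1 := Φ.toOpenPartialHomeomorph.image_mem_nhds hvΦ (hφ.isOpen.mem_nhds hv)
  have h2 : Φ.source ∩ D ∈ 𝓝 v := inter_mem (Φ.open_source.mem_nhds hvΦ) (hφ.isOpen.mem_nhds hv)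
  have h3 := Φ.toOpenPartialHomeomorph.image_mem_nhds hvΦ h2
  rw [hΦ hvΦ]
  refine mem_of_superset h3 ?_
  rintro _ ⟨w, hw, rfl⟩
  exact ⟨w, hw.2, hΦ hw.1⟩

theorem contMDiffAt (hφ : IsTubularNeighbourhood E' i ν D φ) {v : TotalSpace F N} (hv : v ∈ D) :
    ContMDiffAt (𝓘(ℝ, E').prod 𝓘(ℝ, F)) 𝓘(ℝ, E) ∞ φ v :=
  (hφ.localDiffeo ⟨v, hv⟩).contMDiffAt

theorem range_subset (hφ : IsTubularNeighbourhood E' i ν D φ) : range i ⊆ φ '' D := by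
  rintro _ ⟨z, rfl⟩
  exact ⟨⟨z, 0⟩, hφ.zero_mem z, hφ.map_zero z⟩

theorem apply_mem_range_iff (hφ : IsTubularNeighbourhood E' i ν D φ) {v : TotalSpace F N}
    (hv : v ∈ D) : φ v ∈ range i ↔ v.2 = 0 := by
  constructor
  · rintro ⟨z, hz⟩
    rw [← hφ.map_zero] at hz
    rw [← hφ.injOn (hφ.zero_mem z) hv hz]
  · intro h
    refine ⟨v.proj, ?_⟩
    rw [← hφ.map_zero]
    congr 1
    obtain ⟨z, v⟩ := v
    simp only at h
    rw [h]

variable [Nonempty (TotalSpace F N)]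

theorem invFunOn_apply (hφ : IsTubularNeighbourhood E' i ν D φ) {v : TotalSpace F N} (hv : v ∈ D) :
    Function.invFunOn φ D (φ v) = v :=
  hφ.injOn.leftInvOn_invFunOn hv

/-- Near φ v the global inverse on D agrees with the smooth local inverse, because the latter stays
in D by continuity and φ is injective on D. -/
theorem contMDiffAt_invFunOn (hφ : IsTubularNeighbourhood E' i ν D φ) {v : TotalSpace F N}
    (hv : v ∈ D) :
    ContMDiffAt 𝓘(ℝ, E) (𝓘(ℝ, E').prod 𝓘(ℝ, F)) ∞ (Function.invFunOn φ D) (φ v) := by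
  have hloc := hφ.localDiffeo ⟨v, hv⟩
  have h1 := hloc.localInverse_contMDiffAt
  refine h1.congr_of_eventuallyEq ?_
  have h2 : ∀ᶠ m in 𝓝 (φ v), hloc.localInverse m ∈ D := by
    refine h1.continuousAt.eventually (hφ.isOpen.mem_nhds ?_)
    rwa [hloc.localInverse_left_inv hloc.localInverse_mem_target]
  filter_upwards [h2, hloc.localInverse_eventuallyEq_right] with m hm1 hm2
  have hm3 : φ (hloc.localInverse m) = m := hm2
  conv_lhs => rw [← hm3]
  exact hφ.invFunOn_apply hm1

end IsTubularNeighbourhood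

/-- The trivialization is only real linear, so smooth dependence on a complex scalar is read off
from its real and imaginary parts. -/
theorem mk_smul_eq_symm (z₀ : Z) {z : Z} (hz : z ∈ (trivializationAt F N z₀).baseSet) (v : N z)
    (t : ℂ) : (⟨z, t • v⟩ : TotalSpace F N) =
      (trivializationAt F N z₀).toOpenPartialHomeomorph.symm
        (z, t.re • (trivializationAt F N z₀).linearMapAt ℝ z v +
          t.im • (trivializationAt F N z₀).linearMapAt ℝ z (Complex.I • v)) := by
  rw [← Bundle.Trivialization.mk_symm _ hz, ← map_smul, ← map_smul, ← map_add,
    ← Bundle.Trivialization.coe_symmₗ (R := ℝ) _ hz, Bundle.Trivialization.symmₗ_linearMapAt (R := ℝ) _ hz]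
  congr 1
  conv_lhs => rw [← Complex.re_add_im t]
  rw [add_smul, mul_smul, Complex.coe_smul, Complex.coe_smul]

theorem contMDiff_smul_fibre (z : Z) (v : N z) :
    ContMDiff 𝓘(ℝ, ℂ) (𝓘(ℝ, E').prod 𝓘(ℝ, F)) ∞ fun t : ℂ => (⟨z, t • v⟩ : TotalSpace F N) := by
  have hz := FiberBundle.mem_baseSet_trivializationAt' (F := F) (E := N) z
  rw [funext (mk_smul_eq_symm z hz v)]
  intro t
  have h := (trivializationAt F N z).contMDiffOn_symm (IB := 𝓘(ℝ, E')) (n := ∞)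
  refine (h.contMDiffAt ?_).comp t (f := fun t : ℂ => (z, t.re • _ + t.im • _)) ?_
  · exact (trivializationAt F N z).open_target.mem_nhds
      ((trivializationAt F N z).mem_target.2 hz)
  · refine contMDiffAt_const.prodMk ?_
    refine ContDiffAt.contMDiffAt ?_
    exact (Complex.reCLM.contDiff.contDiffAt.smul contDiffAt_const).add
      (Complex.imCLM.contDiff.contDiffAt.smul contDiffAt_const)

/-- A nonzero factor does not change the line ℂ w, so it can be moved into the scalar. At t = 0 it
disappears altogether, which allows normalizing w and shows that radial directions are collapsed. -/
theorem tautologicalMap_smul (z : Z) (v : N z) {a : ℂ} (ha : a ≠ 0) (t : ℂ) :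
    tautologicalMap ((⟨z, a • v⟩ : TotalSpace F N), t) =
      tautologicalMap ((⟨z, v⟩ : TotalSpace F N), t * a) := by
  simp only [tautologicalMap, smul_smul]
  rw [Submodule.span_singleton_smul_eq (IsUnit.mk0 a ha)]

theorem tautologicalMap_mem {w : TotalSpace F N} {t : ℂ} (hw : w.2 ≠ 0)
    (ht : (⟨w.proj, t • w.2⟩ : TotalSpace F N) ∈ D) :
    tautologicalMap (w, t) ∈ tautologicalOver D := by
  refine ⟨?_, ?_, ht⟩
  · change Module.finrank ℂ (Submodule.span ℂ {w.2}) = 1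
    exact finrank_span_singleton hw
  · change t • w.2 ∈ Submodule.span ℂ {w.2}
    exact Submodule.smul_mem _ _ (Submodule.mem_span_singleton_self _)

/-- The lift of the blow-down map to the normal bundle. -/
def normalLift [Nonempty (TotalSpace F N)] (D : Set (TotalSpace F N)) (φ : TotalSpace F N → M)
    (π : B → M) (b : B) : TotalSpace F N :=
  Function.invFunOn φ D (π b)

namespace IsBlowUp

theorem isOpen_preimage (hφ : IsTubularNeighbourhood E' i ν D φ) (hπ : IsBlowUp E E' i D φ j π) :
    IsOpen (π ⁻¹' (φ '' D)) :=
  hφ.isOpen_image.preimage hπ.smooth.continuous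

theorem preimage_range_subset (hφ : IsTubularNeighbourhood E' i ν D φ) :
    π ⁻¹' range i ⊆ π ⁻¹' (φ '' D) :=
  preimage_mono hφ.range_subset

/-- Choose a generator w of the line; the vector on the line is then t w. Points over the tube can
thus be handled through the submersion (w, t) ↦ (ℂ w, t w). -/
theorem exists_eq_taut (hπ : IsBlowUp E E' i D φ j π) {b : B} (hb : b ∈ π ⁻¹' (φ '' D)) :
    ∃ (w : TotalSpace F N) (t : ℂ), w.2 ≠ 0 ∧ (⟨w.proj, t • w.2⟩ : TotalSpace F N) ∈ D ∧
      b = j (tautologicalMap (w, t)) := by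
  obtain ⟨⟨z, l, v⟩, ⟨h1, h2, h3⟩, rfl⟩ := hπ.bijOn_taut.surjOn hb
  simp only at h1 h2 h3
  obtain ⟨⟨w, hwl⟩, hw0, hw⟩ := finrank_eq_one_iff'.1 h1
  have hw0' : w ≠ 0 := fun h => hw0 (Subtype.ext h)
  obtain ⟨t, ht⟩ := hw ⟨v, h2⟩
  have ht' : t • w = v := congrArg Subtype.val ht
  refine ⟨⟨z, w⟩, t, hw0', by simpa [ht'] using h3, ?_⟩
  congr 1
  simp only [tautologicalMap, ht']
  congr 1
  refine le_antisymm (fun x hx => ?_) ((Submodule.span_singleton_le_iff_mem w l).2 hwl)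
  obtain ⟨c, hc⟩ := hw ⟨x, hx⟩
  exact Submodule.mem_span_singleton.2 ⟨c, congrArg Subtype.val hc⟩

theorem map_tautologicalMap (hπ : IsBlowUp E E' i D φ j π) {w : TotalSpace F N} {t : ℂ}
    (hw : w.2 ≠ 0) (ht : (⟨w.proj, t • w.2⟩ : TotalSpace F N) ∈ D) :
    π (j (tautologicalMap (w, t))) = φ ⟨w.proj, t • w.2⟩ :=
  hπ.map_taut _ (tautologicalMap_mem hw ht)

theorem continuousAt_taut (hπ : IsBlowUp E E' i D φ j π) {w : TotalSpace F N} {t : ℂ}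
    (hw : w.2 ≠ 0) (ht : (⟨w.proj, t • w.2⟩ : TotalSpace F N) ∈ D) :
    ContinuousAt (fun q : TotalSpace F N × ℂ => j (tautologicalMap q)) (w, t) :=
  (hπ.submersion (w, t) hw ht).1.continuousAt

theorem zero_smul_mem (hφ : IsTubularNeighbourhood E' i ν D φ) (w : TotalSpace F N) :
    (⟨w.proj, (0 : ℂ) • w.2⟩ : TotalSpace F N) ∈ D := by
  rw [zero_smul]; exact hφ.zero_mem _

variable [Nonempty (TotalSpace F N)]

theorem normalLift_mem {b : B} (hb : b ∈ π ⁻¹' (φ '' D)) : normalLift D φ π b ∈ D :=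
  Function.invFunOn_mem hb

theorem apply_normalLift {b : B} (hb : b ∈ π ⁻¹' (φ '' D)) : φ (normalLift D φ π b) = π b :=
  Function.invFunOn_eq hb

theorem normalLift_taut (hφ : IsTubularNeighbourhood E' i ν D φ) (hπ : IsBlowUp E E' i D φ j π)
    {w : TotalSpace F N} {t : ℂ} (hw : w.2 ≠ 0)
    (ht : (⟨w.proj, t • w.2⟩ : TotalSpace F N) ∈ D) :
    normalLift D φ π (j (tautologicalMap (w, t))) = ⟨w.proj, t • w.2⟩ := by
  rw [normalLift, hπ.map_tautologicalMap hw ht, hφ.invFunOn_apply ht]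

theorem contMDiffAt_normalLift (hφ : IsTubularNeighbourhood E' i ν D φ)
    (hπ : IsBlowUp E E' i D φ j π) {b : B} (hb : b ∈ π ⁻¹' (φ '' D)) :
    ContMDiffAt 𝓘(ℝ, E) (𝓘(ℝ, E').prod 𝓘(ℝ, F)) ∞ (normalLift D φ π) b := by
  have h := hφ.contMDiffAt_invFunOn (normalLift_mem hb)
  rw [apply_normalLift hb] at h
  exact h.comp b hπ.smooth.contMDiffAt

theorem mem_exceptional_iff (hφ : IsTubularNeighbourhood E' i ν D φ) {b : B}
    (hb : b ∈ π ⁻¹' (φ '' D)) : π b ∈ range i ↔ (normalLift D φ π b).2 = 0 := by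
  rw [← apply_normalLift hb, hφ.apply_mem_range_iff (normalLift_mem hb)]

theorem exists_eq_taut_zero (hφ : IsTubularNeighbourhood E' i ν D φ)
    (hπ : IsBlowUp E E' i D φ j π) {b : B} (hb : π b ∈ range i) :
    ∃ w : TotalSpace F N, w.2 ≠ 0 ∧ b = j (tautologicalMap (w, 0)) := by
  have hbO : b ∈ π ⁻¹' (φ '' D) := preimage_range_subset hφ hb
  obtain ⟨w, t, hw, ht, rfl⟩ := hπ.exists_eq_taut hbO
  have h1 := (mem_exceptional_iff hφ hbO).1 hb
  rw [normalLift_taut hφ hπ hw ht] at h1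
  have h2 : t = 0 := (smul_eq_zero.1 h1).resolve_right hw
  subst h2
  exact ⟨w, hw, rfl⟩

/-- The point (ℂ w, 0) is the limit of (ℂ w, t w) as t ≠ 0 tends to 0. This density lets identities
between smooth forms pass from the complement to the divisor. -/
theorem exceptional_subset_closure (hφ : IsTubularNeighbourhood E' i ν D φ)
    (hπ : IsBlowUp E E' i D φ j π) {b : B} (hb : π b ∈ range i) :
    b ∈ closure (π ⁻¹' range i)ᶜ := by
  obtain ⟨w, hw, rfl⟩ := exists_eq_taut_zero hφ hπ hb
  have h0 := zero_smul_mem hφ w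
  have hc : ContinuousAt (fun t : ℂ => j (tautologicalMap (w, t))) 0 :=
    (hπ.continuousAt_taut hw h0).comp (f := fun t : ℂ => (w, t))
      (continuousAt_const.prodMk continuousAt_id)
  have hO : ∀ᶠ t in 𝓝 (0 : ℂ), j (tautologicalMap (w, t)) ∈ π ⁻¹' (φ '' D) :=
    hc.eventually ((isOpen_preimage hφ hπ).mem_nhds (preimage_range_subset (π := π) hφ hb))
  have hD : ∀ᶠ t in 𝓝 (0 : ℂ), (⟨w.proj, t • w.2⟩ : TotalSpace F N) ∈ D :=
    (contMDiff_smul_fibre (E' := E') w.proj w.2).continuous.continuousAt.eventually (hφ.isOpen.mem_nhds h0)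
  refine mem_closure_of_tendsto (hc.tendsto.mono_left (nhdsWithin_le_nhds (s := {0}ᶜ))) ?_
  filter_upwards [nhdsWithin_le_nhds hO, nhdsWithin_le_nhds hD, self_mem_nhdsWithin] with t h1 h2 h3
  intro h4
  have h5 := (mem_exceptional_iff hφ h1).1 h4
  rw [normalLift_taut hφ hπ hw h2] at h5
  exact h3 ((smul_eq_zero.1 h5).resolve_right hw)

/-- The exceptional divisor is compact. -/
theorem isCompact_exceptional [T2Space Z] [CompactSpace Z] [FiniteDimensional ℝ F]
    (hφ : IsTubularNeighbourhood E' i ν D φ) (hπ : IsBlowUp E E' i D φ j π) :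
    IsCompact (π ⁻¹' range i) := by
  let q : TotalSpace F N × ℂ → B := fun p => j (tautologicalMap p)
  have hloc : ∀ z₀ : Z, ∃ C ∈ 𝓝 z₀, ∃ K ⊆ π ⁻¹' range i, IsCompact K ∧
      ∀ w : TotalSpace F N, w.proj ∈ C → w.2 ≠ 0 → q (w, 0) ∈ K := by
    intro z₀
    let e := trivializationAt F N z₀
    obtain ⟨C, hC, hCc, hCe⟩ := exists_mem_nhds_isClosed_subset
      (e.open_baseSet.mem_nhds (FiberBundle.mem_baseSet_trivializationAt' z₀))
    -- Every line over C has a generator on the unit sphere of the trivialization, so the part of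
    -- the divisor over C is covered by the image of the compact set C × sphere.
    let g : Z × F → B := fun x => q (e.toOpenPartialHomeomorph.symm x, 0)
    have hsrc : ∀ x ∈ C ×ˢ Metric.sphere (0 : F) 1, x ∈ e.target := fun x hx =>
      e.mem_target.2 (hCe hx.1)
    have hne : ∀ x ∈ C ×ˢ Metric.sphere (0 : F) 1, (e.toOpenPartialHomeomorph.symm x).2 ≠ 0 := by
      intro x hx h0
      have h1 := e.apply_symm_apply (hsrc x hx)
      have h2 : e.toOpenPartialHomeomorph.symm x = ⟨(e.toOpenPartialHomeomorph.symm x).proj, 0⟩ :=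
        TotalSpace.ext rfl (heq_of_eq h0)
      have h3 : (e.toOpenPartialHomeomorph.symm x).proj ∈ e.baseSet := by
        rw [e.proj_symm_apply (hsrc x hx)]; exact hCe hx.1
      rw [h2] at h1
      have h1' := (e.zeroSection ℝ h3).symm.trans h1
      have h4 : x.2 = 0 := by rw [← h1']
      have h5 := hx.2
      rw [h4] at h5
      simp at h5
    refine ⟨C, hC, g '' (C ×ˢ Metric.sphere (0 : F) 1), ?_, ?_, ?_⟩
    · rintro _ ⟨x, hx, rfl⟩
      have h0 := zero_smul_mem hφ (e.toOpenPartialHomeomorph.symm x)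
      change π (j (tautologicalMap (_, 0))) ∈ range i
      rw [hπ.map_tautologicalMap (hne x hx) h0, hφ.apply_mem_range_iff h0]
      exact zero_smul _ _
    · refine (hCc.isCompact.prod (isCompact_sphere 0 1)).image_of_continuousOn fun x hx => ?_
      refine ContinuousAt.continuousWithinAt ?_
      have h0 := zero_smul_mem hφ (e.toOpenPartialHomeomorph.symm x)
      refine (hπ.continuousAt_taut (hne x hx) h0).comp
        (f := fun x => (e.toOpenPartialHomeomorph.symm x, (0 : ℂ))) ?_
      exact (e.toOpenPartialHomeomorph.continuousAt_symm (hsrc x hx)).prodMk continuousAt_const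
    · rintro ⟨z, w⟩ hz hw
      simp only at hz hw
      have hzb : z ∈ e.baseSet := hCe hz
      set y := e.linearMapAt ℝ z w with hy
      have hy0 : y ≠ 0 := by
        intro h
        apply hw
        rw [← e.symmₗ_linearMapAt (R := ℝ) hzb w, ← hy, h, map_zero]
      have hyn : ‖y‖ ≠ 0 := norm_ne_zero_iff.2 hy0
      refine ⟨(z, ‖y‖⁻¹ • y), ⟨hz, by simp [norm_smul, hyn]⟩, ?_⟩
      have h1 : e.toOpenPartialHomeomorph.symm (z, ‖y‖⁻¹ • y) =
          (⟨z, ((‖y‖⁻¹ : ℝ) : ℂ) • w⟩ : TotalSpace F N) := by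
        rw [← e.mk_symm hzb, ← e.coe_symmₗ (R := ℝ) hzb, map_smul, hy,
          e.symmₗ_linearMapAt (R := ℝ) hzb, Complex.coe_smul]
      simp only [g, h1, q]
      rw [tautologicalMap_smul _ _ (by exact_mod_cast inv_ne_zero hyn), zero_mul]
  choose C hC K hKE hKc hK using hloc
  obtain ⟨s, -, hs⟩ := isCompact_univ.elim_nhds_subcover C fun z _ => hC z
  have h : π ⁻¹' range i = ⋃ z ∈ s, K z := by
    refine Subset.antisymm (fun b hb => ?_) (iUnion₂_subset fun z _ => hKE z)
    obtain ⟨w, hw, rfl⟩ := exists_eq_taut_zero hφ hπ hb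
    obtain ⟨z, hz, hwz⟩ := mem_iUnion₂.1 (hs (mem_univ w.proj))
    exact mem_iUnion₂.2 ⟨z, hz, hK z w hwz hw⟩
  rw [h]
  exact s.isCompact_biUnion fun z _ => hKc z

end IsBlowUp

end Setup

/-- Every subspace of a finite-dimensional complex inner product space is the range of a linear
isometry. -/
theorem exists_linearIsometry_range_eq {H : Type*} [NormedAddCommGroup H] [InnerProductSpace ℂ H]
    [FiniteDimensional ℂ H] (S : Submodule ℂ H) :
    ∃ (Y : Type) (_ : NormedAddCommGroup Y) (_ : InnerProductSpace ℂ Y)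
      (_ : FiniteDimensional ℂ Y) (ι : Y →ₗᵢ[ℂ] H), LinearMap.range ι.toLinearMap = S := by
  let e := (stdOrthonormalBasis ℂ S).repr
  refine ⟨EuclideanSpace ℂ (Fin (Module.finrank ℂ S)), inferInstance, inferInstance, inferInstance,
    S.subtypeₗᵢ.comp e.symm.toLinearIsometry, ?_⟩
  ext x
  constructor
  · rintro ⟨y, rfl⟩
    exact (e.symm y).2
  · intro hx
    exact ⟨e ⟨x, hx⟩, by simp⟩

/-! ### Derivatives of maps with a one-sided local inverse. -/

section MFDeriv

variable {E₁ H₁ M₁ E₂ H₂ M₂ : Type*} [NormedAddCommGroup E₁] [NormedSpace ℝ E₁]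
  [TopologicalSpace H₁] {I₁ : ModelWithCorners ℝ E₁ H₁} [TopologicalSpace M₁] [ChartedSpace H₁ M₁]
  [NormedAddCommGroup E₂] [NormedSpace ℝ E₂] [TopologicalSpace H₂] {I₂ : ModelWithCorners ℝ E₂ H₂}
  [TopologicalSpace M₂] [ChartedSpace H₂ M₂] {f : M₁ → M₂} {g : M₂ → M₁} {x : M₁}

theorem injective_mfderiv_of_leftInverse (hf : MDifferentiableAt I₁ I₂ f x)
    (hg : MDifferentiableAt I₂ I₁ g (f x)) (h : g ∘ f =ᶠ[𝓝 x] id) :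
    Function.Injective (mfderiv I₁ I₂ f x) := by
  have e := (mfderiv_comp x hg hf).symm.trans ((h.mfderiv_eq).trans mfderiv_id)
  refine Function.LeftInverse.injective (g := mfderiv I₂ I₁ g (f x)) fun v => ?_
  exact DFunLike.congr_fun e v

theorem surjective_mfderiv_of_rightInverse {y : M₂} (hx : g y = x)
    (hf : MDifferentiableAt I₁ I₂ f x) (hg : MDifferentiableAt I₂ I₁ g y)
    (h : f ∘ g =ᶠ[𝓝 y] id) : Function.Surjective (mfderiv I₁ I₂ f x) := by
  subst hx
  have e := (mfderiv_comp y hf hg).symm.trans ((h.mfderiv_eq).trans mfderiv_id)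
  intro v
  exact ⟨mfderiv I₂ I₁ g y (show E₂ from v), DFunLike.congr_fun e (show E₂ from v)⟩

end MFDeriv

/-! ### Coordinates on the blow-up near the exceptional divisor. -/

section Setup

variable {E : Type*} [NormedAddCommGroup E] [NormedSpace ℝ E]
  {M : Type*} [TopologicalSpace M] [ChartedSpace E M] [IsManifold 𝓘(ℝ, E) ∞ M]
  {E' : Type*} [NormedAddCommGroup E'] [NormedSpace ℝ E']
  {Z : Type*} [TopologicalSpace Z] [ChartedSpace E' Z] [IsManifold 𝓘(ℝ, E') ∞ Z]
  {F : Type*} [NormedAddCommGroup F] [NormedSpace ℝ F]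
  {N : Z → Type*} [∀ z, AddCommGroup (N z)] [∀ z, Module ℂ (N z)]
  [∀ z, TopologicalSpace (N z)] [TopologicalSpace (TotalSpace F N)]
  [FiberBundle F N] [VectorBundle ℝ F N] [ContMDiffVectorBundle ∞ F N 𝓘(ℝ, E')]
  {B : Type*} [TopologicalSpace B] [ChartedSpace E B] [IsManifold 𝓘(ℝ, E) ∞ B]
  {i : Z → M} {ν : ∀ z, N z →ₗ[ℝ] TangentSpace 𝓘(ℝ, E) (i z)}
  {D : Set (TotalSpace F N)} {φ : TotalSpace F N → M}
  {j : SubspaceVector N → B} {π : B → M}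
  {H Y K : Type*} [NormedAddCommGroup H] [InnerProductSpace ℂ H]
  [NormedAddCommGroup Y] [InnerProductSpace ℂ Y] [NormedAddCommGroup K] [InnerProductSpace ℂ K]
  {c : ∀ z, N z →ₗ[ℂ] H} {z₀ : Z} {P : H →L[ℂ] Y} {ι : Y →ₗᵢ[ℂ] H} {γ : E' × Y → TotalSpace F N}
  {U : Set E'}

/-- The rank of the normal bundle is finite. -/
theorem IsNormalBundle.finiteDimensional [FiniteDimensional ℝ E] {Ω : DiffForm E M 2}
    (hν : IsNormalBundle E' F Ω i ν) (hZ : Nonempty Z) : FiniteDimensional ℝ F := by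
  obtain ⟨z⟩ := hZ
  have hz := FiberBundle.mem_baseSet_trivializationAt' (F := F) (E := N) z
  let e := (trivializationAt F N z).linearEquivAt ℝ z hz
  let ν' : N z →ₗ[ℝ] E := ν z
  have h : Function.Injective (ν'.comp e.symm.toLinearMap) := (hν.injective z).comp e.symm.injective
  exact FiniteDimensional.of_injective _ h

namespace IsComplexTrivialization

/-- Both sides lie in the same fibre and have the same coordinate P ∘ c, which is injective there.
Since P ∘ c is complex linear, complex homogeneity of γ follows. -/
theorem apply_coord (h : IsComplexTrivialization c z₀ P ι γ U) {x : E'} (hx : x ∈ U)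
    (v : TotalSpace F N) (hv : v.proj = (extChartAt 𝓘(ℝ, E') z₀).symm x) :
    γ (x, P (c _ v.2)) = v := by
  have h1 := h.proj x hx (P (c _ v.2))
  have h2 := h.coord x hx (P (c _ v.2))
  have h3 := h.injective x hx
  generalize (γ (x, P (c _ v.2))) = u at h1 h2
  obtain ⟨z, u⟩ := u
  obtain ⟨z', v⟩ := v
  simp only at h1 h2 hv
  subst h1 hv
  rw [h3 h2]

theorem apply_smul (h : IsComplexTrivialization c z₀ P ι γ U) {x : E'} (hx : x ∈ U) (t : ℂ)
    (y : Y) : γ (x, t • y) = ⟨(γ (x, y)).proj, t • (γ (x, y)).2⟩ := by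
  refine Eq.trans ?_ (h.apply_coord hx ⟨(γ (x, y)).proj, t • (γ (x, y)).2⟩ (h.proj x hx y))
  rw [map_smul, map_smul, h.coord x hx]

theorem apply_zero (h : IsComplexTrivialization c z₀ P ι γ U) {x : E'} (hx : x ∈ U) :
    γ (x, 0) = ⟨(extChartAt 𝓘(ℝ, E') z₀).symm x, 0⟩ := by
  refine Eq.trans ?_ (h.apply_coord hx ⟨(extChartAt 𝓘(ℝ, E') z₀).symm x, 0⟩ rfl)
  rw [map_zero, map_zero]

theorem apply_center_zero (h : IsComplexTrivialization c z₀ P ι γ U) :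
    γ (extChartAt 𝓘(ℝ, E') z₀ z₀, 0) = ⟨z₀, 0⟩ := by
  rw [h.apply_zero h.mem, extChartAt_to_inv]

theorem snd_ne_zero (h : IsComplexTrivialization c z₀ P ι γ U) {x : E'} (hx : x ∈ U) {y : Y}
    (hy : y ≠ 0) : (γ (x, y)).2 ≠ 0 := by
  intro h0
  have := h.coord x hx y
  rw [h0, map_zero, map_zero] at this
  exact hy this.symm

/-- The inverse of a complex trivialization. -/
theorem contMDiffAt_inverse (hcs : ContMDiff (𝓘(ℝ, E').prod 𝓘(ℝ, F)) 𝓘(ℝ, H) ∞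
    fun p : TotalSpace F N => c p.proj p.2) (P : H →L[ℂ] Y) {v : TotalSpace F N}
    (hv : v.proj ∈ (extChartAt 𝓘(ℝ, E') z₀).source) :
    ContMDiffAt (𝓘(ℝ, E').prod 𝓘(ℝ, F)) 𝓘(ℝ, E' × Y) ∞
      (fun v : TotalSpace F N => (extChartAt 𝓘(ℝ, E') z₀ v.proj, P (c _ v.2))) v := by
  refine ContMDiffAt.prodMk_space ?_ ?_
  · rw [extChartAt_source] at hv
    exact (contMDiffAt_extChartAt' hv).comp v (Bundle.contMDiffAt_proj N)
  · exact ((P.restrictScalars ℝ).contDiff.contDiffAt.contMDiffAt).comp v (hcs v)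

/-- The chart of Z at the base point, together with P ∘ c, is a smooth two-sided local inverse. -/
theorem mfderiv_bijective (h : IsComplexTrivialization c z₀ P ι γ U)
    (hcs : ContMDiff (𝓘(ℝ, E').prod 𝓘(ℝ, F)) 𝓘(ℝ, H) ∞ fun p : TotalSpace F N => c p.proj p.2)
    {x : E'} (hx : x ∈ U) (y : Y) :
    Function.Bijective (mfderiv 𝓘(ℝ, E' × Y) (𝓘(ℝ, E').prod 𝓘(ℝ, F)) γ (x, y)) := by
  let Ψ : TotalSpace F N → E' × Y := fun v => (extChartAt 𝓘(ℝ, E') z₀ v.proj, P (c _ v.2))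
  have hΨγ : ∀ x ∈ U, ∀ y, Ψ (γ (x, y)) = (x, y) := by
    intro x hx y
    simp only [Ψ]
    rw [h.coord x hx y, h.proj x hx y, PartialEquiv.right_inv _ (h.subset hx)]
  have hsrc : (γ (x, y)).proj ∈ (extChartAt 𝓘(ℝ, E') z₀).source := by
    rw [h.proj x hx y]; exact PartialEquiv.map_target _ (h.subset hx)
  have hΨ : ContMDiffAt (𝓘(ℝ, E').prod 𝓘(ℝ, F)) 𝓘(ℝ, E' × Y) ∞ Ψ (γ (x, y)) :=
    contMDiffAt_inverse hcs P hsrc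
  have hγ := h.smooth x hx y
  have h1 : Ψ ∘ γ =ᶠ[𝓝 (x, y)] id := by
    filter_upwards [(h.isOpen.prod isOpen_univ).mem_nhds (mk_mem_prod hx (mem_univ y))] with p hp
    exact hΨγ _ hp.1 _
  have h2 : γ ∘ Ψ =ᶠ[𝓝 (γ (x, y))] id := by
    have hc : ContinuousAt (fun v : TotalSpace F N => (Ψ v).1) (γ (x, y)) :=
      continuous_fst.continuousAt.comp hΨ.continuousAt
    have hU : U ∈ 𝓝 (Ψ (γ (x, y))).1 := by rw [hΨγ x hx y]; exact h.isOpen.mem_nhds hx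
    have hp : ContinuousAt (fun v : TotalSpace F N => v.proj) (γ (x, y)) :=
      (FiberBundle.continuous_proj F N).continuousAt
    filter_upwards [hc.eventually hU,
      hp.eventually ((isOpen_extChartAt_source z₀).mem_nhds hsrc)] with v hv1 hv2
    exact h.apply_coord hv1 v (PartialEquiv.left_inv _ hv2).symm
  exact ⟨injective_mfderiv_of_leftInverse (hγ.mdifferentiableAt (by simp))
      (hΨ.mdifferentiableAt (by simp)) h1,
    surjective_mfderiv_of_rightInverse (hΨγ x hx y) (hγ.mdifferentiableAt (by simp))
      (hΨ.mdifferentiableAt (by simp)) h2⟩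

/-- The coordinate expression of `c`. -/
theorem contDiffAt_coord (h : IsComplexTrivialization c z₀ P ι γ U)
    (hcs : ContMDiff (𝓘(ℝ, E').prod 𝓘(ℝ, F)) 𝓘(ℝ, H) ∞ fun p : TotalSpace F N => c p.proj p.2)
    {x : E'} (hx : x ∈ U) (y : Y) :
    ContDiffAt ℝ ∞ (fun p : E' × Y => c _ (γ p).2) (x, y) :=
  ((hcs _).comp (x, y) (h.smooth x hx y)).contDiffAt

end IsComplexTrivialization

/-- Coordinates on the blow-up near the exceptional divisor: over the point of `Z` with
coordinate `x`, the line spanned by `y₀ + ζ` and the vector `t (y₀ + ζ)` on it. -/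
def blowUpChart (j : SubspaceVector N → B) (γ : E' × Y → TotalSpace F N) (κ : K →L[ℂ] Y) (y₀ : Y)
    (p : E' × K × ℂ) : B :=
  j (tautologicalMap (γ (p.1, y₀ + κ p.2.1), p.2.2))

section Chart

variable {κ : K →L[ℂ] Y} {y₀ : Y}

theorem contMDiffAt_blowUpChart (hπ : IsBlowUp E E' i D φ j π)
    (h : IsComplexTrivialization c z₀ P ι γ U) {p : E' × K × ℂ} (hpU : p.1 ∈ U)
    (hp0 : y₀ + κ p.2.1 ≠ 0) (hpD : γ (blowDown κ y₀ p) ∈ D) :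
    ContMDiffAt 𝓘(ℝ, E' × K × ℂ) 𝓘(ℝ, E) ∞ (blowUpChart j γ κ y₀) p := by
  have h1 : (⟨(γ (p.1, y₀ + κ p.2.1)).proj, p.2.2 • (γ (p.1, y₀ + κ p.2.1)).2⟩ : TotalSpace F N)
      ∈ D := by rwa [← h.apply_smul hpU]
  have h2 := (hπ.submersion (γ (p.1, y₀ + κ p.2.1), p.2.2) (h.snd_ne_zero hpU hp0) h1).1
  refine h2.comp p (f := fun p : E' × K × ℂ => (γ (p.1, y₀ + κ p.2.1), p.2.2)) ?_
  refine ContMDiffAt.prodMk ?_ ?_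
  · refine (h.smooth _ hpU _).comp p (f := fun p : E' × K × ℂ => (p.1, y₀ + κ p.2.1)) ?_
    refine ContDiffAt.contMDiffAt ?_
    refine contDiffAt_fst.prodMk (contDiffAt_const.add ?_)
    exact ((κ.restrictScalars ℝ).contDiff.comp (contDiff_fst.comp contDiff_snd)).contDiffAt
  · exact (contDiff_snd.comp contDiff_snd).contDiffAt.contMDiffAt

theorem map_blowUpChart (hπ : IsBlowUp E E' i D φ j π)
    (h : IsComplexTrivialization c z₀ P ι γ U) {p : E' × K × ℂ} (hpU : p.1 ∈ U)
    (hp0 : y₀ + κ p.2.1 ≠ 0) (hpD : γ (blowDown κ y₀ p) ∈ D) :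
    π (blowUpChart j γ κ y₀ p) = φ (γ (blowDown κ y₀ p)) := by
  have h1 := h.apply_smul hpU p.2.2 (y₀ + κ p.2.1)
  rw [blowUpChart, hπ.map_tautologicalMap (h.snd_ne_zero hpU hp0) (by rw [← h1]; exact hpD), ← h1]
  rfl

theorem normalLift_blowUpChart [Nonempty (TotalSpace F N)]
    (hφ : IsTubularNeighbourhood E' i ν D φ) (hπ : IsBlowUp E E' i D φ j π)
    (h : IsComplexTrivialization c z₀ P ι γ U) {p : E' × K × ℂ} (hpU : p.1 ∈ U)
    (hp0 : y₀ + κ p.2.1 ≠ 0) (hpD : γ (blowDown κ y₀ p) ∈ D) :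
    normalLift D φ π (blowUpChart j γ κ y₀ p) = γ (blowDown κ y₀ p) := by
  rw [normalLift, map_blowUpChart hπ h hpU hp0 hpD, hφ.invFunOn_apply hpD]

/-- Collects the conditions under which `blowUpChart` is smooth and π becomes `blowDown` followed by
φ ∘ γ. -/
theorem eventually_good (hφ : IsTubularNeighbourhood E' i ν D φ)
    (h : IsComplexTrivialization c z₀ P ι γ U) (hy₀ : y₀ ≠ 0) :
    ∀ᶠ p in 𝓝 ((extChartAt 𝓘(ℝ, E') z₀ z₀, 0, 0) : E' × K × ℂ),
      p.1 ∈ U ∧ y₀ + κ p.2.1 ≠ 0 ∧ γ (blowDown κ y₀ p) ∈ D := by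
  have h1 : ∀ᶠ p in 𝓝 ((extChartAt 𝓘(ℝ, E') z₀ z₀, 0, 0) : E' × K × ℂ), p.1 ∈ U :=
    continuous_fst.continuousAt.eventually (h.isOpen.mem_nhds h.mem)
  have h2 : ∀ᶠ p in 𝓝 ((extChartAt 𝓘(ℝ, E') z₀ z₀, 0, 0) : E' × K × ℂ), y₀ + κ p.2.1 ≠ 0 := by
    have : Continuous fun p : E' × K × ℂ => y₀ + κ p.2.1 := by fun_prop
    refine this.continuousAt.eventually (isOpen_ne.mem_nhds ?_)
    simpa using hy₀
  refine h1.and (h2.and ?_)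
  have e : blowDown κ y₀ (extChartAt 𝓘(ℝ, E') z₀ z₀, 0, 0) = (extChartAt 𝓘(ℝ, E') z₀ z₀, 0) := by
    simp [blowDown]
  have h3 : ContinuousAt (fun p => γ (blowDown κ y₀ p))
      ((extChartAt 𝓘(ℝ, E') z₀ z₀, 0, 0) : E' × K × ℂ) := by
    refine ContinuousAt.comp (g := γ) ?_ (contDiff_blowDown κ y₀).continuous.continuousAt
    rw [e]
    exact (h.smooth _ h.mem 0).continuousAt
  refine h3.eventually (hφ.isOpen.mem_nhds ?_)
  change γ (blowDown κ y₀ _) ∈ D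
  rw [e, h.apply_center_zero]
  exact hφ.zero_mem z₀

/-- The derivative of the tautological map in a complex trivialization is onto, and vanishes on
the radial directions. -/
theorem surjective_mfderiv_blowUpChart (hφ : IsTubularNeighbourhood E' i ν D φ)
    (hπ : IsBlowUp E E' i D φ j π) (h : IsComplexTrivialization c z₀ P ι γ U)
    (hcs : ContMDiff (𝓘(ℝ, E').prod 𝓘(ℝ, F)) 𝓘(ℝ, H) ∞ fun p : TotalSpace F N => c p.proj p.2)
    (hy₀ : y₀ ≠ 0) (hκ : ∀ y, ∃ (a : ℂ) (ζ : K), y = a • y₀ + κ ζ) :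
    Function.Surjective (mfderiv 𝓘(ℝ, E' × K × ℂ) 𝓘(ℝ, E) (blowUpChart j γ κ y₀)
      (extChartAt 𝓘(ℝ, E') z₀ z₀, 0, 0)) := by
  set x₀ := extChartAt 𝓘(ℝ, E') z₀ z₀ with hx₀
  -- G expresses the quotient map q in the trivialization. It has the local right inverse R, so q ∘
  -- G is still a submersion at the centre.
  let G : E' × Y × ℂ → TotalSpace F N × ℂ := fun p => (γ (p.1, p.2.1), p.2.2)
  let R : TotalSpace F N × ℂ → E' × Y × ℂ := fun q =>
    (extChartAt 𝓘(ℝ, E') z₀ q.1.proj, P (c _ q.1.2), q.2)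
  let q : TotalSpace F N × ℂ → B := fun q => j (tautologicalMap q)
  let ℓ : E' × K × ℂ → E' × Y × ℂ := fun p => (p.1, y₀ + κ p.2.1, p.2.2)
  have hD : ∀ y, (⟨(γ (x₀, y)).proj, (0 : ℂ) • (γ (x₀, y)).2⟩ : TotalSpace F N) ∈ D :=
    fun y => IsBlowUp.zero_smul_mem hφ _
  obtain ⟨hq, hqs⟩ := hπ.submersion (γ (x₀, y₀), 0) (h.snd_ne_zero h.mem hy₀) (hD y₀)
  have hp₀ : (γ (x₀, y₀)).proj = z₀ := by rw [h.proj x₀ h.mem, hx₀, extChartAt_to_inv]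
  have hsrc : (γ (x₀, y₀)).proj ∈ (extChartAt 𝓘(ℝ, E') z₀).source := by
    rw [hp₀]; exact mem_extChartAt_source z₀
  have hG : ContMDiffAt 𝓘(ℝ, E' × Y × ℂ) ((𝓘(ℝ, E').prod 𝓘(ℝ, F)).prod 𝓘(ℝ, ℂ)) ∞ G
      (x₀, y₀, 0) := by
    refine ContMDiffAt.prodMk ?_ ?_
    · refine (h.smooth x₀ h.mem y₀).comp (x₀, y₀, (0 : ℂ))
        (f := fun p : E' × Y × ℂ => (p.1, p.2.1)) ?_
      exact (contDiff_fst.prodMk (contDiff_fst.comp contDiff_snd)).contDiffAt.contMDiffAt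
    · exact (contDiff_snd.comp contDiff_snd).contDiffAt.contMDiffAt
  have hR : ContMDiffAt ((𝓘(ℝ, E').prod 𝓘(ℝ, F)).prod 𝓘(ℝ, ℂ)) 𝓘(ℝ, E' × Y × ℂ) ∞ R
      (γ (x₀, y₀), 0) := by
    have h1 := (IsComplexTrivialization.contMDiffAt_inverse (z₀ := z₀) hcs P hsrc).comp
      (γ (x₀, y₀), (0 : ℂ)) (contMDiffAt_fst (I := 𝓘(ℝ, E').prod 𝓘(ℝ, F)) (J := 𝓘(ℝ, ℂ)))
    have h2 := contMDiffAt_snd (I := 𝓘(ℝ, E').prod 𝓘(ℝ, F)) (J := 𝓘(ℝ, ℂ)) (n := ∞)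
      (p := (γ (x₀, y₀), (0 : ℂ)))
    have h3 : ContDiff ℝ ∞ fun p : (E' × Y) × ℂ => (p.1.1, p.1.2, p.2) := by fun_prop
    exact h3.contMDiff.contMDiffAt.comp (γ (x₀, y₀), (0 : ℂ)) (h1.prodMk_space h2)
  have hRG : R (γ (x₀, y₀), 0) = (x₀, y₀, 0) := by
    simp only [R]
    rw [h.coord x₀ h.mem, hp₀]
  have hGR : G ∘ R =ᶠ[𝓝 (γ (x₀, y₀), 0)] id := by
    have hc : ContinuousAt (fun v => (R v).1) (γ (x₀, y₀), 0) :=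
      continuous_fst.continuousAt.comp hR.continuousAt
    have hU : U ∈ 𝓝 (R (γ (x₀, y₀), 0)).1 := by rw [hRG]; exact h.isOpen.mem_nhds h.mem
    have hp : ContinuousAt (fun v : TotalSpace F N × ℂ => v.1.proj) (γ (x₀, y₀), 0) :=
      ((FiberBundle.continuous_proj F N).comp continuous_fst).continuousAt
    filter_upwards [hc.eventually hU,
      hp.eventually ((isOpen_extChartAt_source z₀).mem_nhds hsrc)] with v hv1 hv2
    exact Prod.ext (h.apply_coord hv1 v.1 (PartialEquiv.left_inv _ hv2).symm) rfl
  have hGs := surjective_mfderiv_of_rightInverse hRG (hG.mdifferentiableAt (by simp))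
    (hR.mdifferentiableAt (by simp)) hGR
  have hqG : MDifferentiableAt 𝓘(ℝ, E' × Y × ℂ) 𝓘(ℝ, E) (q ∘ G) (x₀, y₀, 0) :=
    (hq.comp (x₀, y₀, (0 : ℂ)) hG).mdifferentiableAt (by simp)
  have e1 : ∀ v, mfderiv 𝓘(ℝ, E' × Y × ℂ) 𝓘(ℝ, E) (q ∘ G) (x₀, y₀, 0) v =
      mfderiv ((𝓘(ℝ, E').prod 𝓘(ℝ, F)).prod 𝓘(ℝ, ℂ)) 𝓘(ℝ, E) q (γ (x₀, y₀), 0)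
        (mfderiv 𝓘(ℝ, E' × Y × ℂ) ((𝓘(ℝ, E').prod 𝓘(ℝ, F)).prod 𝓘(ℝ, ℂ)) G (x₀, y₀, 0) v) :=
    fun v => DFunLike.congr_fun (mfderiv_comp (x₀, y₀, (0 : ℂ)) (hq.mdifferentiableAt (by simp))
      (hG.mdifferentiableAt (by simp))) v
  have hsurj : Function.Surjective
      (mfderiv 𝓘(ℝ, E' × Y × ℂ) 𝓘(ℝ, E) (q ∘ G) (x₀, y₀, 0)) := by
    intro v
    obtain ⟨u, hu⟩ := hqs v
    obtain ⟨w, rfl⟩ := hGs u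
    exact ⟨w, (e1 w).trans hu⟩
  -- Moving w along its own complex line does not move (ℂ w, 0). At t = 0 the radial directions are
  -- therefore in the kernel, and the directions κ ζ suffice for surjectivity.
  have hrad : ∀ a : ℂ, mfderiv 𝓘(ℝ, E' × Y × ℂ) 𝓘(ℝ, E) (q ∘ G) (x₀, y₀, 0) (0, a • y₀, 0) = 0 := by
    intro a
    let r : ℝ → E' × Y × ℂ := fun s => (x₀, (1 + s * a) • y₀, 0)
    have hr : HasFDerivAt r (ContinuousLinearMap.toSpanSingleton ℝ ((0, a • y₀, 0) : E' × Y × ℂ))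
        0 := by
      have h1 : HasDerivAt r ((0, a • y₀, 0) : E' × Y × ℂ) 0 := by
        refine (hasDerivAt_const _ _).prodMk (HasDerivAt.prodMk ?_ (hasDerivAt_const _ _))
        have h2 : HasDerivAt (fun s : ℝ => 1 + (s : ℂ) * a) a 0 := by
          simpa using ((Complex.ofRealCLM.hasDerivAt (x := 0)).mul_const a).const_add 1
        simpa using h2.smul_const y₀
      exact h1.hasFDerivAt
    have hr0 : r 0 = (x₀, y₀, 0) := by simp [r]
    have hc : (q ∘ G) ∘ r =ᶠ[𝓝 0] fun _ => (q ∘ G) (x₀, y₀, 0) := by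
      have : ∀ᶠ s : ℝ in 𝓝 0, (1 + (s : ℂ) * a) ≠ 0 := by
        have h3 : Continuous fun s : ℝ => 1 + (s : ℂ) * a := by fun_prop
        exact h3.continuousAt.eventually (isOpen_ne.mem_nhds (by simp))
      filter_upwards [this] with s hs
      simp only [Function.comp, r, q, G]
      rw [h.apply_smul h.mem, tautologicalMap_smul _ _ hs, zero_mul]
    have h4 := hc.mfderiv_eq (I := 𝓘(ℝ, ℝ)) (I' := 𝓘(ℝ, E))
    have hqG' : MDifferentiableAt 𝓘(ℝ, E' × Y × ℂ) 𝓘(ℝ, E) (q ∘ G) (r 0) := by rwa [hr0]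
    have h5 := (mfderiv_comp (0 : ℝ) hqG' hr.differentiableAt.mdifferentiableAt).symm.trans
      (h4.trans mfderiv_const)
    have h6 := DFunLike.congr_fun h5 (1 : ℝ)
    have h7 : mfderiv 𝓘(ℝ, ℝ) 𝓘(ℝ, E' × Y × ℂ) r 0 (1 : ℝ) = (0, a • y₀, 0) := by
      rw [mfderiv_eq_fderiv, hr.fderiv]
      exact one_smul ℝ _
    have h8 : mfderiv 𝓘(ℝ, E' × Y × ℂ) 𝓘(ℝ, E) (q ∘ G) (r 0)
      (mfderiv 𝓘(ℝ, ℝ) 𝓘(ℝ, E' × Y × ℂ) r 0 (1 : ℝ)) = 0 := h6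
    rw [h7] at h8
    rw [hr0] at h8
    exact h8
  have hℓ : HasFDerivAt ℓ ((ContinuousLinearMap.fst ℝ E' (K × ℂ)).prod
      (((κ.restrictScalars ℝ).comp ((ContinuousLinearMap.fst ℝ K ℂ).comp
        (ContinuousLinearMap.snd ℝ E' (K × ℂ)))).prod ((ContinuousLinearMap.snd ℝ K ℂ).comp
        (ContinuousLinearMap.snd ℝ E' (K × ℂ))))) (x₀, 0, 0) := by
    refine hasFDerivAt_fst.prodMk (HasFDerivAt.prodMk ?_ ?_)
    · exact ((κ.restrictScalars ℝ).comp ((ContinuousLinearMap.fst ℝ K ℂ).comp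
        (ContinuousLinearMap.snd ℝ E' (K × ℂ)))).hasFDerivAt.const_add y₀
    · exact ((ContinuousLinearMap.snd ℝ K ℂ).comp
        (ContinuousLinearMap.snd ℝ E' (K × ℂ))).hasFDerivAt
  have hℓ0 : ℓ (x₀, 0, 0) = (x₀, y₀, 0) := by simp [ℓ]
  have hqG' : MDifferentiableAt 𝓘(ℝ, E' × Y × ℂ) 𝓘(ℝ, E) (q ∘ G) (ℓ (x₀, 0, 0)) := by rwa [hℓ0]
  have e2 : ∀ v : E' × K × ℂ, mfderiv 𝓘(ℝ, E' × K × ℂ) 𝓘(ℝ, E) (blowUpChart j γ κ y₀) (x₀, 0, 0) v =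
      mfderiv 𝓘(ℝ, E' × Y × ℂ) 𝓘(ℝ, E) (q ∘ G) (ℓ (x₀, 0, 0)) (v.1, κ v.2.1, v.2.2) := by
    intro v
    refine (DFunLike.congr_fun (mfderiv_comp (x₀, (0 : K), (0 : ℂ)) hqG'
      hℓ.differentiableAt.mdifferentiableAt) v).trans ?_
    change mfderiv 𝓘(ℝ, E' × Y × ℂ) 𝓘(ℝ, E) (q ∘ G) (ℓ (x₀, 0, 0)) (mfderiv _ _ ℓ _ v) = _
    rw [mfderiv_eq_fderiv, hℓ.fderiv]
    rfl
  rw [hℓ0] at e2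
  intro v
  obtain ⟨⟨x, y, t⟩, rfl⟩ := hsurj v
  obtain ⟨a, ζ, rfl⟩ := hκ y
  refine ⟨(x, ζ, t), (e2 _).trans ?_⟩
  have h9 : ((x, a • y₀ + κ ζ, t) : E' × Y × ℂ) = (0, a • y₀, 0) + (x, κ ζ, t) := by simp
  refine Eq.symm ?_
  refine (congrArg (mfderiv 𝓘(ℝ, E' × Y × ℂ) 𝓘(ℝ, E) (q ∘ G) (x₀, y₀, 0)) h9).trans ?_
  refine (map_add (mfderiv 𝓘(ℝ, E' × Y × ℂ) 𝓘(ℝ, E) (q ∘ G) (x₀, y₀, 0)) _ _).trans ?_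
  rw [hrad a]
  exact zero_add _

end Chart

end Setup

/-! ### The inverse function theorem into a manifold. -/

section InverseFunction

variable {E : Type*} [NormedAddCommGroup E] [NormedSpace ℝ E] [FiniteDimensional ℝ E]
  {B : Type*} [TopologicalSpace B] [ChartedSpace E B] [IsManifold 𝓘(ℝ, E) ∞ B]
  {V : Type*} [NormedAddCommGroup V] [NormedSpace ℝ V] [FiniteDimensional ℝ V]

/-- The inverse function theorem for a map from a vector space to a manifold. -/
theorem exists_smooth_local_inverse {q : V → B} {p₀ : V}
    (hq : ∀ᶠ p in 𝓝 p₀, ContMDiffAt 𝓘(ℝ, V) 𝓘(ℝ, E) ∞ q p)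
    (hbij : Function.Bijective (mfderiv 𝓘(ℝ, V) 𝓘(ℝ, E) q p₀)) :
    ∃ σ : B → V, σ (q p₀) = p₀ ∧ (∀ᶠ p in 𝓝 p₀, σ (q p) = p) ∧
      ∀ᶠ b in 𝓝 (q p₀), ContMDiffAt 𝓘(ℝ, E) 𝓘(ℝ, V) ∞ σ b ∧ q (σ b) = b := by
  have : CompleteSpace V := FiniteDimensional.complete ℝ V
  have : CompleteSpace E := FiniteDimensional.complete ℝ E
  let χ := extChartAt 𝓘(ℝ, E) (q p₀)
  let f : V → E := χ ∘ q
  have hqc : ContinuousAt q p₀ := hq.self_of_nhds.continuousAt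
  have hsrc : ∀ᶠ p in 𝓝 p₀, q p ∈ χ.source :=
    hqc.eventually (extChartAt_source_mem_nhds (I := 𝓘(ℝ, E)) (q p₀))
  have hf : ∀ᶠ p in 𝓝 p₀, ContDiffAt ℝ ∞ f p := by
    filter_upwards [hq, hsrc] with p h1 h2
    have h3 : q p ∈ (chartAt E (q p₀)).source := by rwa [← extChartAt_source 𝓘(ℝ, E)]
    exact ((contMDiffAt_extChartAt' h3).comp p h1).contDiffAt
  have hf0 := hf.self_of_nhds
  have hfd : Function.Bijective (fderiv ℝ f p₀) := by
    have h1 := mfderiv_comp (I := 𝓘(ℝ, V)) (I' := 𝓘(ℝ, E)) (I'' := 𝓘(ℝ, E)) p₀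
      ((contMDiffAt_extChartAt (I := 𝓘(ℝ, E)) (n := ∞) (x := q p₀)).mdifferentiableAt (by simp))
      (hq.self_of_nhds.mdifferentiableAt (by simp))
    obtain ⟨e, he⟩ := isInvertible_mfderiv_extChartAt (I := 𝓘(ℝ, E)) (mem_extChartAt_source (q p₀))
    rw [← he] at h1
    have h2 : Function.Bijective fun v => e (mfderiv 𝓘(ℝ, V) 𝓘(ℝ, E) q p₀ v) :=
      e.bijective.comp hbij
    have h3 : ∀ v, fderiv ℝ f p₀ v = e (mfderiv 𝓘(ℝ, V) 𝓘(ℝ, E) q p₀ v) := fun v =>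
      (DFunLike.congr_fun mfderiv_eq_fderiv.symm v).trans (DFunLike.congr_fun h1 v)
    exact (funext h3 : ⇑(fderiv ℝ f p₀) = _) ▸ h2
  let e : V ≃L[ℝ] E := (LinearEquiv.ofBijective (fderiv ℝ f p₀ : V →ₗ[ℝ] E) hfd).toContinuousLinearEquiv
  have he : (e : V →L[ℝ] E) = fderiv ℝ f p₀ := by ext v; rfl
  have hfe : HasFDerivAt f (e : V →L[ℝ] E) p₀ := by
    rw [he]; exact (hf0.differentiableAt (by simp)).hasFDerivAt
  let Φ := hf0.toOpenPartialHomeomorph f hfe (by simp)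
  have hp₀ : p₀ ∈ Φ.source := hf0.mem_toOpenPartialHomeomorph_source hfe (by simp)
  have hΦ : ∀ p, Φ p = f p := fun p => rfl
  -- Invertibility of the derivative is an open condition, so the inverse is smooth at all points
  -- near q p₀ and not only at q p₀.
  have hinv : ∀ᶠ p in 𝓝 p₀, fderiv ℝ f p ∈ range ((↑) : (V ≃L[ℝ] E) → V →L[ℝ] E) :=
    (hf0.fderiv_right (m := ∞) (by simp)).continuousAt.eventually
      (ContinuousLinearEquiv.isOpen.mem_nhds ⟨e, he⟩)
  have hχ : ContinuousAt χ (q p₀) := continuousAt_extChartAt (I := 𝓘(ℝ, E)) (q p₀)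
  have hs0 : Φ.symm (χ (q p₀)) = p₀ := Φ.left_inv hp₀
  refine ⟨Φ.symm ∘ χ, hs0, ?_, ?_⟩
  · filter_upwards [Φ.open_source.mem_nhds hp₀] with p hp
    exact Φ.left_inv hp
  · have hσ : ContinuousAt (Φ.symm ∘ χ) (q p₀) :=
      ContinuousAt.comp (Φ.continuousAt_symm (Φ.map_source hp₀)) hχ
    have hσ' : Tendsto (Φ.symm ∘ χ) (𝓝 (q p₀)) (𝓝 p₀) := by
      have := hσ.tendsto
      rwa [Function.comp_apply, hs0] at this
    filter_upwards [hχ.eventually (Φ.open_target.mem_nhds (Φ.map_source hp₀)),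
      extChartAt_source_mem_nhds (I := 𝓘(ℝ, E)) (q p₀), hσ'.eventually hinv, hσ'.eventually hf,
      hσ'.eventually hsrc] with b h1 h2 h3 h4 h5
    obtain ⟨e', he'⟩ := h3
    have h6 : HasFDerivAt Φ (e' : V →L[ℝ] E) (Φ.symm (χ b)) := by
      rw [he']; exact (h4.differentiableAt (by simp)).hasFDerivAt
    have h7 : b ∈ (chartAt E (q p₀)).source := by rwa [← extChartAt_source 𝓘(ℝ, E)]
    exact ⟨(Φ.contDiffAt_symm h1 h6 h4).contMDiffAt.comp b (contMDiffAt_extChartAt' h7),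
      χ.injOn h5 h2 (Φ.right_inv h1)⟩

end InverseFunction

/-! ### The differential of a pulled back angular form. -/

section AngularPull

variable {H : Type*} [NormedAddCommGroup H] [InnerProductSpace ℂ H] {V : Type*}
  [NormedAddCommGroup V] [NormedSpace ℝ V]

theorem extDeriv_angularForm_pull_apply {C : V → H} {y : V} (hC : ContDiffAt ℝ ∞ C y)
    (hCy : C y ≠ 0) (v : Fin 2 → V) :
    extDeriv ((angularForm H).pull C) y v =
      extDeriv angularMap (C y) fun l => fderiv ℝ C y (v l) := by
  have h0 : (angularForm H).pull C =
      fun z => (angularMap (C z)).compContinuousLinearMap (fderiv ℝ C z) := by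
    funext z
    ext v
    rw [DiffForm.pull_apply, mfderiv_eq_fderiv]
    rfl
  rw [h0, extDeriv_pullback (r := ∞) ((contDiffAt_angularMap hCy).differentiableAt (by simp)) hC
    (by simpa using (WithTop.coe_le_coe.2 le_top : ((2 : ℕ∞) : ℕ∞ω) ≤ ∞))]
  rfl

end AngularPull

/-! ### Dimension count for the coordinates, and taming Ω along Z. -/

section Setup

variable {E : Type*} [NormedAddCommGroup E] [NormedSpace ℝ E]
  {M : Type*} [TopologicalSpace M] [ChartedSpace E M] [IsManifold 𝓘(ℝ, E) ∞ M]
  {E' : Type*} [NormedAddCommGroup E'] [NormedSpace ℝ E']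
  {Z : Type*} [TopologicalSpace Z] [ChartedSpace E' Z] [IsManifold 𝓘(ℝ, E') ∞ Z]
  {F : Type*} [NormedAddCommGroup F] [NormedSpace ℝ F]
  {N : Z → Type*} [∀ z, AddCommGroup (N z)] [∀ z, Module ℂ (N z)]
  [∀ z, TopologicalSpace (N z)] [TopologicalSpace (TotalSpace F N)]
  [FiberBundle F N] [VectorBundle ℝ F N] [ContMDiffVectorBundle ∞ F N 𝓘(ℝ, E')]
  {B : Type*} [TopologicalSpace B] [ChartedSpace E B] [IsManifold 𝓘(ℝ, E) ∞ B]
  {i : Z → M} {ν : ∀ z, N z →ₗ[ℝ] TangentSpace 𝓘(ℝ, E) (i z)}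
  {D : Set (TotalSpace F N)} {φ : TotalSpace F N → M}
  {j : SubspaceVector N → B} {π : B → M}
  {H Y K : Type*} [NormedAddCommGroup H] [InnerProductSpace ℂ H]
  [NormedAddCommGroup Y] [InnerProductSpace ℂ Y] [NormedAddCommGroup K] [InnerProductSpace ℂ K]
  {c : ∀ z, N z →ₗ[ℂ] H} {z₀ : Z} {P : H →L[ℂ] Y} {ι : Y →ₗᵢ[ℂ] H} {γ : E' × Y → TotalSpace F N}
  {U : Set E'}

/-- The tubular neighbourhood map in a complex trivialization. -/
theorem contMDiffAt_tube (hφ : IsTubularNeighbourhood E' i ν D φ)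
    (h : IsComplexTrivialization c z₀ P ι γ U) {p : E' × Y} (hp : p.1 ∈ U) (hD : γ p ∈ D) :
    ContMDiffAt 𝓘(ℝ, E' × Y) 𝓘(ℝ, E) ∞ (φ ∘ γ) p :=
  (hφ.contMDiffAt hD).comp p (h.smooth p.1 hp p.2)

theorem center_mem (hφ : IsTubularNeighbourhood E' i ν D φ)
    (h : IsComplexTrivialization c z₀ P ι γ U) : γ (extChartAt 𝓘(ℝ, E') z₀ z₀, 0) ∈ D := by
  rw [h.apply_center_zero]; exact hφ.zero_mem z₀

theorem bijective_mfderiv_tube (hφ : IsTubularNeighbourhood E' i ν D φ)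
    (h : IsComplexTrivialization c z₀ P ι γ U)
    (hcs : ContMDiff (𝓘(ℝ, E').prod 𝓘(ℝ, F)) 𝓘(ℝ, H) ∞ fun p : TotalSpace F N => c p.proj p.2)
    {p : E' × Y} (hp : p.1 ∈ U) (hD : γ p ∈ D) :
    Function.Bijective (mfderiv 𝓘(ℝ, E' × Y) 𝓘(ℝ, E) (φ ∘ γ) p) := by
  have h1 := mfderiv_comp (I := 𝓘(ℝ, E' × Y)) (I' := 𝓘(ℝ, E').prod 𝓘(ℝ, F)) (I'' := 𝓘(ℝ, E)) p
    ((hφ.contMDiffAt hD).mdifferentiableAt (by simp))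
    ((h.smooth p.1 hp p.2).mdifferentiableAt (by simp))
  rw [h1]
  have hloc := hφ.localDiffeo ⟨_, hD⟩
  have h2 : Function.Bijective (mfderiv (𝓘(ℝ, E').prod 𝓘(ℝ, F)) 𝓘(ℝ, E) φ (γ p)) := by
    have h3 := hloc.mfderivToContinuousLinearEquiv_coe (by simp)
    rw [← h3]
    exact (hloc.mfderivToContinuousLinearEquiv (by simp)).bijective
  exact h2.comp (h.mfderiv_bijective hcs hp p.2)

theorem finrank_eq_of_trivialization (hφ : IsTubularNeighbourhood E' i ν D φ)
    (h : IsComplexTrivialization c z₀ P ι γ U)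
    (hcs : ContMDiff (𝓘(ℝ, E').prod 𝓘(ℝ, F)) 𝓘(ℝ, H) ∞ fun p : TotalSpace F N => c p.proj p.2) :
    Module.finrank ℝ (E' × Y) = Module.finrank ℝ E := by
  let L : E' × Y →L[ℝ] E := mfderiv 𝓘(ℝ, E' × Y) 𝓘(ℝ, E) (φ ∘ γ) (extChartAt 𝓘(ℝ, E') z₀ z₀, 0)
  have hL : Function.Bijective L := bijective_mfderiv_tube hφ h hcs h.mem (center_mem hφ h)
  exact (LinearEquiv.ofBijective (L : E' × Y →ₗ[ℝ] E) hL).finrank_eq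

/-- Surjectivity becomes bijectivity by counting dimensions: κ maps K onto the complement of a
complex line in Y, and φ ∘ γ shows that E has the dimension of E' × Y. -/
theorem bijective_mfderiv_blowUpChart [FiniteDimensional ℝ E] [FiniteDimensional ℝ E']
    [FiniteDimensional ℂ Y] [FiniteDimensional ℂ K] {κ : K →ₗᵢ[ℂ] Y} {y₀ : Y}
    (hφ : IsTubularNeighbourhood E' i ν D φ)
    (hπ : IsBlowUp E E' i D φ j π) (h : IsComplexTrivialization c z₀ P ι γ U)
    (hcs : ContMDiff (𝓘(ℝ, E').prod 𝓘(ℝ, F)) 𝓘(ℝ, H) ∞ fun p : TotalSpace F N => c p.proj p.2)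
    (hy₀ : y₀ ≠ 0) (hκ : LinearMap.range κ.toLinearMap = (Submodule.span ℂ {y₀})ᗮ) :
    Function.Bijective (mfderiv 𝓘(ℝ, E' × K × ℂ) 𝓘(ℝ, E)
      (blowUpChart j γ κ.toContinuousLinearMap y₀) (extChartAt 𝓘(ℝ, E') z₀ z₀, 0, 0)) := by
  have : FiniteDimensional ℝ Y := FiniteDimensional.complexToReal Y
  have : FiniteDimensional ℝ K := FiniteDimensional.complexToReal K
  have hs := surjective_mfderiv_blowUpChart (κ := κ.toContinuousLinearMap) hφ hπ h hcs hy₀ (by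
    intro y
    obtain ⟨a, ha, b, hb, rfl⟩ := (Submodule.span ℂ {y₀}).exists_add_mem_mem_orthogonal y
    obtain ⟨t, rfl⟩ := Submodule.mem_span_singleton.1 ha
    rw [← hκ] at hb
    obtain ⟨ζ, rfl⟩ := hb
    exact ⟨t, ζ, rfl⟩)
  have h1 := finrank_eq_of_trivialization hφ h hcs
  have h2 : Module.finrank ℂ K + 1 = Module.finrank ℂ Y := by
    have h3 := LinearMap.finrank_range_of_inj (f := κ.toLinearMap) κ.injective
    rw [hκ] at h3
    have h4 := Submodule.finrank_add_finrank_orthogonal (Submodule.span ℂ {y₀})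
    rw [finrank_span_singleton hy₀] at h4
    omega
  have h5 : Module.finrank ℝ (E' × K × ℂ) = Module.finrank ℝ E := by
    rw [← h1, Module.finrank_prod, Module.finrank_prod, Module.finrank_prod,
      finrank_real_of_complex K, finrank_real_of_complex Y, finrank_real_of_complex ℂ,
      Module.finrank_self]
    omega
  let L : E' × K × ℂ →L[ℝ] E := mfderiv 𝓘(ℝ, E' × K × ℂ) 𝓘(ℝ, E)
    (blowUpChart j γ κ.toContinuousLinearMap y₀) (extChartAt 𝓘(ℝ, E') z₀ z₀, 0, 0)
  have hL : Function.Surjective (L : E' × K × ℂ →ₗ[ℝ] E) := hs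
  exact ⟨(LinearMap.injective_iff_surjective_of_finrank_eq_finrank h5).2 hL, hs⟩

theorem alternating_congr {α : DiffForm E M 2} {x x' : M} (h : x = x')
    (v : Fin 2 → E) : α x v = α x' v := by
  subst h; rfl

/-- The model of the normal space at the centre of a trivialization. -/
theorem IsComplexTrivialization.exists_center_linearMap
    (h : IsComplexTrivialization c z₀ P ι γ U) (hc : ∀ z, Function.Injective (c z))
    (hι : LinearMap.range ι.toLinearMap = LinearMap.range (c z₀)) :
    ∃ n : Y →ₗ[ℂ] N z₀, Function.Injective n ∧
      ∀ y, γ (extChartAt 𝓘(ℝ, E') z₀ z₀, y) = ⟨z₀, n y⟩ := by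
  let e := LinearEquiv.ofInjective (c z₀) (hc z₀)
  let n : Y →ₗ[ℂ] N z₀ := e.symm.toLinearMap.comp
    (ι.toLinearMap.codRestrict (LinearMap.range (c z₀)) fun y => by
      rw [← hι]; exact ⟨y, rfl⟩)
  have hn : ∀ y, c z₀ (n y) = ι y := fun y => congrArg Subtype.val (e.apply_symm_apply _)
  refine ⟨n, fun y y' hy => ι.injective (by rw [← hn, ← hn, hy]), fun y => ?_⟩
  have h1 := h.coord _ h.mem y
  rw [h.center] at h1
  have h2 := h.apply_coord h.mem ⟨z₀, n y⟩ (by rw [extChartAt_to_inv])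
  rw [hn, h1] at h2
  exact h2

/-- Near a point of `Z`, the form `Ω` is tamed by a linear map acting as the complex structure in
the normal directions. -/
theorem exists_tame_tube [FiniteDimensional ℝ E'] [FiniteDimensional ℂ Y] {Ω : DiffForm E M 2}
    (hi : ContMDiff 𝓘(ℝ, E') 𝓘(ℝ, E) ∞ i)
    (hZΩ : (DiffForm.pullback (E := E') i Ω).IsNondegenerate)
    (hν : IsNormalBundle E' F Ω i ν) (hφ : IsTubularNeighbourhood E' i ν D φ)
    (h : IsComplexTrivialization c z₀ P ι γ U) (hc : ∀ z, Function.Injective (c z))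
    (hι : LinearMap.range ι.toLinearMap = LinearMap.range (c z₀)) :
    ∃ J : E' × Y →L[ℝ] E' × Y, (∀ v, (J v).2 = Complex.I • v.2) ∧
      ∀ v, v ≠ 0 → 0 < Ω.pull (φ ∘ γ) (extChartAt 𝓘(ℝ, E') z₀ z₀, 0) ![v, J v] := by
  obtain ⟨n, hn, hnγ⟩ := h.exists_center_linearMap hc hι
  set x₀ := extChartAt 𝓘(ℝ, E') z₀ z₀ with hx₀
  set ch := extChartAt 𝓘(ℝ, E') z₀ with hch
  have hch0 : ch.symm x₀ = z₀ := extChartAt_to_inv z₀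
  have hchs : ContMDiffAt 𝓘(ℝ, E') 𝓘(ℝ, E') ∞ ch.symm x₀ :=
    contMDiffAt_extChartAt_symm z₀ (mem_extChartAt_target z₀)
  have hcsurj : Function.Surjective (mfderiv 𝓘(ℝ, E') 𝓘(ℝ, E') ch.symm x₀) :=
    mfderiv_extChartAt_symm_surjective z₀
  have hcbij : Function.Bijective (mfderiv 𝓘(ℝ, E') 𝓘(ℝ, E') ch.symm x₀) := by
    let L : E' →L[ℝ] E' := mfderiv 𝓘(ℝ, E') 𝓘(ℝ, E') ch.symm x₀
    have hL : Function.Surjective (L : E' →ₗ[ℝ] E') := hcsurj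
    have hLi : Function.Injective (L : E' →ₗ[ℝ] E') := LinearMap.injective_iff_surjective.2 hL
    exact ⟨hLi, hcsurj⟩
  have hi0 : MDifferentiableAt 𝓘(ℝ, E') 𝓘(ℝ, E) i (ch.symm x₀) :=
    (hi _).mdifferentiableAt (by simp)
  have hchd := hchs.mdifferentiableAt (by simp)
  let Q : E' →L[ℝ] E := mfderiv 𝓘(ℝ, E') 𝓘(ℝ, E) (i ∘ ch.symm) x₀
  let dch : E' →L[ℝ] E' := mfderiv 𝓘(ℝ, E') 𝓘(ℝ, E') ch.symm x₀
  let di : E' →L[ℝ] E := mfderiv 𝓘(ℝ, E') 𝓘(ℝ, E) i z₀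
  have hQ : ∀ x : E', Q x = di (dch x) := by
    intro x
    have h1 : ∀ z, z = z₀ → ∀ u : E', mfderiv 𝓘(ℝ, E') 𝓘(ℝ, E) i z u =
        mfderiv 𝓘(ℝ, E') 𝓘(ℝ, E) i z₀ u := by rintro z rfl u; rfl
    exact (DFunLike.congr_fun (mfderiv_comp x₀ hi0 hchd) x).trans (h1 _ hch0 _)
  let η : E [⋀^Fin 2]→L[ℝ] ℝ := Ω (i z₀)
  let n' : Y →ₗ[ℝ] E := (ν z₀).comp (n.restrictScalars ℝ)
  have hμ0 : φ (γ (x₀, 0)) = i z₀ := by rw [h.apply_center_zero, hφ.map_zero]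
  have hD0 : γ (x₀, 0) ∈ D := center_mem hφ h
  have hμ : MDifferentiableAt 𝓘(ℝ, E' × Y) 𝓘(ℝ, E) (φ ∘ γ) (x₀, 0) :=
    (contMDiffAt_tube hφ h h.mem hD0).mdifferentiableAt (by simp)
  let Λ : E' × Y →L[ℝ] E := mfderiv 𝓘(ℝ, E' × Y) 𝓘(ℝ, E) (φ ∘ γ) (x₀, 0)
  have hQn : ∀ x y, η ![Q x, n' y] = 0 := by
    intro x y
    have h1 := (hν.mem_range_iff z₀ (ν z₀ (n y))).1 ⟨_, rfl⟩
      (show TangentSpace 𝓘(ℝ, E') z₀ from dch x)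
    rw [hQ, ← bilin_apply, bilin_swap, bilin_apply]
    exact neg_eq_zero.2 h1
  have hQnd : Nondegenerate₂ (η.compContinuousLinearMap Q) := by
    have h1 : (DiffForm.pullback (E := E') i Ω).NondegenerateAt (ch.symm x₀) := hZΩ _
    have h2 := h1.pull hcbij
    rw [DiffForm.pull_pullback Ω hi0 hchd] at h2
    intro v hv
    refine h2 v fun w => ?_
    rw [DiffForm.pull_apply]
    refine Eq.trans ?_ (hv w)
    exact alternating_congr (congrArg i hch0) fun l => Q (![v, w] l)
  have hnpos : ∀ y, y ≠ 0 → 0 < η ![n' y, n' (Complex.I • y)] := by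
    intro y hy
    have h1 := hν.positive z₀ (n y) fun h0 => hy (hn (by rw [h0, map_zero]))
    rw [← map_smul] at h1
    exact h1
  have hΛ1 : ∀ x, Λ (x, 0) = Q x := by
    intro x
    have h1 : (φ ∘ γ) ∘ (fun x : E' => (x, (0 : Y))) =ᶠ[𝓝 x₀] i ∘ ch.symm := by
      filter_upwards [h.isOpen.mem_nhds h.mem] with x hx
      simp only [Function.comp]
      rw [h.apply_zero hx, hφ.map_zero]
    have h2 : HasFDerivAt (fun x : E' => (x, (0 : Y))) (ContinuousLinearMap.inl ℝ E' Y) x₀ :=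
      (ContinuousLinearMap.inl ℝ E' Y).hasFDerivAt
    have h3 := DFunLike.congr_fun ((mfderiv_comp x₀ hμ h2.differentiableAt.mdifferentiableAt).symm.trans
      (h1.mfderiv_eq (I := 𝓘(ℝ, E')) (I' := 𝓘(ℝ, E)))) x
    refine Eq.trans ?_ h3
    change _ = mfderiv 𝓘(ℝ, E' × Y) 𝓘(ℝ, E) (φ ∘ γ) (x₀, 0) (mfderiv 𝓘(ℝ, E') 𝓘(ℝ, E' × Y)
      (fun x : E' => (x, (0 : Y))) x₀ x)
    rw [mfderiv_eq_fderiv, h2.fderiv]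
    rfl
  -- This is `normal_deriv`: the fibre derivative of φ is ν up to a vector tangent to Z, and that
  -- vector lies in the range of Q.
  have hΛ2 : ∀ y, ∃ x, Λ (0, y) = n' y + Q x := by
    intro y
    obtain ⟨u, hu⟩ := hφ.normal_deriv z₀ (n y)
    have hdch : Function.Surjective dch := hcsurj
    obtain ⟨x, hx⟩ := hdch (show E' from u)
    refine ⟨x, ?_⟩
    have h1 : (fun t : ℝ => φ ⟨z₀, t • n y⟩) = (φ ∘ γ) ∘ fun t : ℝ => (x₀, t • y) := by
      funext t
      simp only [Function.comp]
      rw [hnγ, ← Complex.coe_smul t y, map_smul, Complex.coe_smul]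
    have h2 : HasFDerivAt (fun t : ℝ => (x₀, t • y))
        (ContinuousLinearMap.toSpanSingleton ℝ ((0, y) : E' × Y)) 0 := by
      have h3 : HasDerivAt (fun t : ℝ => (x₀, t • y)) ((0, y) : E' × Y) 0 := by
        refine (hasDerivAt_const _ _).prodMk ?_
        simpa using (hasDerivAt_id (0 : ℝ)).smul_const y
      exact h3.hasFDerivAt
    have h4 : MDifferentiableAt 𝓘(ℝ, E' × Y) 𝓘(ℝ, E) (φ ∘ γ) (x₀, (0 : ℝ) • y) := by
      rwa [zero_smul]
    have h5 := DFunLike.congr_fun (mfderiv_comp (0 : ℝ) h4 h2.differentiableAt.mdifferentiableAt)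
      (1 : ℝ)
    rw [h1] at hu
    have h6 : (mfderiv 𝓘(ℝ, ℝ) 𝓘(ℝ, E) ((φ ∘ γ) ∘ fun t : ℝ => (x₀, t • y)) 0 (1 : ℝ) : E) =
        Λ (0, y) := by
      refine h5.trans ?_
      change mfderiv 𝓘(ℝ, E' × Y) 𝓘(ℝ, E) (φ ∘ γ) (x₀, (0 : ℝ) • y)
        (mfderiv 𝓘(ℝ, ℝ) 𝓘(ℝ, E' × Y) (fun t : ℝ => (x₀, t • y)) 0 (1 : ℝ)) = _
      rw [mfderiv_eq_fderiv, h2.fderiv, zero_smul]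
      exact congrArg Λ (one_smul ℝ _)
    rw [hQ, hx]
    exact h6.symm.trans hu
  obtain ⟨J, hJ1, hJ2⟩ := exists_tame_of_splitting η Q n' Λ hQn hQnd hnpos hΛ1 hΛ2
  refine ⟨J, hJ1, fun v hv => ?_⟩
  refine (hJ2 v hv).trans_eq ?_
  rw [DiffForm.pull_apply]
  refine (alternating_congr hμ0.symm _).trans ?_
  congr 1
  ext l; fin_cases l <;> rfl

end Setup

/-! ### The local direction map and non-degeneracy near the divisor. -/

section Setup

variable {E : Type*} [NormedAddCommGroup E] [NormedSpace ℝ E]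
  {M : Type*} [TopologicalSpace M] [ChartedSpace E M] [IsManifold 𝓘(ℝ, E) ∞ M]
  {E' : Type*} [NormedAddCommGroup E'] [NormedSpace ℝ E']
  {Z : Type*} [TopologicalSpace Z] [ChartedSpace E' Z] [IsManifold 𝓘(ℝ, E') ∞ Z]
  {F : Type*} [NormedAddCommGroup F] [NormedSpace ℝ F]
  {N : Z → Type*} [∀ z, AddCommGroup (N z)] [∀ z, Module ℂ (N z)]
  [∀ z, TopologicalSpace (N z)] [TopologicalSpace (TotalSpace F N)]
  [FiberBundle F N] [VectorBundle ℝ F N] [ContMDiffVectorBundle ∞ F N 𝓘(ℝ, E')]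
  {B : Type*} [TopologicalSpace B] [ChartedSpace E B] [IsManifold 𝓘(ℝ, E) ∞ B]
  {i : Z → M} {ν : ∀ z, N z →ₗ[ℝ] TangentSpace 𝓘(ℝ, E) (i z)}
  {D : Set (TotalSpace F N)} {φ : TotalSpace F N → M}
  {j : SubspaceVector N → B} {π : B → M}
  {H Y K : Type*} [NormedAddCommGroup H] [InnerProductSpace ℂ H]
  [NormedAddCommGroup Y] [InnerProductSpace ℂ Y] [NormedAddCommGroup K] [InnerProductSpace ℂ K]
  {c : ∀ z, N z →ₗ[ℂ] H} {z₀ : Z} {P : H →L[ℂ] Y} {ι : Y →ₗᵢ[ℂ] H} {γ : E' × Y → TotalSpace F N}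
  {U : Set E'}


/-- Differentiating q ∘ σ = id at each b near b₀ gives a right inverse of the derivative of q at σ
b. -/
theorem eventually_bijective_of_local_inverse {V : Type*} [NormedAddCommGroup V] [NormedSpace ℝ V]
    {q : V → B} {σ : B → V} {b₀ : B}
    (hσ : ∀ᶠ b in 𝓝 b₀, ContMDiffAt 𝓘(ℝ, E) 𝓘(ℝ, V) ∞ σ b ∧ q (σ b) = b)
    (hq : ∀ᶠ b in 𝓝 b₀, ContMDiffAt 𝓘(ℝ, V) 𝓘(ℝ, E) ∞ q (σ b)) :
    ∀ᶠ b in 𝓝 b₀, Function.Surjective (mfderiv 𝓘(ℝ, V) 𝓘(ℝ, E) q (σ b)) := by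
  filter_upwards [hσ.eventually_nhds, hq] with b h1 h2
  refine surjective_mfderiv_of_rightInverse (g := σ) (y := b) rfl (h2.mdifferentiableAt (by simp))
    (h1.self_of_nhds.1.mdifferentiableAt (by simp)) ?_
  exact h1.mono fun b' h => h.2

/-- The vector direction in a complex trivialization. -/
def directionMap (c : ∀ z, N z →ₗ[ℂ] H) (γ : E' × Y → TotalSpace F N) (κ : K →L[ℂ] Y) (y₀ : Y)
    (p : E' × K × ℂ) : H :=
  c _ (γ (p.1, y₀ + κ p.2.1)).2

theorem contDiffAt_directionMap {κ : K →L[ℂ] Y} {y₀ : Y}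
    (h : IsComplexTrivialization c z₀ P ι γ U)
    (hcs : ContMDiff (𝓘(ℝ, E').prod 𝓘(ℝ, F)) 𝓘(ℝ, H) ∞ fun p : TotalSpace F N => c p.proj p.2)
    {p : E' × K × ℂ} (hp : p.1 ∈ U) : ContDiffAt ℝ ∞ (directionMap c γ κ y₀) p := by
  refine ContDiffAt.comp p (g := fun p : E' × Y => c _ (γ p).2)
    (f := fun p : E' × K × ℂ => (p.1, y₀ + κ p.2.1)) (h.contDiffAt_coord hcs hp _) ?_
  refine contDiffAt_fst.prodMk (contDiffAt_const.add ?_)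
  exact ((κ.restrictScalars ℝ).contDiff.comp (contDiff_fst.comp contDiff_snd)).contDiffAt

theorem directionMap_ne_zero {κ : K →L[ℂ] Y} {y₀ : Y}
    (h : IsComplexTrivialization c z₀ P ι γ U) (hc : ∀ z, Function.Injective (c z))
    {p : E' × K × ℂ} (hp : p.1 ∈ U) (hp0 : y₀ + κ p.2.1 ≠ 0) : directionMap c γ κ y₀ p ≠ 0 :=
  fun h0 => h.snd_ne_zero hp hp0 (hc _ (h0.trans (map_zero _).symm))

/-- The direction of the line does not involve the scalar coordinate. This puts the scalar
directions in the kernel of the pulled back Fubini–Study form. -/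
theorem fderiv_directionMap_scalar (κ : K →L[ℂ] Y) (y₀ : Y)
    (h : IsComplexTrivialization c z₀ P ι γ U)
    (hcs : ContMDiff (𝓘(ℝ, E').prod 𝓘(ℝ, F)) 𝓘(ℝ, H) ∞ fun p : TotalSpace F N => c p.proj p.2)
    {p : E' × K × ℂ} (hp : p.1 ∈ U) (s : ℂ) :
    fderiv ℝ (directionMap c γ κ y₀) p (0, 0, s) = 0 := by
  have h1 := ((contDiffAt_directionMap (κ := κ) (y₀ := y₀) h hcs hp).differentiableAt
    (by simp)).hasFDerivAt
  have h2 : HasDerivAt (fun r : ℝ => p + r • ((0, 0, s) : E' × K × ℂ)) (0, 0, s) 0 := by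
    simpa using ((hasDerivAt_id (0 : ℝ)).smul_const ((0, 0, s) : E' × K × ℂ)).const_add p
  have h3 := HasFDerivAt.comp_hasDerivAt (0 : ℝ) (by simpa using h1) h2
  refine h3.unique ?_
  have h4 : (directionMap c γ κ y₀ ∘ fun r : ℝ => p + r • ((0, 0, s) : E' × K × ℂ)) =
      fun _ => directionMap c γ κ y₀ p := by
    funext r
    have h5 : (p + r • ((0, 0, s) : E' × K × ℂ)).1 = p.1 := by simp
    have h6 : (p + r • ((0, 0, s) : E' × K × ℂ)).2.1 = p.2.1 := by simp
    simp only [Function.comp, directionMap]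
    rw [h5, h6]
  rw [h4]
  exact hasDerivAt_const _ _

/-- Over the centre c ∘ γ is exactly the linear isometry ι, so positivity along the projective fibre
can be computed with the inner products of Y and K. -/
theorem fderiv_directionMap_center (κ : K →L[ℂ] Y) (y₀ : Y)
    (h : IsComplexTrivialization c z₀ P ι γ U)
    (hcs : ContMDiff (𝓘(ℝ, E').prod 𝓘(ℝ, F)) 𝓘(ℝ, H) ∞ fun p : TotalSpace F N => c p.proj p.2)
    (ζ : K) :
    fderiv ℝ (directionMap c γ κ y₀) (extChartAt 𝓘(ℝ, E') z₀ z₀, 0, 0) (0, ζ, 0) = ι (κ ζ) := by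
  set p₀ : E' × K × ℂ := (extChartAt 𝓘(ℝ, E') z₀ z₀, 0, 0) with hp₀
  have h1 := ((contDiffAt_directionMap (p := p₀) (κ := κ) (y₀ := y₀) h hcs h.mem).differentiableAt
    (by simp)).hasFDerivAt
  have h2 : HasDerivAt (fun r : ℝ => p₀ + r • ((0, ζ, 0) : E' × K × ℂ)) (0, ζ, 0) 0 := by
    simpa using ((hasDerivAt_id (0 : ℝ)).smul_const ((0, ζ, 0) : E' × K × ℂ)).const_add p₀
  have h3 := HasFDerivAt.comp_hasDerivAt (0 : ℝ) (by simpa using h1) h2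
  refine h3.unique ?_
  have h4 : (directionMap c γ κ y₀ ∘ fun r : ℝ => p₀ + r • ((0, ζ, 0) : E' × K × ℂ)) =
      fun r : ℝ => ι y₀ + r • ι (κ ζ) := by
    funext r
    have h5 : (p₀ + r • ((0, ζ, 0) : E' × K × ℂ)).1 = extChartAt 𝓘(ℝ, E') z₀ z₀ := by simp [hp₀]
    have h6 : (p₀ + r • ((0, ζ, 0) : E' × K × ℂ)).2.1 = r • ζ := by simp [hp₀]
    simp only [Function.comp, directionMap]
    rw [h5, h6, h.center, map_add]
    congr 1
    rw [← Complex.coe_smul r ζ, map_smul, map_smul, Complex.coe_smul]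
  rw [h4]
  simpa using ((hasDerivAt_id (0 : ℝ)).smul_const (ι (κ ζ))).const_add (ι y₀)

/-- Near a point of the exceptional divisor, the composition of `c` with the lift of the blow-down
map is a multiple of a nonvanishing map `C`, and small multiples of the differential of the angular
form of `C` make the pullback of `Ω` non-degenerate. -/
theorem exists_local_direction [FiniteDimensional ℝ E] [FiniteDimensional ℝ E']
    [FiniteDimensional ℝ F] [FiniteDimensional ℂ H] [Nonempty (TotalSpace F N)]
    {Ω : DiffForm E M 2} (hΩs : Ω.IsSmooth)
    (hi : ContMDiff 𝓘(ℝ, E') 𝓘(ℝ, E) ∞ i)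
    (hZΩ : (DiffForm.pullback (E := E') i Ω).IsNondegenerate)
    (hν : IsNormalBundle E' F Ω i ν) (hφ : IsTubularNeighbourhood E' i ν D φ)
    (hπ : IsBlowUp E E' i D φ j π) (hc : ∀ z, Function.Injective (c z))
    (hcs : ContMDiff (𝓘(ℝ, E').prod 𝓘(ℝ, F)) 𝓘(ℝ, H) ∞ fun p : TotalSpace F N => c p.proj p.2)
    {b₀ : B} (hb₀ : π b₀ ∈ range i) :
    ∃ (C : B → H) (T : B → ℂ) (s₀ : ℝ), 0 < s₀ ∧ ∀ᶠ b in 𝓝 b₀,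
      ContMDiffAt 𝓘(ℝ, E) 𝓘(ℝ, H) ∞ C b ∧ ContMDiffAt 𝓘(ℝ, E) 𝓘(ℝ, ℂ) ∞ T b ∧ C b ≠ 0 ∧
      c _ (normalLift D φ π b).2 = T b • C b ∧ ∀ s : ℝ, 0 < s → s < s₀ →
        (DiffForm.pullback (E := E) π Ω +
          s • (DiffForm.pullback (E := E) C (angularForm H)).d).NondegenerateAt b := by
  obtain ⟨w₀, hw₀, rfl⟩ := IsBlowUp.exists_eq_taut_zero hφ hπ hb₀
  set z₀ := w₀.proj with hz₀
  obtain ⟨Y, _, _, _, ι, hι⟩ := exists_linearIsometry_range_eq (LinearMap.range (c z₀))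
  obtain ⟨P, γ, U, h⟩ := exists_isComplexTrivialization c hc hcs z₀ ι hι
  set y₀ : Y := P (c _ w₀.2) with hy₀d
  have hγw : γ (extChartAt 𝓘(ℝ, E') z₀ z₀, y₀) = w₀ :=
    h.apply_coord h.mem w₀ (by rw [extChartAt_to_inv])
  have hy₀ : y₀ ≠ 0 := by
    intro h0
    rw [h0, h.apply_center_zero] at hγw
    apply hw₀
    rw [← hγw]
  -- K models the orthogonal complement of y₀: the lines near ℂ y₀ are spanned by the vectors y₀ + κ
  -- ζ.
  obtain ⟨K, _, _, _, κ, hκ⟩ := exists_linearIsometry_range_eq (Submodule.span ℂ {y₀})ᗮ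
  have : FiniteDimensional ℝ K := FiniteDimensional.complexToReal K
  have : FiniteDimensional ℝ Y := FiniteDimensional.complexToReal Y
  set x₀ := extChartAt 𝓘(ℝ, E') z₀ z₀ with hx₀
  set κ' : K →L[ℂ] Y := κ.toContinuousLinearMap with hκ'
  set p₀ : E' × K × ℂ := (x₀, 0, 0) with hp₀
  let q := blowUpChart j γ κ' y₀
  have hgood := eventually_good (κ := κ') hφ h hy₀
  have hqp₀ : q p₀ = j (tautologicalMap (w₀, 0)) := by
    simp only [q, blowUpChart, hp₀, map_zero, add_zero, hγw]
  have hq : ∀ᶠ p in 𝓝 p₀, ContMDiffAt 𝓘(ℝ, E' × K × ℂ) 𝓘(ℝ, E) ∞ q p :=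
    hgood.mono fun p hp => contMDiffAt_blowUpChart hπ h hp.1 hp.2.1 hp.2.2
  obtain ⟨σ, hσ0, hσq, hqσ⟩ := exists_smooth_local_inverse hq
    (bijective_mfderiv_blowUpChart hφ hπ h hcs hy₀ hκ)
  rw [hqp₀] at hσ0 hqσ
  set b₀ := j (tautologicalMap (w₀, 0)) with hb₀d
  have hσc : Tendsto σ (𝓝 b₀) (𝓝 p₀) := by
    have := hqσ.self_of_nhds.1.continuousAt.tendsto
    rwa [hσ0] at this
  obtain ⟨J, hJ, hAJ⟩ := exists_tame_tube hi hZΩ hν hφ h hc hι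
  have hA : ContinuousAt (Ω.pull (φ ∘ γ)) (x₀, 0) :=
    (((DiffForm.isSmooth_iff.1 hΩs) _).pull
      (contMDiffAt_tube hφ h h.mem (center_mem hφ h))).continuousAt
  let C' := directionMap c γ κ' y₀
  have hC'0 : C' p₀ = ι y₀ := by
    have h1 : γ (x₀, y₀ + κ' 0) = γ (x₀, y₀) := by rw [map_zero, add_zero]
    exact (congrArg (fun v : TotalSpace F N => c v.proj v.2) h1).trans (h.center y₀)
  have hC'ne : C' p₀ ≠ 0 := by
    rw [hC'0]; exact fun h0 => hy₀ (ι.injective (h0.trans (map_zero ι).symm))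
  have hC's : ∀ᶠ p in 𝓝 p₀, ContDiffAt ℝ ∞ C' p :=
    hgood.mono fun p hp => contDiffAt_directionMap h hcs hp.1
  have hG : ContinuousAt (extDeriv ((angularForm H).pull C')) p₀ :=
    (contDiffAt_extDeriv ((smoothAt_angularForm hC'ne).pull
      hC's.self_of_nhds.contMDiffAt)).continuousAt
  have hG0 : ∀ᶠ p in 𝓝 p₀, ∀ s w, extDeriv ((angularForm H).pull C') p ![(0, 0, s), w] = 0 := by
    filter_upwards [hgood, hC's] with p hp hpC s w
    rw [extDeriv_angularForm_pull_apply hpC (directionMap_ne_zero h hc hp.1 hp.2.1)]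
    refine ContinuousAlternatingMap.map_coord_zero _ 0 ?_
    exact fderiv_directionMap_scalar κ' y₀ h hcs hp.1 s
  have horth : ∀ ζ, inner ℂ (ι y₀) (ι (κ ζ)) = 0 := by
    intro ζ
    rw [ι.inner_map_map]
    have h1 : κ ζ ∈ (Submodule.span ℂ {y₀})ᗮ := by rw [← hκ]; exact ⟨ζ, rfl⟩
    exact h1 y₀ (Submodule.mem_span_singleton_self y₀)
  have hGpos : ∀ ζ : K, ζ ≠ 0 →
      0 < extDeriv ((angularForm H).pull C') p₀ ![(0, ζ, 0), (0, Complex.I • ζ, 0)] := by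
    intro ζ hζ
    rw [extDeriv_angularForm_pull_apply hC's.self_of_nhds hC'ne]
    have e : (fun l => fderiv ℝ C' p₀ (![((0, ζ, 0) : E' × K × ℂ), (0, Complex.I • ζ, 0)] l)) =
        ![ι (κ ζ), ι (κ (Complex.I • ζ))] := by
      funext l
      fin_cases l
      · exact fderiv_directionMap_center κ' y₀ h hcs ζ
      · exact fderiv_directionMap_center κ' y₀ h hcs (Complex.I • ζ)
    rw [e, hC'0, extDeriv_angularMap_of_orthogonal (by rwa [← hC'0]) (horth _) (horth _),
      ι.inner_map_map, κ.inner_map_map, inner_smul_right, inner_self_eq_norm_sq_to_K, ι.norm_map]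
    have h1 : 0 < ‖y₀‖ := norm_pos_iff.2 hy₀
    have h2 : 0 < ‖ζ‖ := norm_pos_iff.2 hζ
    have h3 : (Complex.I * ((‖ζ‖ : ℝ) : ℂ) ^ 2).im = ‖ζ‖ ^ 2 := by
      rw [← Complex.ofReal_pow, Complex.I_mul_im, Complex.ofReal_re]
    refine lt_of_lt_of_eq ?_ (congrArg (2 * (‖y₀‖ ^ 2)⁻¹ * ·) h3.symm)
    positivity
  obtain ⟨s₀, hs₀, hnd⟩ := exists_eventually_nondegenerate_blowDown κ' hy₀ hA hJ hAJ hG hG0 hGpos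
  -- In the coordinates σ the lifted vector is t (y₀ + κ ζ). Its scalar t is T, and the image of y₀
  -- + κ ζ under the embedding is C.
  refine ⟨C' ∘ σ, fun b => (σ b).2.2, s₀, hs₀, ?_⟩
  have hsurj := eventually_bijective_of_local_inverse hqσ (hσc.eventually hq)
  filter_upwards [hqσ, hqσ.eventually_nhds, hσc.eventually hgood.eventually_nhds,
    hσc.eventually hC's, hσc.eventually hnd, hsurj, hσc.eventually hσq.eventually_nhds,
    hσc.eventually hq]
    with b hb1 hb1' hb2 hb3 hb4 hb5 hb6 hb7
  obtain ⟨hpU, hp0, hpD⟩ := hb2.self_of_nhds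
  have hCs : ContMDiffAt 𝓘(ℝ, E) 𝓘(ℝ, H) ∞ (C' ∘ σ) b := hb3.contMDiffAt.comp b hb1.1
  have hCne : C' (σ b) ≠ 0 := directionMap_ne_zero h hc hpU hp0
  refine ⟨hCs, ?_, hCne, ?_, ?_⟩
  · exact (contDiff_snd.comp contDiff_snd).contDiffAt.contMDiffAt.comp b hb1.1
  · have h1 := normalLift_blowUpChart hφ hπ h hpU hp0 hpD
    have h2 : blowUpChart j γ κ' y₀ (σ b) = b := hb1.2
    rw [h2] at h1
    refine (congrArg (fun v : TotalSpace F N => c v.proj v.2)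
      (h1.trans (h.apply_smul hpU (σ b).2.2 (y₀ + κ' (σ b).2.1)))).trans ?_
    exact map_smul (c _) _ _
  · intro s hs1 hs2
    have h1 := hb4 s hs1 hs2
    have h2 : q (σ b) = b := hb1.2
    rw [← h2]
    refine DiffForm.NondegenerateAt.of_pull hb5 ?_
    -- In coordinates π is `blowDown` followed by φ ∘ γ, and C is the direction map, so the form to
    -- be tested becomes the one of the linear model.
    have hπq : π ∘ q =ᶠ[𝓝 (σ b)] (φ ∘ γ) ∘ blowDown κ' y₀ :=
      hb2.mono fun p hp => map_blowUpChart hπ h hp.1 hp.2.1 hp.2.2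
    have hCq : (C' ∘ σ) ∘ q =ᶠ[𝓝 (σ b)] C' := hb6.mono fun p hp => congrArg C' hp
    have hσs : ContMDiffAt 𝓘(ℝ, E) 𝓘(ℝ, H) ∞ (C' ∘ σ) (q (σ b)) := by rwa [h2]
    have e1 : (DiffForm.pullback (E := E) π Ω).pull q (σ b) =
        (Ω.pull (φ ∘ γ) (blowDown κ' y₀ (σ b))).compContinuousLinearMap
          (blowDownDeriv κ' y₀ (σ b)) := by
      rw [DiffForm.pull_pullback Ω (hπ.smooth.mdifferentiableAt (by simp))
        (hb7.mdifferentiableAt (by simp)), DiffForm.pull_congr Ω hπq,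
        DiffForm.pull_comp Ω ((contMDiffAt_tube hφ h hpU hpD).mdifferentiableAt (by simp))
          (hasFDerivAt_blowDown κ' y₀ (σ b)).differentiableAt,
        (hasFDerivAt_blowDown κ' y₀ (σ b)).fderiv]
    have hsm : (DiffForm.pullback (E := E) (C' ∘ σ) (angularForm H)).SmoothAt (q (σ b)) := by
      refine DiffForm.SmoothAt.pullback (smoothAt_angularForm ?_) hσs
      rw [h2]; exact hCne
    have e2 : (DiffForm.pullback (E := E) (C' ∘ σ) (angularForm H)).d.pull q (σ b) =
        extDeriv ((angularForm H).pull C') (σ b) := by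
      rw [← hsm.extDeriv_pull hb7, (DiffForm.pull_pullback_eventuallyEq _ hσs hb7).extDeriv_eq]
      refine Filter.EventuallyEq.extDeriv_eq ?_
      exact hCq.eventuallyEq_nhds.mono fun p hp => DiffForm.pull_congr _ hp
    have e3 : (DiffForm.pullback (E := E) π Ω +
        s • (DiffForm.pullback (E := E) (C' ∘ σ) (angularForm H)).d).pull q (σ b) =
        (Ω.pull (φ ∘ γ) (blowDown κ' y₀ (σ b))).compContinuousLinearMap
          (blowDownDeriv κ' y₀ (σ b)) + s • extDeriv ((angularForm H).pull C') (σ b) := by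
      rw [← e1, ← e2]
      rfl
    rw [e3]
    exact h1

end Setup

/-! ### Primitives of closed 1-forms. -/

section OneForms

variable {W : Type*} [NormedAddCommGroup W] [NormedSpace ℝ W]

/-- An alternating `1`-form as a continuous linear map. -/
def oneForm : (W [⋀^Fin 1]→L[ℝ] ℝ) ≃ₗᵢ[ℝ] (W →L[ℝ] ℝ) :=
  (ContinuousAlternatingMap.ofSubsingletonLIE (𝕜 := ℝ) (E := W) (F := ℝ) (0 : Fin 1)).symm

theorem apply_oneForm (η : W [⋀^Fin 1]→L[ℝ] ℝ) (v : Fin 1 → W) : oneForm η (v 0) = η v := by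
  have h : η = ContinuousAlternatingMap.ofSubsingletonLIE (𝕜 := ℝ) (E := W) (F := ℝ) (0 : Fin 1)
    (oneForm η) := (LinearIsometryEquiv.apply_symm_apply _ η).symm
  conv_rhs => rw [h]
  rfl

theorem oneForm_apply (η : W [⋀^Fin 1]→L[ℝ] ℝ) (x : W) : oneForm η x = η ![x] :=
  apply_oneForm η ![x]

theorem extDeriv_one_apply {α : W → W [⋀^Fin 1]→L[ℝ] ℝ} {p : W} (h : DifferentiableAt ℝ α p)
    (v : Fin 2 → W) : extDeriv α p v =
      fderiv ℝ (fun q => oneForm (α q)) p (v 0) (v 1) -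
        fderiv ℝ (fun q => oneForm (α q)) p (v 1) (v 0) := by
  have h1 : HasFDerivAt (fun q => oneForm (α q))
      ((oneForm (W := W)).toContinuousLinearEquiv.toContinuousLinearMap.comp (fderiv ℝ α p)) p :=
    (oneForm (W := W)).toContinuousLinearEquiv.toContinuousLinearMap.hasFDerivAt.comp p
      h.hasFDerivAt
  have h2 : ∀ f : Fin 1 → W, ∀ u, fderiv ℝ (fun q => α q f) p u =
      fderiv ℝ (fun q => oneForm (α q)) p u (f 0) := by
    intro f u
    have h3 : (fun q => α q f) = fun q => oneForm (α q) (f 0) := by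
      funext q; exact (apply_oneForm _ _).symm
    rw [h3]
    have h4 := h1.clm_apply (hasFDerivAt_const (f 0) p)
    rw [h4.fderiv, h1.fderiv]
    simp
  rw [extDeriv_apply h, Fin.sum_univ_two, h2, h2]
  simp [Fin.removeNth, sub_eq_add_neg]

/-- The Poincaré lemma for smooth closed `1`-forms on a convex open set. -/
theorem exists_primitive_of_extDeriv_eq_zero {α : W → W [⋀^Fin 1]→L[ℝ] ℝ} {s : Set W}
    (hs : Convex ℝ s) (hso : IsOpen s) (hα : ∀ p ∈ s, ContDiffAt ℝ ∞ α p)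
    (hd : ∀ p ∈ s, extDeriv α p = 0) :
    ∃ f : W → ℝ, ∀ p ∈ s, ContDiffAt ℝ ∞ f p ∧ HasFDerivAt f (oneForm (α p)) p := by
  have hsm : ∀ p ∈ s, ContDiffAt ℝ ∞ (fun q => oneForm (α q)) p := fun p hp =>
    (oneForm (W := W)).contDiff.contDiffAt.comp p (hα p hp)
  obtain ⟨f, hf⟩ := hs.exists_forall_hasFDerivAt_of_fderiv_symmetric hso
    (show DifferentiableOn ℝ (fun q => oneForm (α q)) s from
      fun p hp => ((hsm p hp).differentiableAt (by simp)).differentiableWithinAt) (by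
      intro p hp x y
      have h1 := extDeriv_one_apply ((hα p hp).differentiableAt (by simp)) ![x, y]
      rw [hd p hp] at h1
      exact sub_eq_zero.1 h1.symm)
  refine ⟨f, fun p hp => ⟨?_, hf p hp⟩⟩
  have h1 : ContDiffOn ℝ ∞ f s := by
    rw [contDiffOn_infty_iff_fderiv_of_isOpen hso]
    refine ⟨fun q hq => (hf q hq).differentiableAt.differentiableWithinAt, ?_⟩
    exact ContDiffOn.congr (fun q hq => (hsm q hq).contDiffWithinAt) fun q hq => (hf q hq).fderiv
  exact h1.contDiffAt (hso.mem_nhds hp)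

/-- A primitive of a closed `1`-form on a product of balls, recovered by integration along the
second factor from its values on the first. -/
theorem primitive_eq_add_integral {X Y : Type*} [NormedAddCommGroup X] [NormedSpace ℝ X]
    [NormedAddCommGroup Y] [NormedSpace ℝ Y] {a : X × Y → X × Y →L[ℝ] ℝ} {f : X × Y → ℝ}
    {x₀ : X} {r : ℝ} (ha : ∀ p ∈ Metric.ball (x₀, (0 : Y)) r, ContinuousAt a p)
    (hf : ∀ p ∈ Metric.ball (x₀, (0 : Y)) r, HasFDerivAt f (a p) p) {x : X} {y : Y}
    (hp : (x, y) ∈ Metric.ball (x₀, (0 : Y)) r) :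
    ∫ s in (0 : ℝ)..1, a (x, s • y) (0, y) = f (x, y) - f (x, 0) := by
  have hseg : ∀ s ∈ uIcc (0 : ℝ) 1, (x, s • y) ∈ Metric.ball (x₀, (0 : Y)) r := by
    intro s hs
    rw [uIcc_of_le zero_le_one] at hs
    rw [← ball_prod_same] at hp ⊢
    refine ⟨hp.1, ?_⟩
    have h1 := hp.2
    simp only [Metric.mem_ball, dist_zero_right, norm_smul, Real.norm_eq_abs] at h1 ⊢
    refine lt_of_le_of_lt ?_ h1
    rw [abs_of_nonneg hs.1]
    exact mul_le_of_le_one_left (norm_nonneg _) hs.2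
  have hpath : ∀ s : ℝ, HasDerivAt (fun s : ℝ => (x, s • y)) ((0, y) : X × Y) s := fun s => by
    refine (hasDerivAt_const _ _).prodMk ?_
    simpa using (hasDerivAt_id s).smul_const y
  have hder : ∀ s ∈ uIcc (0 : ℝ) 1, HasDerivAt (fun s : ℝ => f (x, s • y))
      (a (x, s • y) (0, y)) s := fun s hs =>
    (hf _ (hseg s hs)).comp_hasDerivAt s (hpath s)
  have h := intervalIntegral.integral_eq_sub_of_hasDerivAt hder ?_
  · simpa using h
  · refine ContinuousOn.intervalIntegrable fun s hs => ContinuousAt.continuousWithinAt ?_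
    exact ((ha _ (hseg s hs)).comp (f := fun s : ℝ => (x, s • y)) (hpath s).continuousAt).clm_apply
      continuousAt_const

end OneForms

/-! ### A primitive of the Lee form on the tubular neighbourhood. -/

section Setup

variable {E : Type*} [NormedAddCommGroup E] [NormedSpace ℝ E]
  {M : Type*} [TopologicalSpace M] [ChartedSpace E M] [IsManifold 𝓘(ℝ, E) ∞ M]
  {E' : Type*} [NormedAddCommGroup E'] [NormedSpace ℝ E']
  {Z : Type*} [TopologicalSpace Z] [ChartedSpace E' Z] [IsManifold 𝓘(ℝ, E') ∞ Z]
  {F : Type*} [NormedAddCommGroup F] [NormedSpace ℝ F]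
  {N : Z → Type*} [∀ z, AddCommGroup (N z)] [∀ z, Module ℂ (N z)]
  [∀ z, TopologicalSpace (N z)] [TopologicalSpace (TotalSpace F N)]
  [FiberBundle F N] [VectorBundle ℝ F N] [ContMDiffVectorBundle ∞ F N 𝓘(ℝ, E')]
  {B : Type*} [TopologicalSpace B] [ChartedSpace E B] [IsManifold 𝓘(ℝ, E) ∞ B]
  {i : Z → M} {ν : ∀ z, N z →ₗ[ℝ] TangentSpace 𝓘(ℝ, E) (i z)}
  {D : Set (TotalSpace F N)} {φ : TotalSpace F N → M}
  {j : SubspaceVector N → B} {π : B → M}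
  {H Y K : Type*} [NormedAddCommGroup H] [InnerProductSpace ℂ H]
  [NormedAddCommGroup Y] [InnerProductSpace ℂ Y] [NormedAddCommGroup K] [InnerProductSpace ℂ K]
  {c : ∀ z, N z →ₗ[ℂ] H} {z₀ : Z} {P : H →L[ℂ] Y} {ι : Y →ₗᵢ[ℂ] H} {γ : E' × Y → TotalSpace F N}
  {U : Set E'}


variable (E') in
/-- The function on the normal bundle with the values of `f` on the zero section and differential
`φ^* θ` along the fibres. -/
def tubePrimitive (φ : TotalSpace F N → M) (θ : DiffForm E M 1) (f : Z → ℝ) (v : TotalSpace F N) :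
    ℝ :=
  f v.proj + ∫ s in (0 : ℝ)..1,
    oneForm (θ.pull (fun r : ℝ => φ ⟨v.proj, r • v.2⟩) s) 1

/-- `tubePrimitive` is a primitive of `φ^* θ` near the zero section. -/
theorem eventually_tubePrimitive {θ : DiffForm E M 1} (hθs : θ.IsSmooth)
    (hθd : ∀ x, θ.d x = 0) {f : Z → ℝ} (hfs : ContMDiff 𝓘(ℝ, E') 𝓘(ℝ, ℝ) ∞ f)
    (hi : ContMDiff 𝓘(ℝ, E') 𝓘(ℝ, E) ∞ i)
    (hf : ∀ (z : Z) (u : TangentSpace 𝓘(ℝ, E') z),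
      DiffForm.pullback (E := E') i θ z ![u] = mfderiv 𝓘(ℝ, E') 𝓘(ℝ, ℝ) f z u)
    (hφ : IsTubularNeighbourhood E' i ν D φ) (h : IsComplexTrivialization c z₀ P ι γ U)
    (hcs : ContMDiff (𝓘(ℝ, E').prod 𝓘(ℝ, F)) 𝓘(ℝ, H) ∞ fun p : TotalSpace F N => c p.proj p.2) :
    ∀ᶠ v in 𝓝 (⟨z₀, 0⟩ : TotalSpace F N),
      ContMDiffAt (𝓘(ℝ, E').prod 𝓘(ℝ, F)) 𝓘(ℝ, ℝ) ∞ (tubePrimitive φ θ f) v ∧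
      ∀ u, mfderiv (𝓘(ℝ, E').prod 𝓘(ℝ, F)) 𝓘(ℝ, ℝ) (tubePrimitive φ θ f) v u =
        θ (φ v) ![mfderiv (𝓘(ℝ, E').prod 𝓘(ℝ, F)) 𝓘(ℝ, E) φ v u] := by
  set x₀ := extChartAt 𝓘(ℝ, E') z₀ z₀ with hx₀
  set ch := extChartAt 𝓘(ℝ, E') z₀ with hch
  have hθ := DiffForm.isSmooth_iff.1 hθs
  have hgood : ∀ᶠ p in 𝓝 ((x₀, 0) : E' × Y), p.1 ∈ U ∧ γ p ∈ D := by
    refine (continuous_fst.continuousAt.eventually (h.isOpen.mem_nhds h.mem)).and ?_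
    exact (h.smooth _ h.mem 0).continuousAt.eventually (hφ.isOpen.mem_nhds (center_mem hφ h))
  obtain ⟨r, hr, hball⟩ := Metric.eventually_nhds_iff_ball.1 hgood
  have hμ : ∀ p ∈ Metric.ball ((x₀, 0) : E' × Y) r,
      ContMDiffAt 𝓘(ℝ, E' × Y) 𝓘(ℝ, E) ∞ (φ ∘ γ) p := fun p hp =>
    contMDiffAt_tube hφ h (hball p hp).1 (hball p hp).2
  let α := θ.pull (φ ∘ γ)
  have hα : ∀ p ∈ Metric.ball ((x₀, 0) : E' × Y) r, ContDiffAt ℝ ∞ α p := fun p hp =>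
    (hθ _).pull (hμ p hp)
  obtain ⟨A, hA⟩ := exists_primitive_of_extDeriv_eq_zero (α := α) (convex_ball _ r)
    Metric.isOpen_ball hα (by
      intro p hp
      rw [(hθ _).extDeriv_pull (hμ p hp)]
      ext v
      rw [DiffForm.pull_apply, hθd]
      rfl)
  have hzero : ∀ x ∈ Metric.ball x₀ r, (x, (0 : Y)) ∈ Metric.ball ((x₀, 0) : E' × Y) r := by
    intro x hx
    rw [← ball_prod_same]
    exact ⟨hx, Metric.mem_ball_self hr⟩
  -- Along the zero section both f and the local primitive A have differential i^*θ read in the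
  -- chart, so their difference is constant on the ball.
  have hconst : ∀ x ∈ Metric.ball x₀ r, f (ch.symm x) - A (x, 0) = f (ch.symm x₀) - A (x₀, 0) := by
    have hd : ∀ x ∈ Metric.ball x₀ r, HasFDerivAt (fun x => f (ch.symm x) - A (x, 0)) (0 : E' →L[ℝ] ℝ) x := by
      intro x hx
      have hxU : x ∈ U := (hball _ (hzero x hx)).1
      have hchs : ContMDiffAt 𝓘(ℝ, E') 𝓘(ℝ, E') ∞ ch.symm x :=
        contMDiffAt_extChartAt_symm z₀ (h.subset hxU)
      have hchd := hchs.mdifferentiableAt (by simp)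
      have h1 : HasFDerivAt (fun x => f (ch.symm x)) (fderiv ℝ (f ∘ ch.symm) x) x :=
        (((hfs _).comp x hchs).contDiffAt.differentiableAt (by simp)).hasFDerivAt
      have h2 : HasFDerivAt (fun x : E' => A (x, 0))
          ((oneForm (α (x, 0))).comp (ContinuousLinearMap.inl ℝ E' Y)) x :=
        ((hA _ (hzero x hx)).2).comp x (ContinuousLinearMap.inl ℝ E' Y).hasFDerivAt
      have h3 : fderiv ℝ (f ∘ ch.symm) x =
          (oneForm (α (x, 0))).comp (ContinuousLinearMap.inl ℝ E' Y) := by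
        ext u
        have e1 : fderiv ℝ (f ∘ ch.symm) x u = θ.pull (i ∘ ch.symm) x ![u] := by
          rw [← DiffForm.pull_pullback θ ((hi _).mdifferentiableAt (by simp)) hchd,
            DiffForm.pull_apply, ← mfderiv_eq_fderiv,
            mfderiv_comp x ((hfs _).mdifferentiableAt (by simp)) hchd]
          refine (hf _ _).symm.trans ?_
          congr 1
          ext l; fin_cases l; rfl
        have h4 : (φ ∘ γ) ∘ (fun x : E' => (x, (0 : Y))) =ᶠ[𝓝 x] i ∘ ch.symm := by
          filter_upwards [h.isOpen.mem_nhds hxU] with x hx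
          simp only [Function.comp]
          rw [h.apply_zero hx, hφ.map_zero]
        have h5 : HasFDerivAt (fun x : E' => (x, (0 : Y))) (ContinuousLinearMap.inl ℝ E' Y) x :=
          (ContinuousLinearMap.inl ℝ E' Y).hasFDerivAt
        have e2 := DiffForm.pull_comp (f := φ ∘ γ) (g := fun x : E' => (x, (0 : Y))) θ
          ((hμ _ (hzero x hx)).mdifferentiableAt (by simp)) h5.differentiableAt
        rw [e1, ← DiffForm.pull_congr θ h4, e2, h5.fderiv]
        exact (apply_oneForm (α (x, 0)) fun l => ContinuousLinearMap.inl ℝ E' Y (![u] l)).symm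
      have h6 := h1.sub h2
      rw [h3, sub_self] at h6
      exact h6
    intro x hx
    refine (convex_ball x₀ r).is_const_of_fderivWithin_eq_zero (𝕜 := ℝ)
      (f := fun x => f (ch.symm x) - A (x, 0))
      (fun x hx => (hd x hx).differentiableAt.differentiableWithinAt) (fun x hx => ?_) hx
      (Metric.mem_ball_self hr)
    rw [fderivWithin_of_isOpen Metric.isOpen_ball hx, (hd x hx).fderiv]
  -- The integral over the fibre segment is A (x, y) - A (x, 0). Hence the globally defined function
  -- equals the local primitive A up to a constant.
  have hval : ∀ p ∈ Metric.ball ((x₀, 0) : E' × Y) r,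
      tubePrimitive φ θ f (γ p) = A p + (f (ch.symm x₀) - A (x₀, 0)) := by
    rintro ⟨x, y⟩ hp
    have hxU : x ∈ U := (hball _ hp).1
    have hx : x ∈ Metric.ball x₀ r := by rw [← ball_prod_same] at hp; exact hp.1
    have h1 : (fun r : ℝ => φ ⟨(γ (x, y)).proj, r • (γ (x, y)).2⟩) =
        (φ ∘ γ) ∘ fun r : ℝ => (x, r • y) := by
      funext t
      simp only [Function.comp]
      rw [← Complex.coe_smul t y, h.apply_smul hxU, Complex.coe_smul]
    have h2 := primitive_eq_add_integral (a := fun p => oneForm (α p)) (f := A)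
      (fun p hp => oneForm.continuous.continuousAt.comp (hα p hp).continuousAt)
      (fun p hp => (hA p hp).2) hp
    have h3 : ∫ s in (0 : ℝ)..1, oneForm (θ.pull (fun r : ℝ =>
        φ ⟨(γ (x, y)).proj, r • (γ (x, y)).2⟩) s) 1 = A (x, y) - A (x, 0) := by
      rw [← h2, h1]
      refine intervalIntegral.integral_congr fun s hs => ?_
      have hpath : HasDerivAt (fun s : ℝ => (x, s • y)) ((0, y) : E' × Y) s := by
        refine (hasDerivAt_const _ _).prodMk ?_
        simpa using (hasDerivAt_id s).smul_const y
      have hps : (x, s • y) ∈ Metric.ball ((x₀, 0) : E' × Y) r := by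
        rw [uIcc_of_le zero_le_one] at hs
        rw [← ball_prod_same] at hp ⊢
        refine ⟨hp.1, ?_⟩
        have h1 := hp.2
        simp only [Metric.mem_ball, dist_zero_right, norm_smul, Real.norm_eq_abs] at h1 ⊢
        refine lt_of_le_of_lt ?_ h1
        rw [abs_of_nonneg hs.1]
        exact mul_le_of_le_one_left (norm_nonneg _) hs.2
      refine (congrArg (fun η => oneForm η (1 : ℝ)) (DiffForm.pull_comp (f := φ ∘ γ)
        (g := fun r : ℝ => (x, r • y)) θ ((hμ _ hps).mdifferentiableAt (by simp))
        hpath.differentiableAt)).trans ?_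
      rw [hpath.hasFDerivAt.fderiv, oneForm_apply, oneForm_apply]
      change α (x, s • y) _ = _
      congr 1
      ext l <;> fin_cases l <;> simp
    rw [tubePrimitive, h3, h.proj x hxU y]
    have h4 := hconst x hx
    linarith
  let Ψ : TotalSpace F N → E' × Y := fun v => (ch v.proj, P (c _ v.2))
  have hΨ0 : Ψ ⟨z₀, 0⟩ = (x₀, 0) := by simp [Ψ, hx₀]
  have hproj : ContinuousAt (fun v : TotalSpace F N => v.proj) ⟨z₀, 0⟩ :=
    (FiberBundle.continuous_proj F N).continuousAt
  have hsrc : ∀ᶠ v in 𝓝 (⟨z₀, 0⟩ : TotalSpace F N), v.proj ∈ ch.source :=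
    hproj.eventually ((isOpen_extChartAt_source z₀).mem_nhds (mem_extChartAt_source z₀))
  have hΨs : ∀ᶠ v in 𝓝 (⟨z₀, 0⟩ : TotalSpace F N),
      ContMDiffAt (𝓘(ℝ, E').prod 𝓘(ℝ, F)) 𝓘(ℝ, E' × Y) ∞ Ψ v :=
    hsrc.mono fun v hv => IsComplexTrivialization.contMDiffAt_inverse hcs P hv
  have hΨc : Tendsto Ψ (𝓝 ⟨z₀, 0⟩) (𝓝 (x₀, 0)) := by
    have := hΨs.self_of_nhds.continuousAt.tendsto
    rwa [hΨ0] at this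
  have hΨb : ∀ᶠ v in 𝓝 (⟨z₀, 0⟩ : TotalSpace F N), Ψ v ∈ Metric.ball ((x₀, 0) : E' × Y) r :=
    hΨc.eventually (Metric.ball_mem_nhds _ hr)
  have hγΨ : ∀ᶠ v in 𝓝 (⟨z₀, 0⟩ : TotalSpace F N), γ (Ψ v) = v := by
    filter_upwards [hsrc, hΨb] with v h1 h2
    exact h.apply_coord (hball _ h2).1 v (PartialEquiv.left_inv _ h1).symm
  filter_upwards [hΨs, hΨb, hΨb.eventually_nhds, hγΨ.eventually_nhds] with v h1 h2 h3 h4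
  have e1 : tubePrimitive φ θ f =ᶠ[𝓝 v]
      (fun p => A p + (f (ch.symm x₀) - A (x₀, 0))) ∘ Ψ := by
    filter_upwards [h3, h4] with v' h5 h6
    conv_lhs => rw [← h6]
    exact hval _ h5
  have e2 : (φ ∘ γ) ∘ Ψ =ᶠ[𝓝 v] φ := h4.mono fun v' h5 => congrArg φ h5
  have hAs : ContDiffAt ℝ ∞ (fun p => A p + (f (ch.symm x₀) - A (x₀, 0))) (Ψ v) :=
    (hA _ h2).1.add contDiffAt_const
  have hAd : HasFDerivAt (fun p => A p + (f (ch.symm x₀) - A (x₀, 0))) (oneForm (α (Ψ v))) (Ψ v) :=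
    (hA _ h2).2.add_const _
  refine ⟨(hAs.contMDiffAt.comp v h1).congr_of_eventuallyEq e1, fun u => ?_⟩
  have d1 := (e1.mfderiv_eq (I := 𝓘(ℝ, E').prod 𝓘(ℝ, F)) (I' := 𝓘(ℝ, ℝ))).trans
    (mfderiv_comp v (hAs.contMDiffAt.mdifferentiableAt (by simp)) (h1.mdifferentiableAt (by simp)))
  have d2 := (mfderiv_comp v ((hμ _ h2).mdifferentiableAt (by simp))
    (h1.mdifferentiableAt (by simp))).symm.trans
    (e2.mfderiv_eq (I := 𝓘(ℝ, E').prod 𝓘(ℝ, F)) (I' := 𝓘(ℝ, E)))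
  let w : E' × Y := mfderiv (𝓘(ℝ, E').prod 𝓘(ℝ, F)) 𝓘(ℝ, E' × Y) Ψ v u
  have d3 : mfderiv (𝓘(ℝ, E').prod 𝓘(ℝ, F)) 𝓘(ℝ, ℝ) (tubePrimitive φ θ f) v u =
      oneForm (α (Ψ v)) w := by
    refine (DFunLike.congr_fun d1 u).trans ?_
    change mfderiv 𝓘(ℝ, E' × Y) 𝓘(ℝ, ℝ) _ (Ψ v) w = _
    rw [mfderiv_eq_fderiv, hAd.fderiv]
    rfl
  have d4 : (mfderiv 𝓘(ℝ, E' × Y) 𝓘(ℝ, E) (φ ∘ γ) (Ψ v) w : E) =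
      mfderiv (𝓘(ℝ, E').prod 𝓘(ℝ, F)) 𝓘(ℝ, E) φ v u := DFunLike.congr_fun d2 u
  rw [d3, oneForm_apply, DiffForm.pull_apply]
  have key : ∀ (m m' : M) (e : m = m') (x x' : E), x = x' →
      θ m ![(show TangentSpace 𝓘(ℝ, E) m from x)] =
        θ m' ![(show TangentSpace 𝓘(ℝ, E) m' from x')] := by
    rintro m _ rfl x _ rfl; rfl
  refine Eq.trans ?_ (key _ _ (congrArg φ h4.self_of_nhds) _ _ d4)
  congr 1
  ext l; fin_cases l; rfl

end Setup

/-! ### A Leibniz rule for a function times an exact form. -/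

section VectorSpace

variable {V : Type*} [NormedAddCommGroup V] [NormedSpace ℝ V] {k : ℕ}

theorem extDeriv_apply_eq_sum {η : V → V [⋀^Fin k]→L[ℝ] ℝ} {y : V} (hη : DifferentiableAt ℝ η y)
    (v : Fin (k + 1) → V) : extDeriv η y v = ∑ l : Fin (k + 1), (-1 : ℝ) ^ (l : ℕ) *
      fderiv ℝ (fun x => η x (l.removeNth v)) y (v l) := by
  rw [extDeriv_apply hη]
  exact Finset.sum_congr rfl fun l _ => by simp [zsmul_eq_mul]

/-- In the Leibniz rule the terms in which g is not differentiated add up to g d(dη) = 0. -/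
theorem extDeriv_smul_extDeriv {η : V → V [⋀^Fin k]→L[ℝ] ℝ} {g : V → ℝ} {y : V}
    (hη : ContDiffAt ℝ ∞ η y) (hg : DifferentiableAt ℝ g y) (v : Fin (k + 2) → V) :
    extDeriv (fun x => g x • extDeriv η x) y v =
      ∑ l : Fin (k + 2), (-1 : ℝ) ^ (l : ℕ) *
        (fderiv ℝ g y (v l) * extDeriv η y (l.removeNth v)) := by
  have hd : DifferentiableAt ℝ (extDeriv η) y := (contDiffAt_extDeriv hη).differentiableAt (by simp)
  have h0 : extDeriv (extDeriv η) y v = 0 := by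
    rw [extDeriv_extDeriv_apply hη
      (by simpa using (WithTop.coe_le_coe.2 le_top : ((2 : ℕ∞) : ℕ∞ω) ≤ ∞))]
    rfl
  rw [extDeriv_apply_eq_sum hd] at h0
  have hgd : DifferentiableAt ℝ (fun x => g x • extDeriv η x) y := hg.smul hd
  rw [extDeriv_apply_eq_sum hgd]
  have h1 : ∀ u : Fin (k + 1) → V, ∀ w, fderiv ℝ (fun x => (g x • extDeriv η x) u) y w =
      fderiv ℝ g y w * extDeriv η y u + g y * fderiv ℝ (fun x => extDeriv η x u) y w := by
    intro u w
    have h2 : DifferentiableAt ℝ (fun x => extDeriv η x u) y :=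
      (ContinuousAlternatingMap.apply ℝ V ℝ u).differentiableAt.comp y hd
    have h3 := hg.hasFDerivAt.fun_mul h2.hasFDerivAt
    refine (DFunLike.congr_fun h3.fderiv w).trans ?_
    simp
    ring
  have h4 : ∀ l : Fin (k + 2),
      (-1 : ℝ) ^ (l : ℕ) * fderiv ℝ (fun x => (g x • extDeriv η x) (l.removeNth v)) y (v l) =
        (-1 : ℝ) ^ (l : ℕ) * (fderiv ℝ g y (v l) * extDeriv η y (l.removeNth v)) +
        g y * ((-1 : ℝ) ^ (l : ℕ) * fderiv ℝ (fun x => extDeriv η x (l.removeNth v)) y (v l)) := by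
    intro l
    rw [h1]
    ring
  rw [Finset.sum_congr rfl fun l _ => h4 l, Finset.sum_add_distrib, ← Finset.mul_sum, h0, mul_zero,
    add_zero]

end VectorSpace

/-! ### Exterior calculus at a point of a manifold. -/

section Calculus

variable {E : Type*} [NormedAddCommGroup E] [NormedSpace ℝ E]
  {B : Type*} [TopologicalSpace B] [ChartedSpace E B] [IsManifold 𝓘(ℝ, E) ∞ B]
  {k : ℕ} {α β : DiffForm E B k} {x : B}

theorem contMDiffAt_extChartAt_symm_center (x : B) :
    ContMDiffAt 𝓘(ℝ, E) 𝓘(ℝ, E) ∞ (extChartAt 𝓘(ℝ, E) x).symm (extChartAt 𝓘(ℝ, E) x x) :=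
  contMDiffAt_extChartAt_symm x (mem_extChartAt_target x)

theorem contDiffAt_comp_extChartAt_symm {G : Type*} [NormedAddCommGroup G] [NormedSpace ℝ G]
    {f : B → G} (hf : ContMDiffAt 𝓘(ℝ, E) 𝓘(ℝ, G) ∞ f x) :
    ContDiffAt ℝ ∞ (f ∘ (extChartAt 𝓘(ℝ, E) x).symm) (extChartAt 𝓘(ℝ, E) x x) := by
  refine (ContMDiffAt.comp _ ?_ (contMDiffAt_extChartAt_symm_center x)).contDiffAt
  rwa [extChartAt_to_inv]

theorem eventually_extChartAt_symm {p : B → Prop} (h : ∀ᶠ x' in 𝓝 x, p x') :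
    ∀ᶠ y in 𝓝 (extChartAt 𝓘(ℝ, E) x x), p ((extChartAt 𝓘(ℝ, E) x).symm y) :=
  (continuousAt_extChartAt_symm (I := 𝓘(ℝ, E)) x).eventually (by simpa using h)

theorem DiffForm.SmoothAt.add (hα : α.SmoothAt x) (hβ : β.SmoothAt x) : (α + β).SmoothAt x :=
  ContDiffAt.add hα hβ

theorem DiffForm.SmoothAt.smul {f : B → ℝ} (hf : ContMDiffAt 𝓘(ℝ, E) 𝓘(ℝ, ℝ) ∞ f x)
    (hα : α.SmoothAt x) : DiffForm.SmoothAt (fun x => f x • α x) x :=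
  ContDiffAt.smul (contDiffAt_comp_extChartAt_symm hf) hα

/-- The value of d at each nearby point is computed in the chart centred there, so smoothness is
needed at all these points. Naturality then compares it with the chart at x. -/
theorem DiffForm.d_inChart_eventuallyEq (hα : ∀ᶠ x' in 𝓝 x, α.SmoothAt x') :
    α.d.inChart x =ᶠ[𝓝 (extChartAt 𝓘(ℝ, E) x x)] extDeriv (α.inChart x) := by
  filter_upwards [eventually_extChartAt_symm hα,
    (isOpen_extChartAt_target x).mem_nhds (mem_extChartAt_target (I := 𝓘(ℝ, E)) x)] with y h1 h2
  exact (h1.extDeriv_pull (contMDiffAt_extChartAt_symm x h2)).symm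

theorem DiffForm.SmoothAt.d (hα : ∀ᶠ x' in 𝓝 x, α.SmoothAt x') : α.d.SmoothAt x :=
  (contDiffAt_extDeriv hα.self_of_nhds).congr_of_eventuallyEq
    (DiffForm.d_inChart_eventuallyEq hα)

theorem DiffForm.d_add (hα : α.SmoothAt x) (hβ : β.SmoothAt x) :
    (α + β).d x = α.d x + β.d x := by
  have h : extDeriv ((α + β).inChart x) (extChartAt 𝓘(ℝ, E) x x) =
      extDeriv (α.inChart x) (extChartAt 𝓘(ℝ, E) x x) +
        extDeriv (β.inChart x) (extChartAt 𝓘(ℝ, E) x x) :=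
    extDeriv_add (ContDiffAt.differentiableAt hα (by simp))
      (ContDiffAt.differentiableAt hβ (by simp))
  unfold DiffForm.d
  rw [h]
  rfl

/-- `d (f dα) = θ ∧ (f dα)` when `df = f θ`. -/
theorem DiffForm.d_smul_d {f : B → ℝ} {θ : DiffForm E B 1}
    (hf : ContMDiffAt 𝓘(ℝ, E) 𝓘(ℝ, ℝ) ∞ f x)
    (hdf : ∀ u : TangentSpace 𝓘(ℝ, E) x, f x * θ x ![u] = mfderiv 𝓘(ℝ, E) 𝓘(ℝ, ℝ) f x u)
    (hα : ∀ᶠ x' in 𝓝 x, α.SmoothAt x') (v : Fin (k + 2) → TangentSpace 𝓘(ℝ, E) x) :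
    DiffForm.d (fun x => f x • α.d x) x v =
      DiffForm.wedgeOne θ (fun x => f x • α.d x) x v := by
  set ch := extChartAt 𝓘(ℝ, E) x with hch
  let L : E →L[ℝ] E := mfderiv 𝓘(ℝ, E) 𝓘(ℝ, E) ch x
  have hfc := contDiffAt_comp_extChartAt_symm hf
  have h1 : DiffForm.inChart (fun x => f x • α.d x) x =ᶠ[𝓝 (ch x)]
      fun y => (f ∘ ch.symm) y • extDeriv (α.inChart x) y := by
    filter_upwards [DiffForm.d_inChart_eventuallyEq hα] with y hy
    rw [← hy]
    rfl
  have h2 : ∀ u : TangentSpace 𝓘(ℝ, E) x,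
      f x * θ x ![u] = fderiv ℝ (f ∘ ch.symm) (ch x) (L u) := by
    intro u
    refine (hdf u).trans ?_
    have e1 : f =ᶠ[𝓝 x] (f ∘ ch.symm) ∘ ch := by
      filter_upwards [extChartAt_source_mem_nhds (I := 𝓘(ℝ, E)) x] with x' hx'
      exact congrArg f (ch.left_inv hx').symm
    refine (DFunLike.congr_fun ((e1.mfderiv_eq (I := 𝓘(ℝ, E)) (I' := 𝓘(ℝ, ℝ))).trans
      (mfderiv_comp x (hfc.contMDiffAt.mdifferentiableAt (by simp))
        (contMDiffAt_extChartAt.mdifferentiableAt (n := ∞) (by simp)))) u).trans ?_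
    change mfderiv 𝓘(ℝ, E) 𝓘(ℝ, ℝ) (f ∘ ch.symm) (ch x) (L u) = _
    rw [mfderiv_eq_fderiv]
    rfl
  have h3 : DiffForm.d (fun x => f x • α.d x) x v =
      extDeriv (DiffForm.inChart (fun x => f x • α.d x) x) (ch x) fun l => L (v l) := rfl
  rw [h3, h1.extDeriv_eq, extDeriv_smul_extDeriv hα.self_of_nhds (hfc.differentiableAt (by simp))]
  refine Finset.sum_congr rfl fun l _ => ?_
  rw [← h2, mul_comm (f x), mul_assoc]
  rfl

/-- Smooth forms that agree at points arbitrarily close to `x` agree at `x`. -/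
theorem DiffForm.eq_of_frequently_eq (hα : α.SmoothAt x) (hβ : β.SmoothAt x)
    (h : ∃ᶠ x' in 𝓝 x, α x' = β x') : α x = β x := by
  refine DiffForm.eq_of_inChart_eq ?_
  refine tendsto_nhds_unique_of_frequently_eq (ContDiffAt.continuousAt hα).tendsto
    (ContDiffAt.continuousAt hβ).tendsto ?_
  have h1 : ∃ᶠ x' in 𝓝 x, α.inChart x (extChartAt 𝓘(ℝ, E) x x') =
      β.inChart x (extChartAt 𝓘(ℝ, E) x x') := by
    refine (h.and_eventually (extChartAt_source_mem_nhds (I := 𝓘(ℝ, E)) x)).mono ?_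
    rintro x' ⟨h1, h2⟩
    have h3 : α ((extChartAt 𝓘(ℝ, E) x).symm (extChartAt 𝓘(ℝ, E) x x')) =
        β ((extChartAt 𝓘(ℝ, E) x).symm (extChartAt 𝓘(ℝ, E) x x')) := by
      rw [PartialEquiv.left_inv _ h2]; exact h1
    simp only [DiffForm.inChart, DiffForm.pullback]
    rw [h3]
  exact (continuousAt_extChartAt (I := 𝓘(ℝ, E)) x).tendsto.frequently h1

theorem bijective_mfderiv_extChartAt_symm {y : E} (hy : y ∈ (extChartAt 𝓘(ℝ, E) x).target) :
    Function.Bijective (mfderiv 𝓘(ℝ, E) 𝓘(ℝ, E) (extChartAt 𝓘(ℝ, E) x).symm y) := by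
  set ch := extChartAt 𝓘(ℝ, E) x with hch
  have hs : ch.symm y ∈ ch.source := ch.map_target hy
  have hsrc : ch.symm y ∈ (chartAt E x).source := by rwa [← extChartAt_source 𝓘(ℝ, E)]
  have h1 : MDifferentiableAt 𝓘(ℝ, E) 𝓘(ℝ, E) ch.symm y :=
    (contMDiffAt_extChartAt_symm x hy).mdifferentiableAt (by simp)
  have h2 : MDifferentiableAt 𝓘(ℝ, E) 𝓘(ℝ, E) ch (ch.symm y) :=
    (contMDiffAt_extChartAt' (n := ∞) hsrc).mdifferentiableAt (by simp)
  constructor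
  · refine injective_mfderiv_of_leftInverse h1 h2 ?_
    filter_upwards [(isOpen_extChartAt_target x).mem_nhds hy] with y' hy'
    exact ch.right_inv hy'
  · refine surjective_mfderiv_of_rightInverse (ch.right_inv hy) h1 h2 ?_
    filter_upwards [(isOpen_extChartAt_source x).mem_nhds hs] with x' hx'
    exact ch.left_inv hx'

/-- Non-degeneracy is an open condition. -/
theorem DiffForm.NondegenerateAt.exists_eventually_add_smul [FiniteDimensional ℝ E]
    {α β : DiffForm E B 2} (hα : α.SmoothAt x) (hβ : β.SmoothAt x) (h : α.NondegenerateAt x) :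
    ∃ s₀ : ℝ, 0 < s₀ ∧ ∀ᶠ x' in 𝓝 x, ∀ s, 0 < s → s < s₀ → (α + s • β).NondegenerateAt x' := by
  set ch := extChartAt 𝓘(ℝ, E) x with hch
  have h1 : Nondegenerate₂ (α.inChart x (ch x)) := by
    refine DiffForm.NondegenerateAt.pull
      (bijective_mfderiv_extChartAt_symm (mem_extChartAt_target x)) ?_
    rwa [extChartAt_to_inv]
  -- Joint continuity in the coefficient and the point is what yields a single bound s₀ for all
  -- nearby points.
  have hc : ContinuousAt (fun p : ℝ × E => α.inChart x p.2 + p.1 • β.inChart x p.2) (0, ch x) := by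
    refine ContinuousAt.add ?_ (continuousAt_fst.smul ?_)
    · exact ContinuousAt.comp (g := α.inChart x) (ContDiffAt.continuousAt hα) continuousAt_snd
    · exact ContinuousAt.comp (g := β.inChart x) (ContDiffAt.continuousAt hβ) continuousAt_snd
  have h2 : ∀ᶠ p : ℝ × E in 𝓝 (0, ch x),
      Nondegenerate₂ (α.inChart x p.2 + p.1 • β.inChart x p.2) := by
    refine hc.eventually (Nondegenerate₂.eventually ?_)
    simpa using h1
  rw [nhds_prod_eq] at h2
  obtain ⟨p, hp, q, hq, hpq⟩ := eventually_prod_iff.1 h2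
  obtain ⟨s₀, hs₀, hs⟩ := Metric.eventually_nhds_iff_ball.1 hp
  refine ⟨s₀, hs₀, ?_⟩
  filter_upwards [(continuousAt_extChartAt (I := 𝓘(ℝ, E)) x).eventually hq,
    extChartAt_source_mem_nhds (I := 𝓘(ℝ, E)) x] with x' h3 h4 s hs1 hs2
  have h5 := hpq (hs s (by simp [abs_of_pos hs1, hs2])) h3
  have h6 : ch.symm (ch x') = x' := ch.left_inv h4
  rw [← h6]
  exact DiffForm.NondegenerateAt.of_pull
    (bijective_mfderiv_extChartAt_symm (ch.map_source h4)).2 h5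

variable {H : Type*} [NormedAddCommGroup H] [InnerProductSpace ℂ H]

/-- This is `extDeriv_angularForm_pull_smul` read in the chart at x: the two pullbacks differ by d
arg T. -/
theorem d_pullback_angularForm_smul {C : B → H} {T : B → ℂ}
    (hC : ContMDiffAt 𝓘(ℝ, E) 𝓘(ℝ, H) ∞ C x) (hT : ContMDiffAt 𝓘(ℝ, E) 𝓘(ℝ, ℂ) ∞ T x)
    (hCx : C x ≠ 0) (hTx : T x ≠ 0) :
    (DiffForm.pullback (E := E) (fun x => T x • C x) (angularForm H)).d x =
      (DiffForm.pullback (E := E) C (angularForm H)).d x := by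
  have hx : (extChartAt 𝓘(ℝ, E) x).symm (extChartAt 𝓘(ℝ, E) x x) = x := extChartAt_to_inv x
  have hTC : ContMDiffAt 𝓘(ℝ, E) 𝓘(ℝ, H) ∞ (fun x => T x • C x) x :=
    (contDiff_fst.smul contDiff_snd : ContDiff ℝ ∞ fun p : ℂ × H => p.1 • p.2).contMDiff.contMDiffAt.comp
      x (hT.prodMk_space hC)
  have key : ∀ {f : B → H}, ContMDiffAt 𝓘(ℝ, E) 𝓘(ℝ, H) ∞ f x →
      extDeriv ((DiffForm.pullback (E := E) f (angularForm H)).inChart x)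
        (extChartAt 𝓘(ℝ, E) x x) =
      extDeriv ((angularForm H).pull (f ∘ (extChartAt 𝓘(ℝ, E) x).symm))
        (extChartAt 𝓘(ℝ, E) x x) := by
    intro f hf
    refine Filter.EventuallyEq.extDeriv_eq ?_
    exact DiffForm.pull_pullback_eventuallyEq _ (by rwa [hx])
      (contMDiffAt_extChartAt_symm_center x)
  have h := extDeriv_angularForm_pull_smul (contDiffAt_comp_extChartAt_symm hC)
    (contDiffAt_comp_extChartAt_symm hT) (by rwa [Function.comp, hx]) (by rwa [Function.comp, hx])
  unfold DiffForm.d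
  rw [key hTC, key hC, ← h]
  rfl

end Calculus

/-! ### Gluing the angular form and perturbing the pulled back form. -/

section Gluing

variable {E : Type*} [NormedAddCommGroup E] [NormedSpace ℝ E]
  {B : Type*} [TopologicalSpace B] [ChartedSpace E B] [IsManifold 𝓘(ℝ, E) ∞ B]
  {H : Type*} [NormedAddCommGroup H] [InnerProductSpace ℂ H] {k : ℕ}

theorem DiffForm.pullback_congr {f g : B → H} {x : B} (α : DiffForm H H k) (h : f =ᶠ[𝓝 x] g) :
    DiffForm.pullback (E := E) f α x = DiffForm.pullback (E := E) g α x := by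
  have h1 : f x = g x := h.eq_of_nhds
  have h2 := h.mfderiv_eq (I := 𝓘(ℝ, E)) (I' := 𝓘(ℝ, H))
  simp only [DiffForm.pullback]
  rw [h2]
  have key : ∀ (p q : H) (_ : p = q) (u : Fin k → H), α p u = α q u := by
    rintro p _ rfl u; rfl
  ext v
  exact key _ _ h1 _

theorem DiffForm.smoothAt_of_eventually_eq_zero {α : DiffForm E B k} {x : B}
    (h : ∀ᶠ x' in 𝓝 x, α x' = 0) : α.SmoothAt x := by
  refine DiffForm.SmoothAt.congr (α := 0) ?_ (h.mono fun x' hx' => hx'.symm)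
  have h0 : (0 : DiffForm E B k).inChart x = fun _ => 0 := by
    funext y
    ext v
    rfl
  rw [DiffForm.SmoothAt, h0]
  exact contDiffAt_const

theorem DiffForm.wedgeOne_add (θ : DiffForm E B 1) (α β : DiffForm E B k) (x : B)
    (v : Fin (k + 1) → TangentSpace 𝓘(ℝ, E) x) : DiffForm.wedgeOne θ (α + β) x v =
      DiffForm.wedgeOne θ α x v + DiffForm.wedgeOne θ β x v := by
  simp only [DiffForm.wedgeOne]
  rw [← Finset.sum_add_distrib]
  refine Finset.sum_congr rfl fun l _ => ?_
  rw [← mul_add, ← mul_add]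
  rfl

theorem DiffForm.wedgeOne_congr (θ : DiffForm E B 1) {α β : DiffForm E B k} {x : B}
    (h : α x = β x) (v : Fin (k + 1) → TangentSpace 𝓘(ℝ, E) x) :
    DiffForm.wedgeOne θ α x v = DiffForm.wedgeOne θ β x v := by
  simp only [DiffForm.wedgeOne, h]

variable [FiniteDimensional ℝ E] [T2Space B] [SecondCountableTopology B]

/-- Locally defined maps `C`, which differ by nonvanishing scalar factors from a fixed map `ψ` off
`S`, define a global `2`-form equal to the differential of the angular form of `C` near `S`. -/
theorem exists_angular_two_form {S : Set B} (hS : IsCompact S) (hSc : S ⊆ closure Sᶜ)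
    {O : Set B} (hO : IsOpen O) (hSO : S ⊆ O) {ψ : B → H}
    (hψ : ∀ b₀ ∈ S, ∀ᶠ b in 𝓝 b₀, ContMDiffAt 𝓘(ℝ, E) 𝓘(ℝ, H) ∞ ψ b ∧ (ψ b = 0 ↔ b ∈ S))
    {C : B → B → H} {T : B → B → ℂ}
    (hC : ∀ b₀ ∈ S, ∀ᶠ b in 𝓝 b₀, ContMDiffAt 𝓘(ℝ, E) 𝓘(ℝ, H) ∞ (C b₀) b ∧
      ContMDiffAt 𝓘(ℝ, E) 𝓘(ℝ, ℂ) ∞ (T b₀) b ∧ C b₀ b ≠ 0 ∧ ψ b = T b₀ b • C b₀ b) :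
    ∃ (τ : DiffForm E B 2) (K : Set B), IsCompact K ∧ S ⊆ K ∧ K ⊆ O ∧ (∀ b ∉ K, τ b = 0) ∧
      (∀ b₀, ∃ β : DiffForm E B 1, ∀ᶠ b in 𝓝 b₀, β.SmoothAt b ∧ τ b = β.d b) ∧
      ∀ b₀ ∈ S, ∀ᶠ b in 𝓝 b₀,
        τ b = (DiffForm.pullback (E := E) (C b₀) (angularForm H)).d b := by
  classical
  have : LocallyCompactSpace B := Manifold.locallyCompact_of_finiteDimensional 𝓘(ℝ, E)
  -- The support must stay where ψ is smooth with zero set S, so that the angular form can be pulled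
  -- back along ψ at every point of K off S.
  let O' : Set B := O ∩ {b | ∀ᶠ b' in 𝓝 b, ContMDiffAt 𝓘(ℝ, E) 𝓘(ℝ, H) ∞ ψ b' ∧
    (ψ b' = 0 ↔ b' ∈ S)}
  obtain ⟨K, hK, hSK, hKO⟩ := exists_compact_between hS (hO.inter isOpen_setOfPred_eventually_nhds)
    (fun b hb => ⟨hSO hb, hψ b hb⟩ : S ⊆ O')
  obtain ⟨χ, hχ1, hχ0, -⟩ := exists_contMDiffMap_one_nhds_of_subset_interior 𝓘(ℝ, E) (n := ⊤)
    hS.isClosed hSK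
  have hχ1' : ∀ b₀ ∈ S, ∀ᶠ b in 𝓝 b₀, χ b = 1 := fun b₀ hb₀ =>
    (eventually_nhdsSet_iff_forall.1 hχ1) b₀ hb₀
  -- The cut-off angular form is smooth off S only; it is its differential that extends across S.
  let β₀ : DiffForm E B 1 := fun b => χ b • DiffForm.pullback (E := E) ψ (angularForm H) b
  have hβ₀0 : ∀ b ∉ K, β₀ b = 0 := fun b hb => by simp only [β₀, hχ0 b hb, zero_smul]
  have hnear : ∀ b ∉ K, ∀ᶠ b' in 𝓝 b, b' ∉ K := fun b hb => hK.isClosed.isOpen_compl.mem_nhds hb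
  have hSnear : ∀ b ∉ S, ∀ᶠ b' in 𝓝 b, b' ∉ S := fun b hb => hS.isClosed.isOpen_compl.mem_nhds hb
  have hβ₀s : ∀ b ∉ S, β₀.SmoothAt b := by
    intro b hb
    by_cases hbK : b ∈ K
    · obtain ⟨h1, h2⟩ := (hKO hbK).2.self_of_nhds
      exact DiffForm.SmoothAt.smul χ.contMDiff.contMDiffAt
        (DiffForm.SmoothAt.pullback (smoothAt_angularForm fun h => hb (h2.1 h)) h1)
    · exact DiffForm.smoothAt_of_eventually_eq_zero ((hnear b hbK).mono hβ₀0)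
  let A : B → DiffForm E B 1 := fun b₀ => DiffForm.pullback (E := E) (C b₀) (angularForm H)
  -- At a point of S the local map attached to that very point is used. `hon` shows that these
  -- choices agree with each other and with the differential of β₀.
  let τ : DiffForm E B 2 := fun b => (if b ∈ S then A b else β₀).d b
  have hτS : ∀ b ∈ S, τ b = (A b).d b := fun b hb => by simp only [τ, if_pos hb]
  have hτ : ∀ b ∉ S, τ b = β₀.d b := fun b hb => by simp only [τ, if_neg hb]
  have hA : ∀ b₀ ∈ S, ∀ᶠ b in 𝓝 b₀, (A b₀).SmoothAt b := fun b₀ hb₀ =>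
    (hC b₀ hb₀).mono fun b hb => DiffForm.SmoothAt.pullback (smoothAt_angularForm hb.2.2.1) hb.1
  -- Near S the cut-off is 1 and ψ = T • C with T nonzero off S, so replacing ψ by C does not change
  -- the differential.
  have hoff : ∀ b₀ ∈ S, ∀ᶠ b in 𝓝 b₀, b ∉ S → β₀.d b = (A b₀).d b := by
    intro b₀ hb₀
    filter_upwards [hψ b₀ hb₀, (hC b₀ hb₀).eventually_nhds, (hχ1' b₀ hb₀).eventually_nhds]
      with b h1 h2 h3 hbS
    obtain ⟨hCb, hTb, hC0, hψb⟩ := h2.self_of_nhds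
    have hT0 : T b₀ b ≠ 0 := by
      intro h0
      exact hbS (h1.2.1 (by rw [hψb, h0, zero_smul]))
    have h4 : ∀ᶠ b' in 𝓝 b, β₀ b' =
        DiffForm.pullback (E := E) (fun x => T b₀ x • C b₀ x) (angularForm H) b' := by
      filter_upwards [h2.eventually_nhds, h3] with b' h5 h6
      simp only [β₀, h6, one_smul]
      exact DiffForm.pullback_congr _ (h5.mono fun x hx => hx.2.2.2)
    rw [DiffForm.d_congr h4]
    exact d_pullback_angularForm_smul hCb hTb hC0 hT0
  have hon : ∀ b₀ ∈ S, ∀ᶠ b in 𝓝 b₀, τ b = (A b₀).d b := by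
    intro b₀ hb₀
    filter_upwards [(hoff b₀ hb₀).eventually_nhds, (hA b₀ hb₀).eventually_nhds] with b h1 h2
    by_cases hbS : b ∈ S
    · rw [hτS b hbS]
      refine DiffForm.eq_of_frequently_eq (DiffForm.SmoothAt.d (hA b hbS))
        (DiffForm.SmoothAt.d h2) ?_
      -- The forms attached to b and to b₀ have the same differential at nearby points off S. Such
      -- points accumulate at b, so continuity gives equality at b.
      have h3 : ∃ᶠ b' in 𝓝 b, b' ∈ Sᶜ := mem_closure_iff_frequently.1 (hSc hbS)
      refine (h3.and_eventually (h1.and (hoff b hbS))).mono ?_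
      rintro b' ⟨h4, h5, h6⟩
      rw [← h6 h4, h5 h4]
    · rw [hτ b hbS, h1.self_of_nhds hbS]
  refine ⟨τ, K, hK, hSK.trans interior_subset, hKO.trans inter_subset_left, ?_, ?_, hon⟩
  · intro b hb
    rw [hτ b fun h => hb (interior_subset (hSK h)),
      DiffForm.d_congr (β := 0) ((hnear b hb).mono hβ₀0)]
    have h0 : (0 : DiffForm E B 1).inChart b = fun _ => 0 := by
      funext y
      ext v
      rfl
    have h1 : extDeriv (fun _ : E => (0 : E [⋀^Fin 1]→L[ℝ] ℝ)) (extChartAt 𝓘(ℝ, E) b b) = 0 := by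
      have h2 := extDeriv_smul (0 : ℝ) (fun _ : E => (0 : E [⋀^Fin 1]→L[ℝ] ℝ))
        (x := extChartAt 𝓘(ℝ, E) b b)
      rw [zero_smul, zero_smul] at h2
      exact h2
    unfold DiffForm.d
    rw [h0, h1]
    rfl
  · intro b₀
    by_cases hb₀ : b₀ ∈ S
    · exact ⟨A b₀, (hA b₀ hb₀).and (hon b₀ hb₀)⟩
    · exact ⟨β₀, (hSnear b₀ hb₀).mono fun b hb => ⟨hβ₀s b hb, hτ b hb⟩⟩

/-- Perturbing a `2`-form degenerate along a compact set to a locally conformal symplectic form. -/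
theorem exists_isLCS_of_local_directions {Ω₁ : DiffForm E B 2} {θ : DiffForm E B 1}
    (hΩs : Ω₁.IsSmooth) (hθs : θ.IsSmooth) (hθd : ∀ x, θ.d x = 0)
    (hd : ∀ x v, Ω₁.d x v = DiffForm.wedgeOne θ Ω₁ x v) {S : Set B} (hS : IsCompact S)
    (hSc : S ⊆ closure Sᶜ) (hnd : ∀ b ∉ S, Ω₁.NondegenerateAt b) {G : B → ℝ}
    (hG : ∀ b₀ ∈ S, ∀ᶠ b in 𝓝 b₀, ContMDiffAt 𝓘(ℝ, E) 𝓘(ℝ, ℝ) ∞ G b ∧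
      ∀ u : TangentSpace 𝓘(ℝ, E) b, θ b ![u] = mfderiv 𝓘(ℝ, E) 𝓘(ℝ, ℝ) G b u)
    {ψ : B → H}
    (hψ : ∀ b₀ ∈ S, ∀ᶠ b in 𝓝 b₀, ContMDiffAt 𝓘(ℝ, E) 𝓘(ℝ, H) ∞ ψ b ∧ (ψ b = 0 ↔ b ∈ S))
    (hloc : ∀ b₀ ∈ S, ∃ (C : B → H) (T : B → ℂ) (s₀ : ℝ), 0 < s₀ ∧ ∀ᶠ b in 𝓝 b₀,
      ContMDiffAt 𝓘(ℝ, E) 𝓘(ℝ, H) ∞ C b ∧ ContMDiffAt 𝓘(ℝ, E) 𝓘(ℝ, ℂ) ∞ T b ∧ C b ≠ 0 ∧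
      ψ b = T b • C b ∧ ∀ s : ℝ, 0 < s → s < s₀ →
        (Ω₁ + s • (DiffForm.pullback (E := E) C (angularForm H)).d).NondegenerateAt b) :
    ∃ Ω' : DiffForm E B 2, IsLCS Ω' θ := by
  -- Default values off S, so that C, T and s₀ can be chosen as functions on all of B.
  have hloc' : ∀ b₀, ∃ (C : B → H) (T : B → ℂ) (s₀ : ℝ), b₀ ∈ S → 0 < s₀ ∧ ∀ᶠ b in 𝓝 b₀,
      ContMDiffAt 𝓘(ℝ, E) 𝓘(ℝ, H) ∞ C b ∧ ContMDiffAt 𝓘(ℝ, E) 𝓘(ℝ, ℂ) ∞ T b ∧ C b ≠ 0 ∧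
      ψ b = T b • C b ∧ ∀ s : ℝ, 0 < s → s < s₀ →
        (Ω₁ + s • (DiffForm.pullback (E := E) C (angularForm H)).d).NondegenerateAt b := by
    intro b₀
    by_cases hb₀ : b₀ ∈ S
    · obtain ⟨C, T, s₀, h⟩ := hloc b₀ hb₀
      exact ⟨C, T, s₀, fun _ => h⟩
    · exact ⟨0, 0, 0, fun h => absurd h hb₀⟩
  choose C T s₀ hCT using hloc'
  let O : Set B := {b₀ | ∀ᶠ b in 𝓝 b₀, ContMDiffAt 𝓘(ℝ, E) 𝓘(ℝ, ℝ) ∞ G b ∧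
      ∀ u : TangentSpace 𝓘(ℝ, E) b, θ b ![u] = mfderiv 𝓘(ℝ, E) 𝓘(ℝ, ℝ) G b u}
  obtain ⟨τ, K, hK, hSK, hKO, hτ0, hτd, hτS⟩ := exists_angular_two_form (O := O) hS hSc
    isOpen_setOfPred_eventually_nhds hG hψ (C := C) (T := T) fun b₀ hb₀ =>
      (hCT b₀ hb₀).2.mono fun b hb => ⟨hb.1, hb.2.1, hb.2.2.1, hb.2.2.2.1⟩
  -- On K one has θ = dG and τ is locally exact, so d(s e^G τ) = θ ∧ s e^G τ. Off K the added term
  -- is 0, so the values of G there do not matter.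
  let form : ℝ → DiffForm E B 2 := fun s => Ω₁ + fun b => (s * Real.exp (G b)) • τ b
  have hsm := DiffForm.isSmooth_iff.1 hΩs
  have hf : ∀ s : ℝ, ∀ b, ContMDiffAt 𝓘(ℝ, E) 𝓘(ℝ, ℝ) ∞ G b →
      ContMDiffAt 𝓘(ℝ, E) 𝓘(ℝ, ℝ) ∞ (fun b => s * Real.exp (G b)) b := fun s b hb =>
    (contDiff_const.mul Real.contDiff_exp : ContDiff ℝ ∞ fun x : ℝ =>
      s * Real.exp x).contMDiff.contMDiffAt.comp b hb
  have hdf : ∀ s : ℝ, ∀ b, ContMDiffAt 𝓘(ℝ, E) 𝓘(ℝ, ℝ) ∞ G b →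
      (∀ u : TangentSpace 𝓘(ℝ, E) b, θ b ![u] = mfderiv 𝓘(ℝ, E) 𝓘(ℝ, ℝ) G b u) →
      ∀ u : TangentSpace 𝓘(ℝ, E) b, s * Real.exp (G b) * θ b ![u] =
        mfderiv 𝓘(ℝ, E) 𝓘(ℝ, ℝ) (fun b => s * Real.exp (G b)) b u := by
    intro s b hb hu u
    have h1 : HasFDerivAt (fun x : ℝ => s * Real.exp x)
        (ContinuousLinearMap.toSpanSingleton ℝ (s * Real.exp (G b))) (G b) :=
      ((Real.hasDerivAt_exp (G b)).const_mul s).hasFDerivAt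
    have h2 := DFunLike.congr_fun (mfderiv_comp b (h1.differentiableAt.mdifferentiableAt)
      (hb.mdifferentiableAt (by simp))) u
    rw [hu u]
    refine Eq.trans ?_ h2.symm
    change _ = mfderiv 𝓘(ℝ, ℝ) 𝓘(ℝ, ℝ) (fun x : ℝ => s * Real.exp x) (G b)
      (mfderiv 𝓘(ℝ, E) 𝓘(ℝ, ℝ) G b u)
    rw [mfderiv_eq_fderiv, h1.fderiv]
    exact mul_comm (s * Real.exp (G b)) (show ℝ from mfderiv 𝓘(ℝ, E) 𝓘(ℝ, ℝ) G b u)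
  have hlcs : ∀ s : ℝ, (form s).IsSmooth ∧
      ∀ x v, (form s).d x v = DiffForm.wedgeOne θ (form s) x v := by
    intro s
    rw [DiffForm.isSmooth_iff, ← forall_and]
    intro b₀
    by_cases hb₀ : b₀ ∈ K
    · obtain ⟨β, hβ⟩ := hτd b₀
      have hG₀ := (hKO hb₀ : ∀ᶠ b in 𝓝 b₀, _).self_of_nhds
      let β' : DiffForm E B 2 := fun b => (s * Real.exp (G b)) • β.d b
      have h1 : ∀ᶠ b in 𝓝 b₀, (Ω₁ + β') b = form s b := by
        filter_upwards [hβ] with b hb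
        change Ω₁ b + (s * Real.exp (G b)) • β.d b = Ω₁ b + (s * Real.exp (G b)) • τ b
        rw [hb.2]
      have h2 : β'.SmoothAt b₀ := DiffForm.SmoothAt.smul (hf s b₀ hG₀.1)
        (DiffForm.SmoothAt.d (hβ.mono fun b hb => hb.1))
      refine ⟨((hsm b₀).add h2).congr h1, fun v => ?_⟩
      rw [← DiffForm.d_congr h1, DiffForm.d_add (hsm b₀) h2,
        ← DiffForm.wedgeOne_congr θ h1.self_of_nhds, DiffForm.wedgeOne_add, ← hd,
        ← DiffForm.d_smul_d (hf s b₀ hG₀.1) (hdf s b₀ hG₀.1 hG₀.2)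
          (hβ.mono fun b hb => hb.1)]
      rfl
    · have h1 : ∀ᶠ b in 𝓝 b₀, Ω₁ b = form s b := by
        filter_upwards [hK.isClosed.isOpen_compl.mem_nhds hb₀] with b hb
        change Ω₁ b = Ω₁ b + (s * Real.exp (G b)) • τ b
        rw [hτ0 b hb, smul_zero, add_zero]
      refine ⟨(hsm b₀).congr h1, fun v => ?_⟩
      rw [← DiffForm.d_congr h1, hd, DiffForm.wedgeOne_congr θ h1.self_of_nhds]
  have hKnd : ∃ s₁ : ℝ, 0 < s₁ ∧ ∀ b ∈ K, ∀ s, 0 < s → s < s₁ → (form s).NondegenerateAt b := by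
    -- Local bounds on s are combined into one bound on K: compactness reduces to finite unions,
    -- where the minimum works.
    refine hK.induction_on (p := fun K => ∃ s₁ : ℝ, 0 < s₁ ∧ ∀ b ∈ K, ∀ s, 0 < s → s < s₁ →
      (form s).NondegenerateAt b) ⟨1, one_pos, by simp⟩ ?_ ?_ ?_
    · rintro K₁ K₂ h ⟨s₁, h1, h2⟩
      exact ⟨s₁, h1, fun b hb => h2 b (h hb)⟩
    · rintro K₁ K₂ ⟨s₁, h1, h2⟩ ⟨s₂, h3, h4⟩
      refine ⟨min s₁ s₂, lt_min h1 h3, ?_⟩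
      rintro b (hb | hb) s hs1 hs2
      · exact h2 b hb s hs1 (hs2.trans_le (min_le_left _ _))
      · exact h4 b hb s hs1 (hs2.trans_le (min_le_right _ _))
    · intro b₀ hb₀
      have hG₀ := (hKO hb₀ : ∀ᶠ b in 𝓝 b₀, _).self_of_nhds
      by_cases hbS : b₀ ∈ S
      · obtain ⟨hs₀, hev⟩ := hCT b₀ hbS
        -- The coefficient of τ at b is s e^{G b} rather than a constant. As e^G < m near b₀, the
        -- condition s < s₀ / m keeps it below the bound for b₀.
        let m : ℝ := Real.exp (G b₀) + 1
        have hm : 0 < m := by positivity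
        have hGm : ∀ᶠ b in 𝓝 b₀, Real.exp (G b) < m := by
          have hc : ContinuousAt (fun b => Real.exp (G b)) b₀ :=
            Real.continuous_exp.continuousAt.comp hG₀.1.continuousAt
          exact hc.eventually (Iio_mem_nhds (lt_add_one _))
        refine ⟨{b | ∀ s, 0 < s → s < s₀ b₀ / m → (form s).NondegenerateAt b},
          mem_nhdsWithin_of_mem_nhds ?_, s₀ b₀ / m, div_pos hs₀ hm, fun b hb => hb⟩
        filter_upwards [hev, hGm, hτS b₀ hbS] with b h1 h2 h3 s hs1 hs2
        have h4 := h1.2.2.2.2 (s * Real.exp (G b)) (by positivity) (by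
          rw [lt_div_iff₀ hm] at hs2
          exact (mul_lt_mul_of_pos_left h2 hs1).trans hs2)
        have h5 : (Ω₁ + (s * Real.exp (G b)) •
            (DiffForm.pullback (E := E) (C b₀) (angularForm H)).d) b = form s b := by
          change Ω₁ b + (s * Real.exp (G b)) • (DiffForm.pullback (E := E) (C b₀)
            (angularForm H)).d b = Ω₁ b + (s * Real.exp (G b)) • τ b
          rw [h3]
        unfold DiffForm.NondegenerateAt at h4 ⊢
        rwa [← h5]
      · obtain ⟨β, hβ⟩ := hτd b₀
        -- Off S the form Ω₁ is itself non-degenerate, and openness of that condition bounds s.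
        let β' : DiffForm E B 2 := fun b => Real.exp (G b) • β.d b
        have hβ's : β'.SmoothAt b₀ := DiffForm.SmoothAt.smul
          (by simpa using hf 1 b₀ hG₀.1) (DiffForm.SmoothAt.d (hβ.mono fun b hb => hb.1))
        obtain ⟨s₁, hs₁, h1⟩ := (hnd b₀ hbS).exists_eventually_add_smul (hsm b₀) hβ's
        refine ⟨{b | ∀ s, 0 < s → s < s₁ → (form s).NondegenerateAt b},
          mem_nhdsWithin_of_mem_nhds ?_, s₁, hs₁, fun b hb => hb⟩
        filter_upwards [h1, hβ] with b h2 h3 s hs1 hs2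
        have h4 := h2 s hs1 hs2
        have h5 : (Ω₁ + s • β') b = form s b := by
          change Ω₁ b + s • (Real.exp (G b) • β.d b) = Ω₁ b + (s * Real.exp (G b)) • τ b
          rw [h3.2, smul_smul]
        unfold DiffForm.NondegenerateAt at h4 ⊢
        rwa [← h5]
  obtain ⟨s₁, hs₁, hKnd⟩ := hKnd
  refine ⟨form (s₁ / 2), (hlcs _).1, hθs, ?_, hθd, (hlcs _).2⟩
  rw [DiffForm.isNondegenerate_iff]
  intro b
  by_cases hb : b ∈ K
  · exact hKnd b hb _ (by positivity) (by linarith)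
  · have h1 : Ω₁ b = form (s₁ / 2) b := by
      change Ω₁ b = Ω₁ b + (s₁ / 2 * Real.exp (G b)) • τ b
      rw [hτ0 b hb, smul_zero, add_zero]
    have h2 := hnd b fun h => hb (hSK h)
    unfold DiffForm.NondegenerateAt at h2 ⊢
    rwa [← h1]

end Gluing

/-! ### The pulled back structure on the blow-up. -/

section Setup

variable {E : Type*} [NormedAddCommGroup E] [NormedSpace ℝ E]
  {M : Type*} [TopologicalSpace M] [ChartedSpace E M] [IsManifold 𝓘(ℝ, E) ∞ M]
  {E' : Type*} [NormedAddCommGroup E'] [NormedSpace ℝ E']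
  {Z : Type*} [TopologicalSpace Z] [ChartedSpace E' Z] [IsManifold 𝓘(ℝ, E') ∞ Z]
  {F : Type*} [NormedAddCommGroup F] [NormedSpace ℝ F]
  {N : Z → Type*} [∀ z, AddCommGroup (N z)] [∀ z, Module ℂ (N z)]
  [∀ z, TopologicalSpace (N z)] [TopologicalSpace (TotalSpace F N)]
  [FiberBundle F N] [VectorBundle ℝ F N] [ContMDiffVectorBundle ∞ F N 𝓘(ℝ, E')]
  {B : Type*} [TopologicalSpace B] [ChartedSpace E B] [IsManifold 𝓘(ℝ, E) ∞ B]
  {i : Z → M} {ν : ∀ z, N z →ₗ[ℝ] TangentSpace 𝓘(ℝ, E) (i z)}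
  {D : Set (TotalSpace F N)} {φ : TotalSpace F N → M}
  {j : SubspaceVector N → B} {π : B → M}
  {H Y K : Type*} [NormedAddCommGroup H] [InnerProductSpace ℂ H]
  [NormedAddCommGroup Y] [InnerProductSpace ℂ Y] [NormedAddCommGroup K] [InnerProductSpace ℂ K]
  {c : ∀ z, N z →ₗ[ℂ] H} {z₀ : Z} {P : H →L[ℂ] Y} {ι : Y →ₗᵢ[ℂ] H} {γ : E' × Y → TotalSpace F N}
  {U : Set E'}


/-- A primitive of `π^* θ` near the exceptional divisor. -/
theorem eventually_primitive_blowUp [FiniteDimensional ℝ F] [FiniteDimensional ℂ H]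
    [Nonempty (TotalSpace F N)] {θ : DiffForm E M 1} (hθs : θ.IsSmooth)
    (hθd : ∀ x, θ.d x = 0) {f : Z → ℝ} (hfs : ContMDiff 𝓘(ℝ, E') 𝓘(ℝ, ℝ) ∞ f)
    (hi : ContMDiff 𝓘(ℝ, E') 𝓘(ℝ, E) ∞ i)
    (hf : ∀ (z : Z) (u : TangentSpace 𝓘(ℝ, E') z),
      DiffForm.pullback (E := E') i θ z ![u] = mfderiv 𝓘(ℝ, E') 𝓘(ℝ, ℝ) f z u)
    (hφ : IsTubularNeighbourhood E' i ν D φ) (hπ : IsBlowUp E E' i D φ j π)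
    (hc : ∀ z, Function.Injective (c z))
    (hcs : ContMDiff (𝓘(ℝ, E').prod 𝓘(ℝ, F)) 𝓘(ℝ, H) ∞ fun p : TotalSpace F N => c p.proj p.2)
    {b₀ : B} (hb₀ : π b₀ ∈ range i) :
    ∀ᶠ b in 𝓝 b₀,
      ContMDiffAt 𝓘(ℝ, E) 𝓘(ℝ, ℝ) ∞ (tubePrimitive φ θ f ∘ normalLift D φ π) b ∧
      ∀ u : TangentSpace 𝓘(ℝ, E) b, DiffForm.pullback (E := E) π θ b ![u] =
        mfderiv 𝓘(ℝ, E) 𝓘(ℝ, ℝ) (tubePrimitive φ θ f ∘ normalLift D φ π) b u := by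
  have hb₀O : b₀ ∈ π ⁻¹' (φ '' D) := IsBlowUp.preimage_range_subset hφ hb₀
  obtain ⟨z₀, hz₀⟩ : ∃ z₀, normalLift D φ π b₀ = ⟨z₀, 0⟩ := by
    have h1 := (IsBlowUp.mem_exceptional_iff hφ hb₀O).1 hb₀
    generalize normalLift D φ π b₀ = v at h1
    obtain ⟨z, v⟩ := v
    simp only at h1
    exact ⟨z, by rw [h1]⟩
  obtain ⟨Y, _, _, _, ι, hι⟩ := exists_linearIsometry_range_eq (LinearMap.range (c z₀))
  obtain ⟨P, γ, U, h⟩ := exists_isComplexTrivialization c hc hcs z₀ ι hι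
  have h1 := eventually_tubePrimitive hθs hθd hfs hi hf hφ h hcs
  rw [← hz₀] at h1
  have hO : ∀ᶠ b in 𝓝 b₀, b ∈ π ⁻¹' (φ '' D) := (IsBlowUp.isOpen_preimage hφ hπ).mem_nhds hb₀O
  filter_upwards [(IsBlowUp.contMDiffAt_normalLift hφ hπ hb₀O).continuousAt.eventually h1,
    hO, hO.eventually_nhds] with b h2 h3 h4
  have hs := IsBlowUp.contMDiffAt_normalLift hφ hπ h3
  refine ⟨h2.1.comp b hs, fun u => ?_⟩
  have hφs := hφ.contMDiffAt (IsBlowUp.normalLift_mem h3)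
  have e1 : φ ∘ normalLift D φ π =ᶠ[𝓝 b] π := h4.mono fun b' hb' => IsBlowUp.apply_normalLift hb'
  have d1 := DFunLike.congr_fun (mfderiv_comp b (h2.1.mdifferentiableAt (by simp))
    (hs.mdifferentiableAt (by simp))) u
  have d2 := DFunLike.congr_fun ((mfderiv_comp b (hφs.mdifferentiableAt (by simp))
    (hs.mdifferentiableAt (by simp))).symm.trans
    (e1.mfderiv_eq (I := 𝓘(ℝ, E)) (I' := 𝓘(ℝ, E)))) u
  refine Eq.trans ?_ (d1.trans (h2.2 _)).symm
  have key : ∀ (m m' : M) (e : m = m') (x x' : E), x = x' →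
      θ m ![(show TangentSpace 𝓘(ℝ, E) m from x)] =
        θ m' ![(show TangentSpace 𝓘(ℝ, E) m' from x')] := by
    rintro m _ rfl x _ rfl; rfl
  refine Eq.trans ?_ (key _ _ (IsBlowUp.apply_normalLift h3).symm _ _ (Eq.symm d2))
  change θ (π b) _ = _
  congr 1
  ext l; fin_cases l; rfl

/-- The pullback of a locally conformal symplectic structure satisfies all conditions but
non-degeneracy. -/
theorem IsLCS.pullback {Ω : DiffForm E M 2} {θ : DiffForm E M 1} (h : IsLCS Ω θ)
    (hπ : ContMDiff 𝓘(ℝ, E) 𝓘(ℝ, E) ∞ π) :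
    (DiffForm.pullback (E := E) π Ω).IsSmooth ∧ (DiffForm.pullback (E := E) π θ).IsSmooth ∧
      (∀ x, (DiffForm.pullback (E := E) π θ).d x = 0) ∧
      ∀ x v, (DiffForm.pullback (E := E) π Ω).d x v =
        DiffForm.wedgeOne (DiffForm.pullback (E := E) π θ) (DiffForm.pullback (E := E) π Ω) x v := by
  have h1 := DiffForm.isSmooth_iff.1 h.smooth_form
  have h2 := DiffForm.isSmooth_iff.1 h.smooth_lee
  refine ⟨DiffForm.isSmooth_iff.2 fun x => (h1 _).pullback (hπ x),
    DiffForm.isSmooth_iff.2 fun x => (h2 _).pullback (hπ x), fun x => ?_, fun x v => ?_⟩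
  · rw [(h2 _).d_pullback (hπ x)]
    simp only [DiffForm.pullback]
    rw [h.closed_lee]
    rfl
  · rw [(h1 _).d_pullback (hπ x)]
    refine (h.d_eq (π x) fun l => mfderiv 𝓘(ℝ, E) 𝓘(ℝ, E) π x (v l)).trans ?_
    simp only [DiffForm.wedgeOne]
    refine Finset.sum_congr rfl fun l _ => ?_
    congr 2
    change _ = θ (π x) fun m => mfderiv 𝓘(ℝ, E) 𝓘(ℝ, E) π x (![v l] m)
    congr 1
    ext m; fin_cases m; rfl

theorem nondegenerateAt_pullback_blowUp {Ω : DiffForm E M 2} (hΩ : Ω.IsNondegenerate)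
    (hπ : IsBlowUp E E' i D φ j π) {b : B} (hb : π b ∉ range i) :
    (DiffForm.pullback (E := E) π Ω).NondegenerateAt b :=
  DiffForm.NondegenerateAt.pullback
    (mfderiv_bijective_of_localDiffeo (hπ.localDiffeo_compl ⟨b, hb⟩)) (hΩ (π b))

end Setup

end LCS

end

/-! ### The theorem. -/

theorem theorem1p1
    -- the locally conformal symplectic manifold `(M, Ω, θ)`
    {E : Type*} [NormedAddCommGroup E] [NormedSpace ℝ E] [FiniteDimensional ℝ E]
    {M : Type*} [TopologicalSpace M] [T2Space M] [SecondCountableTopology M]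
    [ChartedSpace E M] [IsManifold 𝓘(ℝ, E) ∞ M]
    (Ω : LCS.DiffForm E M 2) (θ : LCS.DiffForm E M 1) (hΩ : LCS.IsLCS Ω θ)
    -- the compact submanifold `i : Z → M`
    {E' : Type*} [NormedAddCommGroup E'] [NormedSpace ℝ E'] [FiniteDimensional ℝ E']
    {Z : Type*} [TopologicalSpace Z] [CompactSpace Z]
    [ChartedSpace E' Z] [IsManifold 𝓘(ℝ, E') ∞ Z]
    (i : Z → M) (hi : Manifold.IsSmoothEmbedding 𝓘(ℝ, E') 𝓘(ℝ, E) ∞ i)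
    (hZΩ : (LCS.DiffForm.pullback (E := E') i Ω).IsNondegenerate)
    (hZθ : (LCS.DiffForm.pullback (E := E') i θ).IsExactOne)
    -- its normal bundle, with a compatible complex structure
    {F : Type*} [NormedAddCommGroup F] [NormedSpace ℝ F]
    {N : Z → Type*} [∀ z, AddCommGroup (N z)] [∀ z, Module ℂ (N z)]
    [∀ z, TopologicalSpace (N z)] [TopologicalSpace (TotalSpace F N)]
    [FiberBundle F N] [VectorBundle ℝ F N] [ContMDiffVectorBundle ∞ F N 𝓘(ℝ, E')]
    (ν : ∀ z, N z →ₗ[ℝ] TangentSpace 𝓘(ℝ, E) (i z)) (hν : LCS.IsNormalBundle E' F Ω i ν)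
    -- a tubular neighbourhood
    (D : Set (TotalSpace F N)) (φ : TotalSpace F N → M)
    (hφ : LCS.IsTubularNeighbourhood E' i ν D φ)
    -- the blow-up `π : B → M` of `M` along `Z`
    {B : Type*} [TopologicalSpace B] [T2Space B] [SecondCountableTopology B]
    [ChartedSpace E B] [IsManifold 𝓘(ℝ, E) ∞ B]
    (j : LCS.SubspaceVector N → B) (π : B → M) (hπ : LCS.IsBlowUp E E' i D φ j π) :
    ∃ Ω' : LCS.DiffForm E B 2, LCS.IsLCS Ω' (LCS.DiffForm.pullback (E := E) π θ) := by
  have hi' := hi.contMDiff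
  obtain ⟨hs, hθs, hθd, hd⟩ := hΩ.pullback hπ.smooth
  have : T2Space Z := hi.isEmbedding.t2Space
  rcases isEmpty_or_nonempty Z with hZ | hZ
  -- If Z is empty, π is a local diffeomorphism everywhere and no correction is needed. Otherwise N
  -- has a point, which the lift of π to N requires as a default value.
  · refine ⟨LCS.DiffForm.pullback (E := E) π Ω, hs, hθs, ?_, hθd, hd⟩
    rw [LCS.DiffForm.isNondegenerate_iff]
    intro b
    exact LCS.nondegenerateAt_pullback_blowUp hΩ.nondegenerate hπ (by
      rintro ⟨z, -⟩
      exact hZ.elim z)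
  have := hν.finiteDimensional hZ
  have : Nonempty (TotalSpace F N) := ⟨⟨hZ.some, 0⟩⟩
  obtain ⟨H, _, _, _, c, hc, hcs⟩ := LCS.exists_fibrewise_embedding
    (fun _ => inferInstance) hν.smooth_I
  obtain ⟨f, hfs, hf⟩ := hZθ
  -- Here ψ is the lift of π to N followed by the fibrewise embedding c. Over the tube it vanishes
  -- exactly on the divisor because c is injective on fibres.
  refine LCS.exists_isLCS_of_local_directions hs hθs hθd hd
    (LCS.IsBlowUp.isCompact_exceptional hφ hπ)
    (fun b hb => LCS.IsBlowUp.exceptional_subset_closure hφ hπ hb)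
    (fun b hb => LCS.nondegenerateAt_pullback_blowUp hΩ.nondegenerate hπ hb)
    (fun b₀ hb₀ => LCS.eventually_primitive_blowUp hΩ.smooth_lee hΩ.closed_lee hfs hi' hf hφ hπ
      hc hcs hb₀)
    (ψ := fun b => c _ (LCS.normalLift D φ π b).2) ?_
    (fun b₀ hb₀ => LCS.exists_local_direction hΩ.smooth_form hi' hZΩ hν hφ hπ hc hcs hb₀)
  intro b₀ hb₀
  filter_upwards [(LCS.IsBlowUp.isOpen_preimage hφ hπ).mem_nhds
    (LCS.IsBlowUp.preimage_range_subset hφ hb₀)] with b hb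
  refine ⟨(hcs _).comp b (LCS.IsBlowUp.contMDiffAt_normalLift hφ hπ hb), ?_⟩
  rw [Set.mem_preimage, LCS.IsBlowUp.mem_exceptional_iff hφ hb]
  exact map_eq_zero_iff _ (hc _)
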